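/- A (real) conic is a point $[f]$ of the projective space $\mathbb{P}(S^2{\mathbb{R}^3}^*)$ of nonzero real ternary quadratic forms up to scaling, with its usual topology; it is proper if $f$ is non-degenerate, and non-empty if $f$ has a zero in $\mathbb{RP}^2$. A pencil of conics is a projective line in $\mathbb{P}(S^2{\mathbb{R}^3}^*)$. A rigid isotopy is a continuous path $t\in[0,1]\mapsto (C_t,D_t)$ in the space of (ordered) couples of distinct proper conics along which, for each $m\ge 1$, the number of real and the number of imaginary (non-real) points of $\mathbb{CP}^2$ at which the two conics intersect with multiplicity $m$ do not change. Two couples are rigidly isotopic if some rigid isotopy connects them. A sliding is a path of the form $t\mapsto([f+tkg],[g])$ or $t\mapsto([f],[g+tkf])$, for $t$ in a closed interval containing $0$, where $f,g$ are non-degenerate non-proportional quadratic forms, $k\in\mathbb{R}$, and $f+tkg$ (respectively $g+tkf$) is non-degenerate for all $t$ in the interval. The group $PGL(3,\mathbb{R})$ acts on conics by $\alpha[f]=[f\circ\alpha^{-1}]$, and diagonally on couples of conics. Lemma. Let $(C_0,D_0)$ and $(C_1,D_1)$ be two couples of distinct proper non-empty conics. If they are rigidly isotopic, then they are also connected by a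 rigid isotopy of the form $t\in[0,1]\mapsto\alpha_t(s_t)$, where - $t\in[0,1]\mapsto s_t$ is a continuous path of couples of conics that is a finite concatenation of slidings (each up to a translation of the time parameter), all conics involved belonging to one fixed pencil of conics; - $t\in[0,1]\mapsto\alpha_t$ is a continuous path in $PGL(3,\mathbb{R})$ with $\alpha_0=\mathrm{id}$. -/

import Mathlib

namespace ConicPairs

open scoped LinearAlgebra.Projectivization Matrix

noncomputable section

/-! ### Real conics -/

/-- The space of real ternary quadratic forms; the form `x ↦ xᵀ A x` is given by its symmetric
matrix `A`. -/
def ternaryForms : Submodule ℝ (Matrix (Fin 3) (Fin 3) ℝ) where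
  carrier := {A | A.IsSymm}
  add_mem' hA hB := hA.add hB
  zero_mem' := Matrix.isSymm_zero
  smul_mem' c _ hA := hA.smul c

/-- A real ternary quadratic form. It carries the subspace topology of the space of matrices. -/
abbrev TernaryForm : Type := ternaryForms

/-- The discriminant: the determinant of the matrix of the form. -/
def TernaryForm.disc (f : TernaryForm) : ℝ := (f : Matrix (Fin 3) (Fin 3) ℝ).det

/-- The value of the form at a vector. -/
def TernaryForm.value (f : TernaryForm) (x : Fin 3 → ℝ) : ℝ :=
  x ⬝ᵥ ((f : Matrix (Fin 3) (Fin 3) ℝ) *ᵥ x)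

/-- (Algebraic) conics: points of the projective space of ternary quadratic forms. -/
abbrev Conic : Type := ℙ ℝ TernaryForm

/-- The space of conics carries the quotient topology from the nonzero forms. -/
instance : TopologicalSpace Conic :=
  inferInstanceAs (TopologicalSpace (Quotient (projectivizationSetoid ℝ TernaryForm)))

/-- `f` is an equation of `C`, i.e. `f ≠ 0` and `C = [f]`. -/
def IsEquation (f : TernaryForm) (C : Conic) : Prop :=
  ∃ hf : f ≠ 0, Projectivization.mk ℝ f hf = C

/-- A conic is proper if its quadratic form is non-degenerate. -/
def Conic.IsProper (C : Conic) : Prop := C.rep.disc ≠ 0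

/-- A conic is non-empty if it has a point in the real projective plane. -/
def Conic.IsNonempty (C : Conic) : Prop := ∃ x : Fin 3 → ℝ, x ≠ 0 ∧ C.rep.value x = 0

/-! ### Complex intersection points and their multiplicities -/

/-- The complex polynomial of a real ternary quadratic form. -/
def TernaryForm.toPoly (f : TernaryForm) : MvPolynomial (Fin 3) ℂ :=
  ∑ i, ∑ j, MvPolynomial.C ((f : Matrix (Fin 3) (Fin 3) ℝ) i j : ℂ) *
    MvPolynomial.X i * MvPolynomial.X j

/-- The homogeneous ideal of the point `[v]` of the complex projective plane: the polynomials
that vanish on the line `ℂ v`, given as the kernel of `F ↦ F (T v₀, T v₁, T v₂)`. -/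
def pointIdeal (v : Fin 3 → ℂ) : Ideal (MvPolynomial (Fin 3) ℂ) :=
  RingHom.ker (MvPolynomial.aeval
    (fun i => Polynomial.C (v i) * Polynomial.X) : MvPolynomial (Fin 3) ℂ →ₐ[ℂ] Polynomial ℂ)

instance (v : Fin 3 → ℂ) : (pointIdeal v).IsPrime := RingHom.ker_isPrime _

/-- The local ring at the point `[v]` of the homogeneous coordinate ring `ℂ[X₀, X₁, X₂]`. -/
abbrev LocalRingAt (v : Fin 3 → ℂ) : Type := Localization.AtPrime (pointIdeal v)

/-- The ideal generated by two forms in the local ring at `[v]`. -/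
def localIdeal (f g : TernaryForm) (v : Fin 3 → ℂ) : Ideal (LocalRingAt v) :=
  Ideal.map (algebraMap (MvPolynomial (Fin 3) ℂ) (LocalRingAt v))
    (Ideal.span {f.toPoly, g.toPoly})

/-- The intersection multiplicity of two conics at a point `p` of the complex projective plane:
the length, over the localization `S_P` of `S = ℂ[X₀, X₁, X₂]` at the homogeneous prime `P` of
`p`, of `S_P / (f, g)`. -/
def intersectionMultiplicity (C D : Conic) (p : ℙ ℂ (Fin 3 → ℂ)) : ℕ∞ :=
  Module.length (LocalRingAt p.rep) (LocalRingAt p.rep ⧸ localIdeal C.rep D.rep p.rep)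

/-- `p` is a (real or imaginary) point of the conic `C`. -/
def Conic.HasPoint (C : Conic) (p : ℙ ℂ (Fin 3 → ℂ)) : Prop :=
  MvPolynomial.eval p.rep C.rep.toPoly = 0

/-- A point of the complex projective plane is real if it has real homogeneous coordinates. -/
def IsRealPoint (p : ℙ ℂ (Fin 3 → ℂ)) : Prop :=
  ∃ (x : Fin 3 → ℝ) (hx : (fun i => (x i : ℂ)) ≠ 0), Projectivization.mk ℂ _ hx = p

/-- The intersection points of multiplicity `m` of the two conics of a couple. -/
def intersections (c : Conic × Conic) (m : ℕ) : Set (ℙ ℂ (Fin 3 → ℂ)) :=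
  {p | c.1.HasPoint p ∧ c.2.HasPoint p ∧ intersectionMultiplicity c.1 c.2 p = m}

/-- The number of real intersections of multiplicity `m`. -/
def numReal (c : Conic × Conic) (m : ℕ) : ℕ∞ :=
  {p ∈ intersections c m | IsRealPoint p}.encard

/-- The number of imaginary (that is, non-real) intersections of multiplicity `m`. -/
def numImaginary (c : Conic × Conic) (m : ℕ) : ℕ∞ :=
  {p ∈ intersections c m | ¬ IsRealPoint p}.encard

/-! ### Rigid isotopy -/

/-- A couple of distinct proper conics. -/
def IsDistinctProper (c : Conic × Conic) : Prop :=
  c.1 ≠ c.2 ∧ c.1.IsProper ∧ c.2.IsProper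

/-- A rigid isotopy: a path of couples of distinct proper conics along which the numbers of real
and of imaginary intersections of each multiplicity do not change. -/
def IsRigidIsotopy {c d : Conic × Conic} (γ : Path c d) : Prop :=
  (∀ t, IsDistinctProper (γ t)) ∧
  ∀ t m, numReal (γ t) m = numReal c m ∧ numImaginary (γ t) m = numImaginary c m

/-- Two couples are rigidly isotopic if a rigid isotopy connects them. -/
def RigidlyIsotopic (c d : Conic × Conic) : Prop :=
  ∃ γ : Path c d, IsRigidIsotopy γ

/-! ### Slidings -/

/-- A sliding on the closed interval `[a, b]` containing `0`: a path of the form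
`t ↦ ([f + t k g], [g])` or `t ↦ ([f], [g + t k f])`, with `f`, `g` non-degenerate and
non-proportional and with no degenerate member. -/
def IsSliding (a b : ℝ) (σ : ℝ → Conic × Conic) : Prop :=
  a ≤ 0 ∧ 0 ≤ b ∧ ∃ (f g : TernaryForm) (k : ℝ),
    f.disc ≠ 0 ∧ g.disc ≠ 0 ∧ LinearIndependent ℝ ![f, g] ∧
    ((∀ t ∈ Set.Icc a b, (f + (t * k) • g).disc ≠ 0 ∧
        IsEquation (f + (t * k) • g) (σ t).1 ∧ IsEquation g (σ t).2) ∨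
      (∀ t ∈ Set.Icc a b, (g + (t * k) • f).disc ≠ 0 ∧
        IsEquation f (σ t).1 ∧ IsEquation (g + (t * k) • f) (σ t).2))

/-- A path parametrized by `[0, 1]` is a (finite) sequence of slidings if there is a subdivision
`0 = τ₀ < τ₁ < ⋯ < τₙ = 1` such that its restriction to each `[τᵢ, τᵢ₊₁]` is a sliding, up to a
translation of the time (which moves the interval so that it contains `0`). -/
def IsSlidingSequence (s : C(unitInterval, Conic × Conic)) : Prop :=
  ∃ (n : ℕ) (τ : ℕ → ℝ), τ 0 = 0 ∧ τ n = 1 ∧ ∀ i < n, τ i < τ (i + 1) ∧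
    ∃ c : ℝ, IsSliding (τ i - c) (τ (i + 1) - c)
      (fun t => Set.IccExtend (zero_le_one : (0 : ℝ) ≤ 1) s (t + c))

/-- The conic `C` belongs to the pencil of conics given by the space `W` of forms. -/
def Conic.MemPencil (C : Conic) (W : Submodule ℝ TernaryForm) : Prop := C.submodule ≤ W

/-! ### The action of `PGL(3, ℝ)` -/

/-- The linear action of an invertible matrix `g` on forms, `f ↦ f ∘ g⁻¹`; it carries the zero
locus of `f` to its image under `g`. -/
def transform (g : GL (Fin 3) ℝ) : TernaryForm →ₗ[ℝ] TernaryForm where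
  toFun f := ⟨(g⁻¹ : GL (Fin 3) ℝ).1ᵀ * f.1 * (g⁻¹ : GL (Fin 3) ℝ).1, by
    have hf : f.1ᵀ = f.1 := f.2
    change (_ : Matrix _ _ ℝ)ᵀ = _
    simp only [Matrix.transpose_mul, Matrix.transpose_transpose, hf, Matrix.mul_assoc]⟩
  map_add' f₁ f₂ := Subtype.ext (by simp [Matrix.mul_add, Matrix.add_mul])
  map_smul' c f := Subtype.ext (by simp)

theorem transform_one : transform 1 = LinearMap.id := by
  ext1 f; exact Subtype.ext (by simp [transform])

theorem transform_mul (g h : GL (Fin 3) ℝ) :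
    transform (g * h) = (transform g).comp (transform h) := by
  ext1 f
  refine Subtype.ext ?_
  simp only [transform, mul_inv_rev, Units.val_mul, Matrix.transpose_mul, LinearMap.coe_mk,
    AddHom.coe_mk, LinearMap.comp_apply, Matrix.mul_assoc]

theorem transform_injective (g : GL (Fin 3) ℝ) : Function.Injective (transform g) := by
  refine Function.LeftInverse.injective (g := transform g⁻¹) fun f => ?_
  rw [← LinearMap.comp_apply, ← transform_mul, inv_mul_cancel, transform_one, LinearMap.id_apply]

/-- `GL(3, ℝ)` acts on conics. -/
instance : MulAction (GL (Fin 3) ℝ) Conic where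
  smul g C := C.map (transform g) (transform_injective g)
  one_smul C := by
    induction C using Projectivization.ind with | h f hf =>
    change Projectivization.mk ℝ (transform 1 f) _ = _
    simp only [transform_one, LinearMap.id_apply]
  mul_smul g h C := by
    induction C using Projectivization.ind with | h f hf =>
    change Projectivization.mk ℝ (transform (g * h) f) _ =
      Projectivization.mk ℝ (transform g (transform h f)) _
    simp only [transform_mul, LinearMap.comp_apply]

/-- The projective general linear group `PGL(3, ℝ)`. -/
abbrev PGL3 : Type := Matrix.ProjGenLinGroup (Fin 3) ℝ

/-- `PGL(3, ℝ)` carries the quotient topology from `GL(3, ℝ)`. -/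
instance : TopologicalSpace PGL3 :=
  inferInstanceAs (TopologicalSpace (GL (Fin 3) ℝ ⧸ Subgroup.center (GL (Fin 3) ℝ)))

/-- The action of `PGL(3, ℝ)` on conics, `[g] • [f] = [f ∘ g⁻¹]`. -/
instance : MulAction PGL3 Conic :=
  Matrix.ProjGenLinGroup.mulActionOfGL fun u C => by
    induction C using Projectivization.ind with | h f hf =>
    change Projectivization.mk ℝ (transform _ f) _ = _
    rw [Projectivization.mk_eq_mk_iff]
    refine ⟨u⁻¹ * u⁻¹, Subtype.ext ?_⟩
    have hu : ((Matrix.GeneralLinearGroup.scalar (Fin 3) u)⁻¹ : GL (Fin 3) ℝ).1 =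
        Matrix.diagonal fun _ => (u⁻¹ : ℝˣ).1 := by
      rw [← map_inv, Matrix.GeneralLinearGroup.coe_scalar]; rfl
    simp only [transform, LinearMap.coe_mk, AddHom.coe_mk]
    rw [hu]
    ext i j
    simp [Units.smul_def, mul_assoc, mul_comm]

end

end ConicPairs

namespace ConicPairs

open scoped LinearAlgebra.Projectivization Matrix Topology

noncomputable section

/-! ### Intersection multiplicities -/

/-! A rigid isotopy carries along the pencil W_t spanned by its two conics. The proof separates the
motion of the pencil, which is realized by the projective group, from the motion of the two conics
inside the pencil, which is realized by slidings.

The pencils. Choose continuous equations f_t, g_t and let B be the traceless part of g⁻¹f, which is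
self-adjoint for g, with characteristic polynomial X³ + pX + q. If its complex roots are distinct,
the pencil has four base points and its orbit under congruence is open: the orbit map is a
submersion, so the inverse function theorem gives a congruence depending continuously on the pencil
(`DiagonalizedBy.exists_local_congruence`). Otherwise there is a double root r, and A = B - r has
characteristic polynomial X²(X - μ) with μ = -3r. The types are: μ ≠ 0 with A(A - μ) ≠ 0; μ ≠ 0 with
A(A - μ) = 0; μ = 0 with A² ≠ 0; μ = 0 with A² = 0 ≠ A. They have 3, 2, 2 and 1 base points
respectively, and explicit bases varying continuously bring nearby pencils of one type to a common
normal form.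

The number of distinct base points is constant along the isotopy, because all multiplicities are
finite. It tells the types apart except for the two with two points, and these are not adjacent:
near a pencil with μ = 0 and A² ≠ 0 the product A(A - μ) stays nonzero, so μ ≠ 0 would give three
points. Hence the pencils are locally congruent (`locallyCongruent_of_encard_eq`), and the local
congruences glue to a path in GL(3, ℝ) starting at 1 (`exists_continuous_congruence`).

The conics. Pulled back by this path, the couple moves in the fixed pencil W_0. The discriminant is
a real cubic on it, so there is a real degenerate member. Removing it leaves an affine line on which
the two conics are points that never meet each other or a degenerate member. Their order is
therefore constant, and one can be moved to its final place before the other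
(`exists_slidingConnected`). The inverse group path applied to these slidings is the required
isotopy. Its intersection numbers are constant because they depend only on the pencil up to
congruence (`numReal_of_map_cong`, `numImaginary_of_map_cong`). -/

theorem length_quotient_of_ringEquiv {R R' : Type*} [CommRing R] [CommRing R'] (e : R ≃+* R')
    (I : Ideal R) (J : Ideal R') (h : J = I.map (e : R →+* R')) :
    Module.length R (R ⧸ I) = Module.length R' (R' ⧸ J) := by
  -- Each quotient has the same length over itself as over the ring it comes from. Lengths over the
  -- two different base rings thus become heights of ideal lattices, which a ring isomorphism
  -- identifies.
  have h1 : Module.length R (R ⧸ I) = Module.length (R ⧸ I) (R ⧸ I) :=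
    Module.length_eq_of_surjective (S := R) (R := R ⧸ I) Ideal.Quotient.mk_surjective
  have h2 : Module.length R' (R' ⧸ J) = Module.length (R' ⧸ J) (R' ⧸ J) :=
    Module.length_eq_of_surjective (S := R') (R := R' ⧸ J) Ideal.Quotient.mk_surjective
  rw [h1, h2]
  let q : (R ⧸ I) ≃+* (R' ⧸ J) := Ideal.quotientEquiv I J e h
  let o : Submodule (R ⧸ I) (R ⧸ I) ≃o Submodule (R' ⧸ J) (R' ⧸ J) :=
    q.symm.idealComapOrderIso
  have := Order.krullDim_eq_of_orderIso o
  rw [← WithBot.coe_inj, Module.coe_length, Module.coe_length, this]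

/-- The length of the local ring at `[v]` modulo the ideal generated by `I`. -/
def localLength (I : Ideal (MvPolynomial (Fin 3) ℂ)) (v : Fin 3 → ℂ) : ℕ∞ :=
  Module.length (LocalRingAt v)
    (LocalRingAt v ⧸ I.map (algebraMap (MvPolynomial (Fin 3) ℂ) (LocalRingAt v)))

/-- An automorphism matching the two primes extends to the localizations. This is what makes
intersection multiplicities invariant under linear substitutions. -/
theorem localLength_congr (e : MvPolynomial (Fin 3) ℂ ≃+* MvPolynomial (Fin 3) ℂ)
    {I J : Ideal (MvPolynomial (Fin 3) ℂ)} (hIJ : J = I.map (e : _ →+* _)) {v w : Fin 3 → ℂ}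
    (h : ∀ F, F ∈ pointIdeal v ↔ e F ∈ pointIdeal w) : localLength I v = localLength J w := by
  have hM : (pointIdeal v).primeCompl.map (e : _ →* _) = (pointIdeal w).primeCompl := by
    ext F
    constructor
    · rintro ⟨G, hG, rfl⟩
      exact fun h' => hG ((h G).2 h')
    · intro hF
      exact ⟨e.symm F, fun h' => hF (by simpa using (h _).1 h'), by simp⟩
  let E : LocalRingAt v ≃+* LocalRingAt w :=
    IsLocalization.ringEquivOfRingEquiv (LocalRingAt v) (LocalRingAt w) e hM
  refine length_quotient_of_ringEquiv E _ _ ?_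
  rw [hIJ, Ideal.map_map, Ideal.map_map]
  congr 1
  refine RingHom.ext fun F => ?_
  exact (IsLocalization.ringEquivOfRingEquiv_eq hM F).symm

/-- A polynomial in `T` over the infinite field ℂ is zero as soon as all its values are. Membership
becomes a statement about evaluations, which behave simply under substitution and scaling. -/
theorem mem_pointIdeal {v : Fin 3 → ℂ} {F : MvPolynomial (Fin 3) ℂ} :
    F ∈ pointIdeal v ↔ ∀ T : ℂ, MvPolynomial.eval (T • v) F = 0 := by
  have key : ∀ T : ℂ, Polynomial.eval T (MvPolynomial.aeval
      (fun i => Polynomial.C (v i) * Polynomial.X) F) = MvPolynomial.eval (T • v) F := by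
    intro T
    induction F using MvPolynomial.induction_on with
    | C a => simp
    | add p q hp hq => simp [hp, hq]
    | mul_X p i hp => simp [hp]; left; ring
  rw [pointIdeal, RingHom.mem_ker]
  constructor
  · intro h T
    rw [← key]
    erw [h]
    simp
  · intro h
    refine Polynomial.funext fun T => ?_
    erw [key, h]
    simp

theorem eval_toPoly (f : TernaryForm) (v : Fin 3 → ℂ) :
    MvPolynomial.eval v f.toPoly = v ⬝ᵥ ((f.1.map (algebraMap ℝ ℂ)) *ᵥ v) := by
  simp [TernaryForm.toPoly, dotProduct, Matrix.mulVec, Finset.mul_sum]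
  refine Finset.sum_congr rfl fun i _ => Finset.sum_congr rfl fun j _ => by ring

/-- The linear substitution `F ↦ F ∘ b`. -/
def linSubst (b : Matrix (Fin 3) (Fin 3) ℂ) :
    MvPolynomial (Fin 3) ℂ →ₐ[ℂ] MvPolynomial (Fin 3) ℂ :=
  MvPolynomial.aeval fun i => ∑ j, MvPolynomial.C (b i j) * MvPolynomial.X j

theorem eval_linSubst (b : Matrix (Fin 3) (Fin 3) ℂ) (F : MvPolynomial (Fin 3) ℂ)
    (x : Fin 3 → ℂ) : MvPolynomial.eval x (linSubst b F) = MvPolynomial.eval (b *ᵥ x) F := by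
  induction F using MvPolynomial.induction_on with
  | C a => simp [linSubst]
  | add p q hp hq => simp [hp, hq]
  | mul_X p i hp => simp [hp]; left; simp [linSubst, Matrix.mulVec, dotProduct]

/-- The linear substitution by an invertible matrix, as an automorphism. -/
def linSubstEquiv (b : GL (Fin 3) ℂ) : MvPolynomial (Fin 3) ℂ ≃+* MvPolynomial (Fin 3) ℂ :=
  RingEquiv.ofRingHom (linSubst b.1).toRingHom (linSubst b⁻¹.1).toRingHom
    (RingHom.ext fun F => MvPolynomial.funext fun x => by
      simp [eval_linSubst])
    (RingHom.ext fun F => MvPolynomial.funext fun x => by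
      simp [eval_linSubst])

theorem eval_linSubstEquiv (b : GL (Fin 3) ℂ) (F : MvPolynomial (Fin 3) ℂ)
    (x : Fin 3 → ℂ) : MvPolynomial.eval x (linSubstEquiv b F) = MvPolynomial.eval (b.1 *ᵥ x) F :=
  eval_linSubst _ _ _


/-- The factor `c` is needed because the chosen representative of an image point is only
proportional to the image of the representative. -/
theorem linSubstEquiv_mem_pointIdeal (b : GL (Fin 3) ℂ) {v w : Fin 3 → ℂ} {c : ℂ} (hc : c ≠ 0)
    (h : b.1 *ᵥ v = c • w) (F : MvPolynomial (Fin 3) ℂ) :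
    F ∈ pointIdeal w ↔ linSubstEquiv b F ∈ pointIdeal v := by
  simp only [mem_pointIdeal, eval_linSubstEquiv, Matrix.mulVec_smul, h, smul_smul]
  constructor
  · intro H T
    exact H _
  · intro H T
    simpa [hc] using H (T / c)

/-! ### Congruences, base points and invariance of the intersection numbers. -/

/-- The congruence `M ↦ bᵀ M b`, i.e. `f ↦ f ∘ b`. -/
def cong (b : Matrix (Fin 3) (Fin 3) ℝ) :
    Matrix (Fin 3) (Fin 3) ℝ →ₗ[ℝ] Matrix (Fin 3) (Fin 3) ℝ where
  toFun M := bᵀ * M * b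
  map_add' _ _ := by simp [Matrix.mul_add, Matrix.add_mul]
  map_smul' _ _ := by simp

theorem cong_apply (b M : Matrix (Fin 3) (Fin 3) ℝ) : cong b M = bᵀ * M * b := rfl

theorem cong_cong (b c M : Matrix (Fin 3) (Fin 3) ℝ) : cong c (cong b M) = cong (b * c) M := by
  simp [cong_apply, Matrix.mul_assoc]

theorem cong_one (M : Matrix (Fin 3) (Fin 3) ℝ) : cong 1 M = M := by simp [cong_apply]

theorem map_cong_map_cong (b c : Matrix (Fin 3) (Fin 3) ℝ)
    (W : Submodule ℝ (Matrix (Fin 3) (Fin 3) ℝ)) :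
    (W.map (cong b)).map (cong c) = W.map (cong (b * c)) := by
  rw [← Submodule.map_comp]
  congr 1
  exact LinearMap.ext fun M => cong_cong b c M

theorem map_cong_one (W : Submodule ℝ (Matrix (Fin 3) (Fin 3) ℝ)) : W.map (cong 1) = W := by
  convert Submodule.map_id W
  exact LinearMap.ext fun M => cong_one M

/-- The value at a complex vector of the quadratic form of a real matrix. -/
def cval (M : Matrix (Fin 3) (Fin 3) ℝ) (v : Fin 3 → ℂ) : ℂ :=
  v ⬝ᵥ ((M.map (algebraMap ℝ ℂ)) *ᵥ v)

theorem cval_add (M N : Matrix (Fin 3) (Fin 3) ℝ) (v : Fin 3 → ℂ) :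
    cval (M + N) v = cval M v + cval N v := by
  simp [cval, Matrix.map_add, Matrix.add_mulVec, dotProduct_add]

theorem cval_real_smul (c : ℝ) (M : Matrix (Fin 3) (Fin 3) ℝ) (v : Fin 3 → ℂ) :
    cval (c • M) v = c * cval M v := by
  have : (c • M).map (algebraMap ℝ ℂ) = (c : ℂ) • M.map (algebraMap ℝ ℂ) := by
    ext i j; simp
  rw [cval, this, Matrix.smul_mulVec, dotProduct_smul, smul_eq_mul, cval]

theorem cval_smul (M : Matrix (Fin 3) (Fin 3) ℝ) (c : ℂ) (v : Fin 3 → ℂ) :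
    cval M (c • v) = c ^ 2 * cval M v := by
  simp [cval, Matrix.mulVec_smul]; ring

theorem cval_cong (b M : Matrix (Fin 3) (Fin 3) ℝ) (v : Fin 3 → ℂ) :
    cval (cong b M) v = cval M (b.map (algebraMap ℝ ℂ) *ᵥ v) := by
  simp only [cval, cong_apply, Matrix.map_mul, Matrix.transpose_map]
  rw [Matrix.dotProduct_mulVec, Matrix.dotProduct_mulVec, ← Matrix.vecMul_vecMul,
    ← Matrix.vecMul_vecMul, Matrix.vecMul_transpose, ← Matrix.dotProduct_mulVec]

theorem eval_toPoly_eq_cval (f : TernaryForm) (v : Fin 3 → ℂ) :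
    MvPolynomial.eval v f.toPoly = cval f.1 v := eval_toPoly f v

/-- The complex base points of a space of real quadratic forms. -/
def basePoints (W : Submodule ℝ (Matrix (Fin 3) (Fin 3) ℝ)) : Set (ℙ ℂ (Fin 3 → ℂ)) :=
  {p | ∀ M ∈ W, cval M p.rep = 0}

theorem mk_mem_basePoints {W : Submodule ℝ (Matrix (Fin 3) (Fin 3) ℝ)} {v : Fin 3 → ℂ}
    (hv : v ≠ 0) : Projectivization.mk ℂ v hv ∈ basePoints W ↔ ∀ M ∈ W, cval M v = 0 := by
  obtain ⟨a, ha⟩ := Projectivization.exists_smul_eq_mk_rep ℂ v hv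
  have ha' : (a : ℂ) • v = (Projectivization.mk ℂ v hv).rep := ha
  simp [basePoints, ← ha', cval_smul]

/-- The pencil of matrices spanned by two matrices. -/
abbrev pen (f g : Matrix (Fin 3) (Fin 3) ℝ) : Submodule ℝ (Matrix (Fin 3) (Fin 3) ℝ) :=
  Submodule.span ℝ {f, g}

theorem forall_mem_pen_cval {f g : Matrix (Fin 3) (Fin 3) ℝ} {v : Fin 3 → ℂ} :
    (∀ M ∈ pen f g, cval M v = 0) ↔ cval f v = 0 ∧ cval g v = 0 := by
  constructor
  · intro h
    exact ⟨h _ (Submodule.subset_span (by simp)), h _ (Submodule.subset_span (by simp))⟩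
  · rintro ⟨h1, h2⟩ M hM
    obtain ⟨a, b, rfl⟩ := Submodule.mem_span_pair.1 hM
    simp [cval_add, cval_real_smul, h1, h2]

/-- The pencil of matrices of a couple of conics. -/
def couplePen (c : Conic × Conic) : Submodule ℝ (Matrix (Fin 3) (Fin 3) ℝ) :=
  pen c.1.rep.1 c.2.rep.1

theorem mem_basePoints_couplePen {c : Conic × Conic} {p : ℙ ℂ (Fin 3 → ℂ)} :
    p ∈ basePoints (couplePen c) ↔ c.1.HasPoint p ∧ c.2.HasPoint p := by
  simp only [basePoints, couplePen, Set.mem_ofPred_eq, forall_mem_pen_cval, Conic.HasPoint,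
    eval_toPoly_eq_cval]

/-- The action of a real invertible matrix on the complex projective plane. -/
def projMap (b : GL (Fin 3) ℝ) : ℙ ℂ (Fin 3 → ℂ) → ℙ ℂ (Fin 3 → ℂ) :=
  Projectivization.map (Matrix.mulVecLin (b.1.map (algebraMap ℝ ℂ))) (by
    refine Function.LeftInverse.injective
      (g := Matrix.mulVecLin ((b⁻¹).1.map (algebraMap ℝ ℂ))) fun v => ?_
    simp only [Matrix.mulVecLin_apply, Matrix.mulVec_mulVec, ← Matrix.map_mul]
    rw [← Units.val_mul, inv_mul_cancel]
    simp)

theorem projMap_mk (b : GL (Fin 3) ℝ) (v : Fin 3 → ℂ) (hv : v ≠ 0)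
    (hb : b.1.map (algebraMap ℝ ℂ) *ᵥ v ≠ 0) :
    projMap b (Projectivization.mk ℂ v hv) = Projectivization.mk ℂ _ hb := rfl

theorem map_mulVec_ne_zero (b : GL (Fin 3) ℝ) {v : Fin 3 → ℂ} (hv : v ≠ 0) :
    b.1.map (algebraMap ℝ ℂ) *ᵥ v ≠ 0 := by
  intro h
  have h2 : (b⁻¹).1.map (algebraMap ℝ ℂ) *ᵥ (b.1.map (algebraMap ℝ ℂ) *ᵥ v) = v := by
    rw [Matrix.mulVec_mulVec, ← Matrix.map_mul, ← Units.val_mul, inv_mul_cancel]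
    simp
  rw [h, Matrix.mulVec_zero] at h2
  exact hv h2.symm

theorem projMap_projMap_inv (b : GL (Fin 3) ℝ) (p : ℙ ℂ (Fin 3 → ℂ)) :
    projMap b (projMap b⁻¹ p) = p := by
  induction p using Projectivization.ind with | h v hv =>
  rw [projMap_mk b⁻¹ v hv (map_mulVec_ne_zero _ hv), projMap_mk b _ _
    (map_mulVec_ne_zero _ (map_mulVec_ne_zero _ hv))]
  congr 1
  rw [Matrix.mulVec_mulVec, ← Matrix.map_mul, ← Units.val_mul, mul_inv_cancel]
  simp

/-- The bijection of the complex projective plane given by a real invertible matrix. -/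
def projEquiv (b : GL (Fin 3) ℝ) : ℙ ℂ (Fin 3 → ℂ) ≃ ℙ ℂ (Fin 3 → ℂ) where
  toFun := projMap b
  invFun := projMap b⁻¹
  left_inv p := by simpa using projMap_projMap_inv b⁻¹ p
  right_inv p := projMap_projMap_inv b p

theorem projMap_rep (b : GL (Fin 3) ℝ) (p : ℙ ℂ (Fin 3 → ℂ)) :
    ∃ c : ℂ, c ≠ 0 ∧ b.1.map (algebraMap ℝ ℂ) *ᵥ p.rep = c • (projMap b p).rep := by
  have h := projMap_mk b p.rep p.rep_nonzero (map_mulVec_ne_zero _ p.rep_nonzero)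
  rw [Projectivization.mk_rep] at h
  obtain ⟨a, ha⟩ := Projectivization.exists_smul_eq_mk_rep ℂ _
    (map_mulVec_ne_zero b p.rep_nonzero)
  refine ⟨(a⁻¹ : ℂˣ).1, Units.ne_zero _, ?_⟩
  rw [h, ← ha]
  exact (inv_smul_smul a _).symm

theorem isRealPoint_projMap (b : GL (Fin 3) ℝ) {p : ℙ ℂ (Fin 3 → ℂ)} (hp : IsRealPoint p) :
    IsRealPoint (projMap b p) := by
  obtain ⟨x, hx, rfl⟩ := hp
  have e : (fun i => ((b.1 *ᵥ x) i : ℂ)) = b.1.map (algebraMap ℝ ℂ) *ᵥ fun i => (x i : ℂ) := by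
    ext i; simp [Matrix.mulVec, dotProduct]
  refine ⟨b.1 *ᵥ x, by rw [e]; exact map_mulVec_ne_zero b hx, ?_⟩
  rw [projMap_mk _ _ _ (map_mulVec_ne_zero b hx)]
  congr 1

theorem isRealPoint_projMap_iff (b : GL (Fin 3) ℝ) {p : ℙ ℂ (Fin 3 → ℂ)} :
    IsRealPoint (projMap b p) ↔ IsRealPoint p :=
  ⟨fun h => by simpa [(projEquiv b).left_inv p] using
    (show projMap b⁻¹ (projMap b p) = p from (projEquiv b).left_inv p) ▸
      isRealPoint_projMap b⁻¹ h, isRealPoint_projMap b⟩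

theorem projMap_mem_basePoints (b : GL (Fin 3) ℝ)
    (W : Submodule ℝ (Matrix (Fin 3) (Fin 3) ℝ)) {p : ℙ ℂ (Fin 3 → ℂ)} :
    projMap b p ∈ basePoints W ↔ p ∈ basePoints (W.map (cong b.1)) := by
  induction p using Projectivization.ind with | h v hv =>
  rw [projMap_mk _ _ _ (map_mulVec_ne_zero b hv), mk_mem_basePoints, mk_mem_basePoints]
  simp [Submodule.mem_map, cval_cong]

theorem encard_basePoints_map_cong (b : GL (Fin 3) ℝ)
    (W : Submodule ℝ (Matrix (Fin 3) (Fin 3) ℝ)) :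
    (basePoints (W.map (cong b.1))).encard = (basePoints W).encard := by
  have : basePoints (W.map (cong b.1)) = projEquiv b ⁻¹' basePoints W := by
    ext p; exact (projMap_mem_basePoints b W).symm
  rw [this]
  exact Set.encard_preimage_of_bijective (projEquiv b).bijective _

/-- A real invertible matrix as a complex one. -/
def complexify (b : GL (Fin 3) ℝ) : GL (Fin 3) ℂ :=
  Units.map ((algebraMap ℝ ℂ).mapMatrix : Matrix (Fin 3) (Fin 3) ℝ →+* _).toMonoidHom b

theorem coe_complexify (b : GL (Fin 3) ℝ) :
    (complexify b).1 = b.1.map (algebraMap ℝ ℂ) := rfl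

theorem toPoly_mem_of_mem_map_cong (b : GL (Fin 3) ℝ) (f g h : TernaryForm)
    (H : h.1 ∈ (pen f.1 g.1).map (cong b.1)) :
    h.toPoly ∈ (Ideal.span {f.toPoly, g.toPoly}).map
      ((linSubstEquiv (complexify b) : MvPolynomial (Fin 3) ℂ ≃+* _) :
        MvPolynomial (Fin 3) ℂ →+* MvPolynomial (Fin 3) ℂ) := by
  obtain ⟨M, hM, hMh⟩ := H
  obtain ⟨x, y, rfl⟩ := Submodule.mem_span_pair.1 hM
  have : h.toPoly = linSubstEquiv (complexify b)
      (MvPolynomial.C (x : ℂ) * f.toPoly + MvPolynomial.C (y : ℂ) * g.toPoly) := by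
    refine MvPolynomial.funext fun v => ?_
    rw [eval_linSubstEquiv, eval_toPoly_eq_cval, ← hMh, cval_cong]
    simp [cval_add, cval_real_smul, eval_toPoly_eq_cval, coe_complexify]
  rw [this]
  refine Ideal.mem_map_of_mem _ (Ideal.add_mem _ (Ideal.mul_mem_left _ _ ?_)
    (Ideal.mul_mem_left _ _ ?_))
  · exact Ideal.subset_span (by simp)
  · exact Ideal.subset_span (by simp)

/-- The ideal of a couple depends only on its real pencil, and a congruence of pencils is induced by
a substitution. The second inclusion is the first one for `b⁻¹`, transported back by the
substitution. -/
theorem span_toPoly_of_map_cong (b : GL (Fin 3) ℝ) (f g f' g' : TernaryForm)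
    (H : pen f'.1 g'.1 = (pen f.1 g.1).map (cong b.1)) :
    Ideal.span {f'.toPoly, g'.toPoly} = (Ideal.span {f.toPoly, g.toPoly}).map
      ((linSubstEquiv (complexify b) : MvPolynomial (Fin 3) ℂ ≃+* _) :
        MvPolynomial (Fin 3) ℂ →+* MvPolynomial (Fin 3) ℂ) := by
  apply le_antisymm
  · rw [Ideal.span_le]
    rintro _ (rfl | rfl)
    · exact toPoly_mem_of_mem_map_cong b f g _ (H ▸ Submodule.subset_span (by simp))
    · exact toPoly_mem_of_mem_map_cong b f g _ (H ▸ Submodule.subset_span (by simp))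
  · have H' : pen f.1 g.1 = (pen f'.1 g'.1).map (cong (b⁻¹).1) := by
      rw [H, map_cong_map_cong, ← Units.val_mul, mul_inv_cancel, Units.val_one, map_cong_one]
    rw [Ideal.map_le_iff_le_comap, Ideal.span_le]
    have key : ∀ h : TernaryForm, h.1 ∈ pen f.1 g.1 →
        linSubstEquiv (complexify b) h.toPoly ∈ Ideal.span {f'.toPoly, g'.toPoly} := by
      intro h hh
      have h1 := toPoly_mem_of_mem_map_cong b⁻¹ f' g' h (H' ▸ hh)
      have h2 := Ideal.mem_map_of_mem ((linSubstEquiv (complexify b) :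
        MvPolynomial (Fin 3) ℂ ≃+* _) : MvPolynomial (Fin 3) ℂ →+* MvPolynomial (Fin 3) ℂ) h1
      rw [Ideal.map_map] at h2
      change linSubstEquiv (complexify b) h.toPoly ∈ _ at h2
      convert h2
      symm
      convert Ideal.map_id _
      refine RingHom.ext fun F => MvPolynomial.funext fun v => ?_
      simp only [RingHom.comp_apply, RingHom.coe_coe, eval_linSubstEquiv, RingHom.id_apply,
        Matrix.mulVec_mulVec, coe_complexify, ← Matrix.map_mul]
      rw [← Units.val_mul, inv_mul_cancel]
      simp
    rintro _ (rfl | rfl)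
    · exact key _ (Submodule.subset_span (by simp))
    · exact key _ (Submodule.subset_span (by simp))

/-- Both being an intersection point and its multiplicity are read off the pencil. The point moves
by `b` from `c'` to `c` since the forms of `c'` are those of `c` composed with `b`. -/
theorem mem_intersections_of_map_cong (b : GL (Fin 3) ℝ) {c c' : Conic × Conic}
    (H : couplePen c' = (couplePen c).map (cong b.1)) (m : ℕ) (p : ℙ ℂ (Fin 3 → ℂ)) :
    p ∈ intersections c' m ↔ projMap b p ∈ intersections c m := by
  have h1 : (c'.1.HasPoint p ∧ c'.2.HasPoint p) ↔
      (c.1.HasPoint (projMap b p) ∧ c.2.HasPoint (projMap b p)) := by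
    rw [← mem_basePoints_couplePen, ← mem_basePoints_couplePen, projMap_mem_basePoints, H]
  have h2 : intersectionMultiplicity c.1 c.2 (projMap b p) =
      intersectionMultiplicity c'.1 c'.2 p := by
    obtain ⟨a, ha, hab⟩ := projMap_rep b p
    exact localLength_congr (linSubstEquiv (complexify b))
      (span_toPoly_of_map_cong b c.1.rep c.2.rep c'.1.rep c'.2.rep H)
      (linSubstEquiv_mem_pointIdeal (complexify b) ha hab)
  simp only [intersections, Set.mem_ofPred_eq, h2, ← and_assoc, h1]

theorem numReal_of_map_cong (b : GL (Fin 3) ℝ) {c c' : Conic × Conic}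
    (H : couplePen c' = (couplePen c).map (cong b.1)) (m : ℕ) : numReal c' m = numReal c m := by
  have : {p ∈ intersections c' m | IsRealPoint p} =
      projEquiv b ⁻¹' {p ∈ intersections c m | IsRealPoint p} := by
    ext p
    change _ ↔ projMap b p ∈ _ ∧ IsRealPoint (projMap b p)
    rw [isRealPoint_projMap_iff, ← mem_intersections_of_map_cong b H]
    rfl
  rw [numReal, this]
  exact Set.encard_preimage_of_bijective (projEquiv b).bijective _

theorem numImaginary_of_map_cong (b : GL (Fin 3) ℝ) {c c' : Conic × Conic}
    (H : couplePen c' = (couplePen c).map (cong b.1)) (m : ℕ) :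
    numImaginary c' m = numImaginary c m := by
  have : {p ∈ intersections c' m | ¬ IsRealPoint p} =
      projEquiv b ⁻¹' {p ∈ intersections c m | ¬ IsRealPoint p} := by
    ext p
    change _ ↔ projMap b p ∈ _ ∧ ¬ IsRealPoint (projMap b p)
    rw [isRealPoint_projMap_iff, ← mem_intersections_of_map_cong b H]
    rfl
  rw [numImaginary, this]
  exact Set.encard_preimage_of_bijective (projEquiv b).bijective _

/-! ### Finiteness of multiplicities and the count of base points. -/

theorem pointIdeal_smul {c : ℂ} (hc : c ≠ 0) (v : Fin 3 → ℂ) :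
    pointIdeal (c • v) = pointIdeal v := by
  ext F
  simp only [mem_pointIdeal, smul_smul]
  exact ⟨fun H T => by simpa [hc] using H (T / c), fun H T => H _⟩

/-- The minors `w j * X i - w i * X j` lie in the ideal of `w`. If they also vanish at `v`, the two
vectors are proportional. -/
theorem pointIdeal_eq_of_le {v w : Fin 3 → ℂ} (hv : v ≠ 0) (hw : w ≠ 0)
    (h : pointIdeal w ≤ pointIdeal v) : pointIdeal w = pointIdeal v := by
  have key : ∀ i j, w j * v i = w i * v j := by
    intro i j
    have h1 : MvPolynomial.C (w j) * MvPolynomial.X i - MvPolynomial.C (w i) * MvPolynomial.X j ∈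
        pointIdeal w := by
      rw [mem_pointIdeal]
      intro T
      simp; ring
    have := mem_pointIdeal.1 (h h1) 1
    simpa [sub_eq_zero] using this
  obtain ⟨k, hk⟩ := Function.ne_iff.1 hw
  simp only [Pi.zero_apply] at hk
  have e : v = (v k / w k) • w := by
    ext i
    simp only [Pi.smul_apply, smul_eq_mul]
    field_simp
    linear_combination key i k
  have hc : v k / w k ≠ 0 := by
    intro h0
    rw [h0, zero_smul] at e
    exact hv e
  rw [e, pointIdeal_smul hc]

/-- By the Nullstellensatz the radical of the ideal of the couple contains the intersection of the
ideals of finitely many points. A prime above it contains one of these, which then lies inside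
`pointIdeal v` and must equal it. -/
theorem eq_pointIdeal_of_prime {f g : TernaryForm} (hfin : (basePoints (pen f.1 g.1)).Finite)
    {v : Fin 3 → ℂ} (hv : v ≠ 0)
    (Q : Ideal (MvPolynomial (Fin 3) ℂ)) [hQ : Q.IsPrime]
    (h1 : Ideal.span {f.toPoly, g.toPoly} ≤ Q) (h2 : Q ≤ pointIdeal v)  :
    Q = pointIdeal v := by
  classical
  set I := Ideal.span {f.toPoly, g.toPoly}
  obtain ⟨P, hP⟩ : ∃ P : ℙ ℂ (Fin 3 → ℂ) → Ideal (MvPolynomial (Fin 3) ℂ),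
    ∀ p, P p = pointIdeal p.rep := ⟨_, fun _ => rfl⟩
  -- The point `[v]` is inserted to make `s` nonempty: membership in some point ideal is what forces
  -- vanishing at the origin, a zero that no projective point accounts for.
  obtain ⟨s, hs, hs'⟩ : ∃ s : Finset (ℙ ℂ (Fin 3 → ℂ)), Projectivization.mk ℂ v hv ∈ s ∧
      ∀ p ∈ basePoints (pen f.1 g.1), p ∈ s :=
    ⟨insert (Projectivization.mk ℂ v hv) hfin.toFinset, Finset.mem_insert_self _ _,
      fun p hp => Finset.mem_insert_of_mem (hfin.mem_toFinset.2 hp)⟩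
  have hle : s.inf P ≤ Q := by
    refine le_trans ?_ ((hQ.radical_le_iff).2 h1)
    rw [← MvPolynomial.vanishingIdeal_zeroLocus_eq_radical (K := ℂ)]
    intro F hF
    rw [MvPolynomial.mem_vanishingIdeal_iff]
    intro x hx
    rw [MvPolynomial.zeroLocus_span] at hx
    have hx1 : MvPolynomial.eval x f.toPoly = 0 := hx _ (by simp)
    have hx2 : MvPolynomial.eval x g.toPoly = 0 := hx _ (by simp)
    have hF' : ∀ p ∈ s, F ∈ pointIdeal p.rep := by
      intro p hp
      rw [← hP]
      exact Finset.inf_le (f := P) hp hF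
    change MvPolynomial.eval x F = 0
    by_cases hx0 : x = 0
    · have := mem_pointIdeal.1 (hF' _ hs) 0
      simpa [hx0] using this
    · have hmem : Projectivization.mk ℂ x hx0 ∈ basePoints (pen f.1 g.1) := by
        rw [mk_mem_basePoints, forall_mem_pen_cval, ← eval_toPoly_eq_cval, ← eval_toPoly_eq_cval]
        exact ⟨hx1, hx2⟩
      obtain ⟨a, ha⟩ := Projectivization.exists_smul_eq_mk_rep ℂ x hx0
      have := mem_pointIdeal.1 (hF' _ (hs' _ hmem)) (a⁻¹ : ℂˣ).1
      rw [← ha] at this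
      have e : (a⁻¹ : ℂˣ).1 • (a • x) = x := inv_smul_smul a x
      rwa [e] at this
  obtain ⟨p, -, hp⟩ := (Ideal.IsPrime.inf_le' hQ).1 hle
  rw [hP] at hp
  have := pointIdeal_eq_of_le hv p.rep_nonzero (hp.trans h2)
  exact le_antisymm h2 (this ▸ hp)

/-- Every prime of the local quotient pulls back to `pointIdeal v`, so the quotient is noetherian of
dimension zero, hence artinian and of finite length. -/
theorem localLength_ne_top {f g : TernaryForm} (hfin : (basePoints (pen f.1 g.1)).Finite)
    {v : Fin 3 → ℂ} (hv : v ≠ 0) :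
    localLength (Ideal.span {f.toPoly, g.toPoly}) v ≠ ⊤ := by
  set I := Ideal.span {f.toPoly, g.toPoly} with hI
  have : IsNoetherianRing (LocalRingAt v) :=
    IsLocalization.isNoetherianRing (pointIdeal v).primeCompl _ inferInstance
  set J := I.map (algebraMap (MvPolynomial (Fin 3) ℂ) (LocalRingAt v)) with hJ
  have hdim : Ring.KrullDimLE 0 (LocalRingAt v ⧸ J) := by
    refine Ring.KrullDimLE.mk₀ fun K hK => ?_
    set K' := K.comap (Ideal.Quotient.mk J) with hK'
    have hJK : J ≤ K' := by
      intro x hx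
      rw [hK', Ideal.mem_comap, Ideal.Quotient.eq_zero_iff_mem.2 hx]
      exact K.zero_mem
    set Q := K'.comap (algebraMap (MvPolynomial (Fin 3) ℂ) (LocalRingAt v)) with hQ
    have h1 : I ≤ Q := Ideal.map_le_iff_le_comap.1 hJK
    have h2 : Q ≤ pointIdeal v := by
      have h3 : Disjoint ((pointIdeal v).primeCompl : Set (MvPolynomial (Fin 3) ℂ)) Q :=
        ((IsLocalization.isPrime_iff_isPrime_disjoint (pointIdeal v).primeCompl
          (LocalRingAt v) K').1 inferInstance).2
      intro x hx
      by_contra hxP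
      exact Set.disjoint_left.1 h3 hxP hx
    have h3 : Q = pointIdeal v := eq_pointIdeal_of_prime hfin hv Q h1 h2
    have h4 : K' = IsLocalRing.maximalIdeal (LocalRingAt v) := by
      rw [← IsLocalization.map_under (pointIdeal v).primeCompl (LocalRingAt v) K']
      change Ideal.map _ Q = _
      rw [h3]
      exact Localization.AtPrime.map_eq_maximalIdeal
    have hmax : K'.IsMaximal := h4 ▸ inferInstance
    rw [← Ideal.map_comap_of_surjective (Ideal.Quotient.mk J) Ideal.Quotient.mk_surjective K]
    refine (Ideal.map_eq_top_or_isMaximal_of_surjective (Ideal.Quotient.mk J)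
      Ideal.Quotient.mk_surjective hmax).resolve_left fun htop => hK.ne_top ?_
    rwa [Ideal.map_comap_of_surjective (Ideal.Quotient.mk J) Ideal.Quotient.mk_surjective K] at htop
  have hart : IsArtinianRing (LocalRingAt v ⧸ J) :=
    (isArtinianRing_iff_isNoetherianRing_krullDimLE_zero (R := LocalRingAt v ⧸ J)).2
      ⟨inferInstance, hdim⟩
  have := Module.length_eq_of_surjective (S := LocalRingAt v) (R := LocalRingAt v ⧸ J)
    (M := LocalRingAt v ⧸ J) Ideal.Quotient.mk_surjective
  rw [localLength, this]
  exact Module.length_ne_top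

/-- Finitely many points with finite multiplicities have a bounded multiplicity. Allowing every
larger `N` lets two couples be compared over the same finite index set. -/
theorem basePoints_eq_iUnion {c : Conic × Conic} (hfin : (basePoints (couplePen c)).Finite) :
    ∃ N₀ : ℕ, ∀ N ≥ N₀, basePoints (couplePen c) = ⋃ i : Fin N × Bool,
      {p ∈ intersections c i.1 | IsRealPoint p ↔ i.2 = true} := by
  have hne : ∀ p, intersectionMultiplicity c.1 c.2 p ≠ ⊤ := fun p =>
    localLength_ne_top hfin p.rep_nonzero
  obtain ⟨N, hN⟩ := (hfin.image fun p => (intersectionMultiplicity c.1 c.2 p).toNat).bddAbove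
  refine ⟨N + 1, fun N' hN' => ?_⟩
  ext p
  simp only [Set.mem_iUnion, Set.mem_ofPred_eq, intersections, ← mem_basePoints_couplePen,
    ← and_assoc]
  constructor
  · intro hp
    have h1 : (intersectionMultiplicity c.1 c.2 p).toNat ≤ N := hN (Set.mem_image_of_mem _ hp)
    classical
    exact ⟨(⟨(intersectionMultiplicity c.1 c.2 p).toNat, by omega⟩, decide (IsRealPoint p)),
      ⟨hp, (ENat.natCast_toNat (hne p)).symm⟩, by simp⟩
  · rintro ⟨i, ⟨h, -⟩, -⟩
    exact h

/-- All that is used later of the constancy of the intersection numbers: the number of distinct base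
points is the sum of the real and imaginary counts over the multiplicities. -/
theorem encard_basePoints_eq {c c' : Conic × Conic} (hfin : (basePoints (couplePen c)).Finite)
    (hfin' : (basePoints (couplePen c')).Finite)
    (h : ∀ m, numReal c' m = numReal c m ∧ numImaginary c' m = numImaginary c m) :
    (basePoints (couplePen c')).encard = (basePoints (couplePen c)).encard := by
  obtain ⟨N, hN⟩ := basePoints_eq_iUnion hfin
  obtain ⟨N', hN'⟩ := basePoints_eq_iUnion hfin'
  rw [hN (max N N') (le_max_left _ _), hN' (max N N') (le_max_right _ _)]
  have hd : ∀ c : Conic × Conic, Pairwise (Function.onFun Disjoint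
      fun i : Fin (max N N') × Bool => {p ∈ intersections c i.1 | IsRealPoint p ↔ i.2 = true}) := by
    rintro c ⟨i, r⟩ ⟨j, s⟩ hij
    refine Set.disjoint_left.2 ?_
    rintro p ⟨h1, h2⟩ ⟨h3, h4⟩
    apply hij
    have e1 : i = j := by
      have := h1.2.2.symm.trans h3.2.2
      exact Fin.ext (by exact_mod_cast this)
    have e2 : r = s := by
      rw [Bool.eq_iff_iff]; exact h2.symm.trans h4
    rw [e1, e2]
  rw [Set.encard_iUnion_of_finite (hd c'), Set.encard_iUnion_of_finite (hd c)]
  refine finsum_congr fun i => ?_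
  obtain ⟨i, r⟩ := i
  cases r
  · simpa [numImaginary] using (h i).2
  · simpa [numReal] using (h i).1

/-! ### Base points of pencils in normal form -/

theorem mk_eq_mk_iff_cross {v w : Fin 3 → ℂ} (hv : v ≠ 0) (hw : w ≠ 0) :
    Projectivization.mk ℂ v hv = Projectivization.mk ℂ w hw ↔ ∀ i j, v i * w j = v j * w i := by
  rw [Projectivization.mk_eq_mk_iff']
  constructor
  · rintro ⟨a, rfl⟩ i j
    simp; ring
  · intro h
    obtain ⟨k, hk⟩ := Function.ne_iff.1 hw
    simp only [Pi.zero_apply] at hk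
    refine ⟨v k / w k, funext fun i => ?_⟩
    simp only [Pi.smul_apply, smul_eq_mul]
    field_simp
    linear_combination h k i

theorem cval_fin_three (M : Matrix (Fin 3) (Fin 3) ℝ) (v : Fin 3 → ℂ) :
    cval M v = ∑ i, ∑ j, (M i j : ℂ) * v i * v j := by
  simp only [cval, dotProduct, Matrix.mulVec, Finset.mul_sum, Matrix.map_apply]
  exact Finset.sum_congr rfl fun i _ => Finset.sum_congr rfl fun j _ => by
    simp; ring

theorem vec_ne_zero {v : Fin 3 → ℂ} (i : Fin 3) (h : v i ≠ 0) : v ≠ 0 := fun h0 => h (by simp [h0])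

theorem cval_of (a b c d e f g h i : ℝ) (v : Fin 3 → ℂ) :
    cval !![a, b, c; d, e, f; g, h, i] v = a * v 0 ^ 2 + e * v 1 ^ 2 + i * v 2 ^ 2 +
      (b + d) * v 0 * v 1 + (c + g) * v 0 * v 2 + (f + h) * v 1 * v 2 := by
  simp [cval_fin_three, Fin.sum_univ_three]; ring

theorem basePoints_of_forms {F G : Matrix (Fin 3) (Fin 3) ℝ} {S : Set (ℙ ℂ (Fin 3 → ℂ))}
    (h : ∀ v (hv : v ≠ 0), cval F v = 0 ∧ cval G v = 0 ↔ Projectivization.mk ℂ v hv ∈ S) :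
    basePoints (pen F G) = S := by
  ext p
  induction p using Projectivization.ind with | h v hv =>
  rw [mk_mem_basePoints, forall_mem_pen_cval, h v hv]

theorem exists_sq_eq (z : ℂ) : ∃ s : ℂ, s ^ 2 = z := by
  obtain ⟨s, hs⟩ := IsAlgClosed.exists_pow_nat_eq z (n := 2) two_pos
  exact ⟨s, hs⟩

theorem forall_fin_three_pairs {P : Fin 3 → Fin 3 → Prop} (hd : ∀ i, P i i)
    (hs : ∀ i j, P i j → P j i) : (∀ i j, P i j) ↔ P 0 1 ∧ P 0 2 ∧ P 1 2 := by
  constructor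
  · intro h; exact ⟨h _ _, h _ _, h _ _⟩
  · rintro ⟨h1, h2, h3⟩ i j
    fin_cases i <;> fin_cases j <;> first | exact hd _ | assumption | (apply hs; assumption)

theorem mk_eq_mk_iff_cross' {v w : Fin 3 → ℂ} (hv : v ≠ 0) (hw : w ≠ 0) :
    Projectivization.mk ℂ v hv = Projectivization.mk ℂ w hw ↔
      v 0 * w 1 = v 1 * w 0 ∧ v 0 * w 2 = v 2 * w 0 ∧ v 1 * w 2 = v 2 * w 1 := by
  rw [mk_eq_mk_iff_cross, forall_fin_three_pairs]
  · exact fun i => rfl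
  · exact fun i j h => by rw [h]

/-- First normal form, `γ z² + 2 x y`. -/
def nfG (γ : ℝ) : Matrix (Fin 3) (Fin 3) ℝ := !![0, 1, 0; 1, 0, 0; 0, 0, γ]

/-- First normal form, `x² + μ z²`. -/
def nfH (μ : ℝ) : Matrix (Fin 3) (Fin 3) ℝ := !![1, 0, 0; 0, 0, 0; 0, 0, μ]

theorem encard_basePoints_nf_three {γ μ : ℝ} (hγ : γ ≠ 0) (hμ : μ ≠ 0) :
    (basePoints (pen (nfH μ) (nfG γ))).encard = 3 := by
  obtain ⟨s, hs⟩ := exists_sq_eq (-μ)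
  have hγ' : (γ : ℂ) ≠ 0 := by exact_mod_cast hγ
  have hμ' : (μ : ℂ) ≠ 0 := by exact_mod_cast hμ
  have hs0 : s ≠ 0 := by rintro rfl; simp at hs; exact hμ (by exact_mod_cast hs)
  have h1 : (![0, 1, 0] : Fin 3 → ℂ) ≠ 0 := vec_ne_zero 1 (by simp)
  -- With z = 1 the first form gives x = ±s, and then γ + 2xy = 0 determines y. With z = 0 only the
  -- point [0 : 1 : 0] remains.
  have h2 : (![s, -γ / (2 * s), 1] : Fin 3 → ℂ) ≠ 0 := vec_ne_zero 2 (by simp)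
  have h3 : (![-s, γ / (2 * s), 1] : Fin 3 → ℂ) ≠ 0 := vec_ne_zero 2 (by simp)
  have key : basePoints (pen (nfH μ) (nfG γ)) = {Projectivization.mk ℂ _ h1,
      Projectivization.mk ℂ _ h2, Projectivization.mk ℂ _ h3} := by
    refine basePoints_of_forms fun v hv => ?_
    simp only [nfG, nfH, cval_of, Set.mem_insert_iff, Set.mem_singleton_iff, mk_eq_mk_iff_cross']
    simp
    constructor
    · rintro ⟨e1, e2⟩
      by_cases hz : v 2 = 0
      · have : v 0 = 0 := by simpa [hz] using e1
        exact Or.inl ⟨this, hz.symm⟩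
      · right
        have : (v 0 - s * v 2) * (v 0 + s * v 2) = 0 := by
          linear_combination e1 - v 2 ^ 2 * hs
        rcases mul_eq_zero.1 this with h | h
        · left
          have e : v 0 = s * v 2 := by linear_combination h
          rw [e] at e2 ⊢
          have : v 1 = -γ / (2 * s) * v 2 := by
            field_simp
            apply mul_left_cancel₀ hz
            linear_combination e2
          rw [this]
          refine ⟨by field_simp, by ring, by field_simp⟩
        · right
          have e : v 0 = -s * v 2 := by linear_combination h
          rw [e] at e2 ⊢
          have : v 1 = γ / (2 * s) * v 2 := by
            field_simp
            apply mul_left_cancel₀ hz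
            linear_combination -e2
          rw [this]
          refine ⟨by field_simp, by ring, by field_simp⟩
    · rintro (⟨e1, e2⟩ | ⟨e1, e2, e3⟩ | ⟨e1, e2, e3⟩)
      · rw [e1, ← e2]; simp
      · rw [e2, e3]
        refine ⟨by linear_combination v 2 ^ 2 * hs, by field_simp; ring⟩
      · rw [e2, e3]
        refine ⟨by linear_combination v 2 ^ 2 * hs, by field_simp; ring⟩
  rw [key, Set.encard_eq_three]
  refine ⟨_, _, _, ?_, ?_, ?_, rfl⟩
  · rw [Ne, mk_eq_mk_iff_cross']; simp
  · rw [Ne, mk_eq_mk_iff_cross']; simp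
  · rw [Ne, mk_eq_mk_iff_cross']
    simp only [Matrix.cons_val_zero, Matrix.cons_val_one, Matrix.cons_val, mul_one, one_mul]
    rintro ⟨-, h, -⟩
    exact hs0 (by linear_combination h / 2)

theorem encard_basePoints_nf_one {γ : ℝ} (hγ : γ ≠ 0) :
    (basePoints (pen (nfH 0) (nfG γ))).encard = 1 := by
  have hγ' : (γ : ℂ) ≠ 0 := by exact_mod_cast hγ
  have h1 : (![0, 1, 0] : Fin 3 → ℂ) ≠ 0 := vec_ne_zero 1 (by simp)
  rw [Set.encard_eq_one]
  refine ⟨Projectivization.mk ℂ _ h1, basePoints_of_forms fun v hv => ?_⟩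
  simp only [nfG, nfH, cval_of, Set.mem_singleton_iff, mk_eq_mk_iff_cross']
  simp
  intro e1
  rw [e1, eq_comm (a := 0)]
  simp [hγ]

/-- Second normal form, `y² + 2 x z`. -/
def nfG' : Matrix (Fin 3) (Fin 3) ℝ := !![0, 0, 1; 0, 1, 0; 1, 0, 0]

/-- Second normal form, `2 x y`. -/
def nfH' : Matrix (Fin 3) (Fin 3) ℝ := !![0, 1, 0; 1, 0, 0; 0, 0, 0]

theorem encard_basePoints_nf_two : (basePoints (pen nfH' nfG')).encard = 2 := by
  have h1 : (![1, 0, 0] : Fin 3 → ℂ) ≠ 0 := vec_ne_zero 0 (by simp)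
  have h2 : (![0, 0, 1] : Fin 3 → ℂ) ≠ 0 := vec_ne_zero 2 (by simp)
  rw [Set.encard_eq_two]
  refine ⟨Projectivization.mk ℂ _ h1, Projectivization.mk ℂ _ h2,
    by rw [Ne, mk_eq_mk_iff_cross']; simp, basePoints_of_forms fun v hv => ?_⟩
  simp only [nfG', nfH', cval_of, Set.mem_singleton_iff, Set.mem_insert_iff, mk_eq_mk_iff_cross']
  simp
  have h2' : (1 + 1 : ℂ) ≠ 0 := by norm_num
  constructor
  · rintro ⟨e1 | e1, e2⟩
    · exact Or.inr ⟨e1, by simpa [e1] using e2⟩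
    · rcases (by simpa [e1, h2'] using e2 : v 0 = 0 ∨ v 2 = 0) with h | h
      · exact Or.inr ⟨h, e1⟩
      · exact Or.inl ⟨e1.symm, h.symm⟩
  · rintro (⟨e1, e2⟩ | ⟨e1, e2⟩)
    · rw [← e1, ← e2]; simp
    · rw [e1, e2]; simp

/-- Third normal form, a diagonal quadratic form. -/
def nfD (a b c : ℝ) : Matrix (Fin 3) (Fin 3) ℝ := !![a, 0, 0; 0, b, 0; 0, 0, c]

theorem encard_basePoints_nf_double {a b c : ℝ} (hb : b ≠ 0) (hc : c ≠ 0) :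
    (basePoints (pen (nfD 1 0 0) (nfD a b c))).encard = 2 := by
  obtain ⟨s, hs⟩ := exists_sq_eq (-c / b)
  have hb' : (b : ℂ) ≠ 0 := by exact_mod_cast hb
  have hc' : (c : ℂ) ≠ 0 := by exact_mod_cast hc
  have hs' : b * s ^ 2 = -c := by rw [hs]; field_simp
  have hs0 : s ≠ 0 := by
    rintro rfl
    apply hc'
    simpa using hs'.symm
  have h1 : (![0, s, 1] : Fin 3 → ℂ) ≠ 0 := vec_ne_zero 2 (by simp)
  have h2 : (![0, -s, 1] : Fin 3 → ℂ) ≠ 0 := vec_ne_zero 2 (by simp)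
  rw [Set.encard_eq_two]
  refine ⟨Projectivization.mk ℂ _ h1, Projectivization.mk ℂ _ h2, ?_,
    basePoints_of_forms fun v hv => ?_⟩
  · rw [Ne, mk_eq_mk_iff_cross']
    simp only [Matrix.cons_val_zero, Matrix.cons_val_one, Matrix.cons_val, mul_one, one_mul]
    rintro ⟨-, -, h⟩
    exact hs0 (by linear_combination h / 2)
  · simp only [nfD, cval_of, Set.mem_singleton_iff, Set.mem_insert_iff, mk_eq_mk_iff_cross']
    simp
    constructor
    · rintro ⟨e1, e2⟩
      simp only [e1] at e2 ⊢
      have : (v 1 - s * v 2) * (v 1 + s * v 2) = 0 := by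
        apply mul_left_cancel₀ hb'
        linear_combination e2 - v 2 ^ 2 * hs'
      rcases mul_eq_zero.1 this with h | h
      · left; simp; linear_combination h
      · right; simp; linear_combination h
    · rintro (⟨e1, e2, e3⟩ | ⟨e1, e2, e3⟩)
      · simp [e2, e3]; linear_combination v 2 ^ 2 * hs'
      · simp [e2, e3]; linear_combination v 2 ^ 2 * hs'

/-! ### Adapted bases -/

/-- The value of the bilinear form of a matrix. -/
def gram (M : Matrix (Fin 3) (Fin 3) ℝ) (u v : Fin 3 → ℝ) : ℝ := u ⬝ᵥ M *ᵥ v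

/-- The matrix with the given columns. -/
def cols (u v w : Fin 3 → ℝ) : Matrix (Fin 3) (Fin 3) ℝ := (Matrix.of ![u, v, w])ᵀ

theorem cong_cols (M : Matrix (Fin 3) (Fin 3) ℝ) (u v w : Fin 3 → ℝ) :
    cong (cols u v w) M = !![gram M u u, gram M u v, gram M u w;
      gram M v u, gram M v v, gram M v w; gram M w u, gram M w v, gram M w w] := by
  ext i j
  simp only [cong_apply, cols, Matrix.transpose_transpose, Matrix.mul_assoc, gram]
  fin_cases i <;> fin_cases j <;>
    simp [Matrix.mul_apply, dotProduct, Matrix.mulVec]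

theorem gram_comm {M : Matrix (Fin 3) (Fin 3) ℝ} (hM : M.IsSymm) (u v : Fin 3 → ℝ) :
    gram M u v = gram M v u := by
  rw [gram, Matrix.dotProduct_mulVec, ← Matrix.mulVec_transpose, hM.eq, dotProduct_comm, gram]

theorem gram_mul (g A : Matrix (Fin 3) (Fin 3) ℝ) (u v : Fin 3 → ℝ) :
    gram (g * A) u v = gram g u (A *ᵥ v) := by
  simp [gram, Matrix.mulVec_mulVec]

theorem gram_mulVec_left {g A : Matrix (Fin 3) (Fin 3) ℝ} (hg : g.IsSymm) (hA : (g * A).IsSymm)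
    (u v : Fin 3 → ℝ) : gram g (A *ᵥ u) v = gram g u (A *ᵥ v) := by
  rw [gram_comm hg, ← gram_mul, gram_comm hA, gram_mul]

theorem gram_add_right (M : Matrix (Fin 3) (Fin 3) ℝ) (u v w : Fin 3 → ℝ) :
    gram M u (v + w) = gram M u v + gram M u w := by
  simp [gram, Matrix.mulVec_add, dotProduct_add]

theorem gram_add_left (M : Matrix (Fin 3) (Fin 3) ℝ) (u v w : Fin 3 → ℝ) :
    gram M (u + v) w = gram M u w + gram M v w := by
  simp [gram, add_dotProduct]

theorem gram_sub_right (M : Matrix (Fin 3) (Fin 3) ℝ) (u v w : Fin 3 → ℝ) :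
    gram M u (v - w) = gram M u v - gram M u w := by
  simp [gram, Matrix.mulVec_sub, dotProduct_sub]

theorem gram_sub_left (M : Matrix (Fin 3) (Fin 3) ℝ) (u v w : Fin 3 → ℝ) :
    gram M (u - v) w = gram M u w - gram M v w := by
  simp [gram, sub_dotProduct]

theorem gram_smul_right (M : Matrix (Fin 3) (Fin 3) ℝ) (c : ℝ) (u v : Fin 3 → ℝ) :
    gram M u (c • v) = c * gram M u v := by
  simp [gram, Matrix.mulVec_smul]

theorem gram_smul_left (M : Matrix (Fin 3) (Fin 3) ℝ) (c : ℝ) (u v : Fin 3 → ℝ) :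
    gram M (c • u) v = c * gram M u v := by
  simp [gram]

theorem gram_zero_right (M : Matrix (Fin 3) (Fin 3) ℝ) (u : Fin 3 → ℝ) : gram M u 0 = 0 := by
  simp [gram]

/-- Polarization. It supplies the starting vector of every adapted basis. -/
theorem exists_gram_self_ne_zero {M : Matrix (Fin 3) (Fin 3) ℝ} (hM : M.IsSymm) (h : M ≠ 0) :
    ∃ v, gram M v v ≠ 0 := by
  by_contra! H
  apply h
  ext i j
  have h1 : gram M (Pi.single i 1) (Pi.single j 1) = 0 := by
    have e := H (Pi.single i 1 + Pi.single j 1)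
    rw [gram_add_left, gram_add_right, gram_add_right, H, H,
      gram_comm hM (Pi.single j 1)] at e
    linarith
  simpa [gram] using h1

theorem det_cong (b M : Matrix (Fin 3) (Fin 3) ℝ) : (cong b M).det = b.det ^ 2 * M.det := by
  simp [cong_apply, Matrix.det_mul, Matrix.det_transpose]; ring

theorem det_cols (u v w : Fin 3 → ℝ) : (cols u v w).det = u ⬝ᵥ (crossProduct v w) := by
  rw [triple_product_eq_det, cols, Matrix.det_transpose]
  rfl

/-- Orthogonal complements are produced by cross products because these are polynomial in the data
and therefore vary continuously with a parameter. -/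
theorem gram_crossProduct_left {g : Matrix (Fin 3) (Fin 3) ℝ} (u v : Fin 3 → ℝ) :
    gram g (crossProduct u (g *ᵥ v)) v = 0 := by
  rw [gram, dotProduct_comm, dot_cross_self]

theorem gram_crossProduct_left' {g : Matrix (Fin 3) (Fin 3) ℝ} (u v : Fin 3 → ℝ) :
    gram g (crossProduct (g *ᵥ v) u) v = 0 := by
  rw [gram, dotProduct_comm, dot_self_cross]

/-- A matrix self-adjoint with respect to `g` has its trace determined by Gram matrices. -/
theorem exists_cong_mul_eq {g A c : Matrix (Fin 3) (Fin 3) ℝ} (hc : c.det ≠ 0) :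
    ∃ X : Matrix (Fin 3) (Fin 3) ℝ, cong c (g * A) = cong c g * X ∧ X.trace = A.trace ∧
      X = c⁻¹ * A * c := by
  have hu : IsUnit c.det := isUnit_iff_ne_zero.2 hc
  refine ⟨c⁻¹ * A * c, ?_, ?_, rfl⟩
  · simp only [cong_apply, Matrix.mul_assoc]
    rw [← Matrix.mul_assoc c c⁻¹, Matrix.mul_nonsing_inv c hu, Matrix.one_mul]
  · rw [Matrix.trace_mul_comm, ← Matrix.mul_assoc, Matrix.mul_nonsing_inv c hu, Matrix.one_mul]

/-- A basis adapted to a self-adjoint `A` and a vector `e` with `A² e = 0`. -/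
theorem adapted_basis_of_sq_eq_zero {g A : Matrix (Fin 3) (Fin 3) ℝ} (hg : g.IsSymm)
    (hA : (g * A).IsSymm) (hdet : g.det ≠ 0) {e : Fin 3 → ℝ} (he : A *ᵥ (A *ᵥ e) = 0)
    {b : ℝ} (hb : gram g e (A *ᵥ e) = b) (hb0 : b ≠ 0) {n : Fin 3 → ℝ}
    (hn : n = crossProduct (g *ᵥ e) (g *ᵥ (A *ᵥ e))) {k : ℝ} (hk : gram g n n = k)
    {e' : Fin 3 → ℝ} (he' : e' = e - (gram g e e / (2 * b)) • A *ᵥ e) :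
    k ≠ 0 ∧ cong (cols e' (A *ᵥ e) n) g = !![0, b, 0; b, 0, 0; 0, 0, k] ∧
      cong (cols e' (A *ᵥ e) n) (g * A) = !![b, 0, 0; 0, 0, 0; 0, 0, A.trace * k] := by
  have h22 : gram g (A *ᵥ e) (A *ᵥ e) = 0 := by
    rw [gram_mulVec_left hg hA, he, gram_zero_right]
  have hn1 : gram g n e = 0 := by rw [hn]; exact gram_crossProduct_left' _ _
  have hn2 : gram g n (A *ᵥ e) = 0 := by rw [hn]; exact gram_crossProduct_left _ _
  have hn1' : gram g e n = 0 := by rw [gram_comm hg, hn1]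
  have hn2' : gram g (A *ᵥ e) n = 0 := by rw [gram_comm hg, hn2]
  have h21 : gram g (A *ᵥ e) e = b := by rw [gram_comm hg, hb]
  have hAe' : A *ᵥ e' = A *ᵥ e := by
    rw [he', Matrix.mulVec_sub, Matrix.mulVec_smul, he, smul_zero, sub_zero]
  -- As `A *ᵥ e` is isotropic and pairs to `b` with `e`, the multiple of it subtracted in `e'` is
  -- exactly the one that makes `e'` isotropic.
  have h11 : gram g e' e' = 0 := by
    simp only [he', gram_sub_left, gram_sub_right, gram_smul_left, gram_smul_right, hb, h21, h22]
    field_simp; ring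
  have h12 : gram g e' (A *ᵥ e) = b := by
    simp only [he', gram_sub_left, gram_smul_left, hb, h22]; ring
  have h13 : gram g e' n = 0 := by
    simp only [he', gram_sub_left, gram_smul_left, hn1', hn2']; ring
  have hcong : cong (cols e' (A *ᵥ e) n) g = !![0, b, 0; b, 0, 0; 0, 0, k] := by
    rw [cong_cols, h11, h12, h13, gram_comm hg _ e', h12, h22, hn2', gram_comm hg n e', h13,
      hn2, hk]
  have hdetc : (cols e' (A *ᵥ e) n).det ≠ 0 := by
    -- By cyclic permutation the determinant is the scalar product of `n` with the cross product of
    -- the first two columns. The Binet–Cauchy identity turns it into a 2 × 2 determinant of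
    -- `g`-products.
    have e1 : (cols e' (A *ᵥ e) n).det = - b ^ 2 := by
      rw [det_cols, triple_product_permutation, triple_product_permutation,
        hn, cross_dot_cross]
      have t1 : (g *ᵥ e) ⬝ᵥ e' = 0 + gram g e e / 2 := by
        rw [dotProduct_comm]
        change gram g e' e = _
        simp only [he', gram_sub_left, gram_smul_left, h21]
        field_simp; ring
      have t2 : (g *ᵥ (A *ᵥ e)) ⬝ᵥ (A *ᵥ e) = 0 := by
        rw [dotProduct_comm]; exact h22
      have t3 : (g *ᵥ e) ⬝ᵥ (A *ᵥ e) = b := by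
        rw [dotProduct_comm]; exact h21
      have t4 : (g *ᵥ (A *ᵥ e)) ⬝ᵥ e' = b := by
        rw [dotProduct_comm]; exact h12
      rw [t1, t2, t3, t4]; ring
    rw [e1]
    simpa using hb0
  have hk0 : k ≠ 0 := by
    rintro rfl
    have := det_cong (cols e' (A *ᵥ e) n) g
    rw [hcong, Matrix.det_fin_three] at this
    simp at this
    tauto
  refine ⟨hk0, hcong, ?_⟩
  -- The last diagonal entry is found through the trace: `X` is conjugate to `A`, its first two
  -- diagonal entries turn out to be zero, so the third is the trace of `A`.
  obtain ⟨X, hX, htr, -⟩ := exists_cong_mul_eq (g := g) (A := A) hdetc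
  have hh : cong (cols e' (A *ᵥ e) n) (g * A) =
      !![b, 0, 0; 0, 0, 0; 0, 0, gram (g * A) n n] := by
    rw [cong_cols, gram_comm hA (A *ᵥ e) e', gram_comm hA n e', gram_comm hA n (A *ᵥ e)]
    have a1 : gram (g * A) e' e' = b := by rw [gram_mul, hAe', h12]
    have a2 : gram (g * A) e' (A *ᵥ e) = 0 := by rw [gram_mul, he, gram_zero_right]
    have a3 : gram (g * A) (A *ᵥ e) (A *ᵥ e) = 0 := by rw [gram_mul, he, gram_zero_right]
    have a4 : gram (g * A) e' n = 0 := by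
      rw [gram_comm hA, gram_mul, hAe', hn2]
    have a5 : gram (g * A) (A *ᵥ e) n = 0 := by
      rw [gram_comm hA, gram_mul, he, gram_zero_right]
    rw [a1, a2, a3, a4, a5]
  rw [hh]
  rw [hh, hcong] at hX
  have x1 := congrFun (congrFun hX 0) 1
  have x2 := congrFun (congrFun hX 1) 0
  have x3 := congrFun (congrFun hX 2) 2
  simp [Matrix.mul_apply, Fin.sum_univ_three, hb0] at x1 x2 x3
  rw [Matrix.trace_fin_three, x1, x2] at htr
  rw [x3, ← htr]
  congr 1
  ring_nf

theorem pen_smul_smul {x y : ℝ} (hx : x ≠ 0) (hy : y ≠ 0) (f g : Matrix (Fin 3) (Fin 3) ℝ) :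
    pen (x • f) (y • g) = pen f g := by
  apply le_antisymm
  · rw [Submodule.span_le]
    rintro _ (rfl | rfl)
    · exact Submodule.smul_mem _ _ (Submodule.subset_span (by simp))
    · exact Submodule.smul_mem _ _ (Submodule.subset_span (by simp))
  · rw [Submodule.span_le]
    rintro _ (rfl | rfl)
    · exact (Submodule.smul_mem_iff _ hx).1 (Submodule.subset_span (by simp))
    · exact (Submodule.smul_mem_iff _ hy).1 (Submodule.subset_span (by simp))

theorem map_cong_pen (b f g : Matrix (Fin 3) (Fin 3) ℝ) :
    (pen f g).map (cong b) = pen (cong b f) (cong b g) := by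
  rw [Submodule.map_span, Set.image_pair]

theorem isSymm_mul_mul {g A B : Matrix (Fin 3) (Fin 3) ℝ} (hg : g.IsSymm)
    (hA : (g * A).IsSymm) (hB : (g * B).IsSymm) (hAB : A * B = B * A) :
    (g * (A * B)).IsSymm := by
  have hA' : Aᵀ * g = g * A := by
    have := hA.eq
    rwa [Matrix.transpose_mul, hg.eq] at this
  have hB' : Bᵀ * g = g * B := by
    have := hB.eq
    rwa [Matrix.transpose_mul, hg.eq] at this
  change (g * (A * B))ᵀ = _
  rw [Matrix.transpose_mul, hg.eq, Matrix.transpose_mul, Matrix.mul_assoc, hA',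
    ← Matrix.mul_assoc, hB', Matrix.mul_assoc, hAB]

/-- A Jordan basis for a nilpotent self-adjoint `A` of order three. -/
theorem adapted_basis_of_cube_eq_zero {g A : Matrix (Fin 3) (Fin 3) ℝ} (hg : g.IsSymm)
    (hA : (g * A).IsSymm) {e : Fin 3 → ℝ} (he : A *ᵥ (A *ᵥ (A *ᵥ e)) = 0)
    {c : ℝ} (hc : gram g e (A *ᵥ (A *ᵥ e)) = c) (hc0 : c ≠ 0) {p q : ℝ}
    (hp : p = -(gram g e (A *ᵥ e) / (2 * c)))
    (hq : q = -((gram g e e + 2 * p * gram g e (A *ᵥ e) + p ^ 2 * c) / (2 * c)))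
    {e₁ : Fin 3 → ℝ} (he₁ : e₁ = e + (p • A *ᵥ e + q • A *ᵥ (A *ᵥ e))) :
    cong (cols e₁ (A *ᵥ e₁) (A *ᵥ (A *ᵥ e₁))) g = c • nfG' ∧
      cong (cols e₁ (A *ᵥ e₁) (A *ᵥ (A *ᵥ e₁))) (g * A) = c • nfH' := by
  have hs := fun u v => gram_mulVec_left hg hA u v
  have h2 : A *ᵥ e₁ = A *ᵥ e + p • A *ᵥ (A *ᵥ e) := by
    rw [he₁, Matrix.mulVec_add, Matrix.mulVec_add, Matrix.mulVec_smul, Matrix.mulVec_smul, he,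
      smul_zero, add_zero]
  have h3 : A *ᵥ (A *ᵥ e₁) = A *ᵥ (A *ᵥ e) := by
    rw [h2, Matrix.mulVec_add, Matrix.mulVec_smul, he, smul_zero, add_zero]
  have h4 : A *ᵥ (A *ᵥ (A *ᵥ e₁)) = 0 := by rw [h3, he]
  -- The coefficient `q` is the one that cancels this product for any `p`, while `p` is the one that
  -- cancels the product of `e₁` and `A *ᵥ e₁`.
  have g11 : gram g e₁ e₁ = 0 := by
    simp only [he₁, gram_add_left, gram_add_right, gram_smul_left, gram_smul_right, hs, he,
      Matrix.mulVec_zero, gram_zero_right, hc, hq]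
    field_simp; ring
  have g12 : gram g e₁ (A *ᵥ e₁) = 0 := by
    rw [h2]
    simp only [he₁, gram_add_left, gram_add_right, gram_smul_left, gram_smul_right, hs, he,
      Matrix.mulVec_zero, gram_zero_right, hc, hp]
    field_simp; ring
  have g13 : gram g e₁ (A *ᵥ (A *ᵥ e₁)) = c := by
    rw [h3]
    simp only [he₁, gram_add_left, gram_smul_left, hs, he,
      Matrix.mulVec_zero, gram_zero_right, hc]
    ring
  constructor
  · rw [cong_cols]
    simp only [hs, h4, g11, g12, g13, gram_zero_right]
    ext i j
    fin_cases i <;> fin_cases j <;> simp [nfG', gram_zero_right]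
  · rw [cong_cols]
    simp only [gram_mul, hs, h4, g12, g13, gram_zero_right]
    ext i j
    fin_cases i <;> fin_cases j <;> simp [nfH', gram_zero_right]

/-- An orthogonal eigenbasis for a self-adjoint `A` with `A² = μ A` and trace `μ`. -/
theorem adapted_basis_of_sq_eq_smul {g A : Matrix (Fin 3) (Fin 3) ℝ} (hg : g.IsSymm)
    (hA : (g * A).IsSymm) (hdet : g.det ≠ 0) {μ : ℝ} (hμ : μ ≠ 0) (hAA : A * A = μ • A)
    (htr : A.trace = μ) {e : Fin 3 → ℝ} (he : A *ᵥ e = μ • e)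
    {d : ℝ} (hd : gram g e e = d) (hd0 : d ≠ 0) {x e₂ n : Fin 3 → ℝ}
    (he₂ : e₂ = x - (gram g x e / d) • e)
    {d₂ : ℝ} (hd₂ : gram g e₂ e₂ = d₂) (hd₂0 : d₂ ≠ 0)
    (hn : n = crossProduct (g *ᵥ e) (g *ᵥ e₂)) {k : ℝ} (hk : gram g n n = k) :
    k ≠ 0 ∧ cong (cols e e₂ n) g = nfD d d₂ k ∧ cong (cols e e₂ n) (g * A) = nfD (μ * d) 0 0 := by
  have h21 : gram g e₂ e = 0 := by
    rw [he₂, gram_sub_left, gram_smul_left, hd]; field_simp; ring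
  have h12 : gram g e e₂ = 0 := by rw [gram_comm hg, h21]
  have hn1 : gram g n e = 0 := by rw [hn]; exact gram_crossProduct_left' _ _
  have hn2 : gram g n e₂ = 0 := by rw [hn]; exact gram_crossProduct_left _ _
  have hn1' : gram g e n = 0 := by rw [gram_comm hg, hn1]
  have hn2' : gram g e₂ n = 0 := by rw [gram_comm hg, hn2]
  have hcong : cong (cols e e₂ n) g = nfD d d₂ k := by
    rw [cong_cols, hd, h12, hn1', h21, hd₂, hn2', hn1, hn2, hk, nfD]
  have hdetc : (cols e e₂ n).det ≠ 0 := by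
    have e1 : (cols e e₂ n).det = d * d₂ := by
      rw [det_cols, triple_product_permutation, triple_product_permutation,
        hn, cross_dot_cross]
      have t1 : (g *ᵥ e) ⬝ᵥ e = d := by rw [dotProduct_comm]; exact hd
      have t2 : (g *ᵥ e₂) ⬝ᵥ e₂ = d₂ := by rw [dotProduct_comm]; exact hd₂
      have t3 : (g *ᵥ e) ⬝ᵥ e₂ = 0 := by rw [dotProduct_comm]; exact h21
      rw [t1, t2, t3]; ring
    rw [e1]
    exact mul_ne_zero hd0 hd₂0
  have hk0 : k ≠ 0 := by
    rintro rfl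
    have := det_cong (cols e e₂ n) g
    rw [hcong, nfD, Matrix.det_fin_three] at this
    simp at this
    tauto
  refine ⟨hk0, hcong, ?_⟩
  obtain ⟨X, hX, htrX, hXA⟩ := exists_cong_mul_eq (g := g) (A := A) hdetc
  have hXX : X * X = μ • X := by
    have hu : IsUnit (cols e e₂ n).det := isUnit_iff_ne_zero.2 hdetc
    rw [hXA, ← Matrix.smul_mul, ← Matrix.mul_smul, ← hAA]
    simp only [Matrix.mul_assoc]
    rw [← Matrix.mul_assoc (cols e e₂ n) (cols e e₂ n)⁻¹, Matrix.mul_nonsing_inv _ hu,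
      Matrix.one_mul]
  obtain ⟨α, hα⟩ : ∃ α, gram (g * A) e₂ e₂ = α := ⟨_, rfl⟩
  obtain ⟨β, hβ⟩ : ∃ β, gram (g * A) e₂ n = β := ⟨_, rfl⟩
  obtain ⟨δ, hδ⟩ : ∃ δ, gram (g * A) n n = δ := ⟨_, rfl⟩
  have hh : cong (cols e e₂ n) (g * A) = !![μ * d, 0, 0; 0, α, β; 0, β, δ] := by
    rw [cong_cols, gram_comm hA n e₂, hα, hβ, hδ, gram_comm hA e e₂, gram_comm hA e n,
      gram_mul _ _ e e, gram_mul _ _ e₂ e, gram_mul _ _ n e, he, gram_smul_right, gram_smul_right,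
      gram_smul_right, h21, hn1, hd, mul_zero]
  rw [hh]
  rw [hh, hcong, nfD] at hX
  have x (i j) := congrFun (congrFun hX i) j
  have x00 := x 0 0
  have x11 := x 1 1
  have x12 := x 1 2
  have x21 := x 2 1
  have x22 := x 2 2
  have x10 := x 1 0
  have x20 := x 2 0
  simp [Matrix.mul_apply, Fin.sum_univ_three, hd₂0, hk0] at x00 x11 x12 x21 x22 x10 x20
  have y (i j) := congrFun (congrFun hXX i) j
  have y11 := y 1 1
  have y12 := y 1 2
  have y22 := y 2 2
  simp [Matrix.mul_apply, Fin.sum_univ_three, x10, x20] at y11 y12 y22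
  have z00 : X 0 0 = μ := mul_left_cancel₀ hd0 (by linear_combination -x00)
  rw [Matrix.trace_fin_three, htr, z00] at htrX
  -- The lower 2 × 2 block Y of `X` has trace zero and satisfies Y² = μY. Subtracting the diagonal
  -- entries of that relation gives equality of the two entries, and then everything in the block
  -- vanishes.
  have e1 : X 1 1 = X 2 2 := mul_left_cancel₀ hμ (by
    linear_combination -y11 + y22 + (X 1 1 - X 2 2) * htrX)
  have e2 : X 1 1 = 0 := by linarith
  have e3 : X 2 2 = 0 := by linarith
  have e4 : X 1 2 = 0 := by
    rw [e2, e3] at y12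
    simpa [hμ, eq_comm] using y12
  rw [x11, x12, x22, e2, e3, e4, nfD]
  simp

/-- The value of `g` on the projection of `x` to the complement of `e` is the value at `x` of `g`
minus a rank-one matrix. That difference is nonzero since `g` is invertible, so it has a
non-isotropic vector. -/
theorem exists_projection_nonisotropic {g : Matrix (Fin 3) (Fin 3) ℝ} (hg : g.IsSymm)
    (hdet : g.det ≠ 0) {e : Fin 3 → ℝ} {d : ℝ} (hd : gram g e e = d) (hd0 : d ≠ 0) :
    ∃ x, gram g (x - (gram g x e / d) • e) (x - (gram g x e / d) • e) ≠ 0 := by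
  set M : Matrix (Fin 3) (Fin 3) ℝ := g - d⁻¹ • Matrix.vecMulVec (g *ᵥ e) (g *ᵥ e) with hM
  have hsymm : M.IsSymm := by
    change Mᵀ = M
    rw [hM, Matrix.transpose_sub, hg.eq, Matrix.transpose_smul, Matrix.transpose_vecMulVec]
  have hne : M ≠ 0 := by
    intro h0
    apply hdet
    rw [sub_eq_zero.1 (hM.symm.trans h0), Matrix.det_fin_three]
    simp [Matrix.vecMulVec_apply]
    ring
  obtain ⟨x, hx⟩ := exists_gram_self_ne_zero hsymm hne
  refine ⟨x, ?_⟩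
  convert hx using 1
  rw [gram_sub_left, gram_sub_right, gram_sub_right, gram_smul_left, gram_smul_left,
    gram_smul_right, gram_smul_right, hd, gram_comm hg e x]
  have : gram M x x = gram g x x - d⁻¹ * (gram g x e * gram g x e) := by
    rw [hM, gram, Matrix.sub_mulVec, dotProduct_sub, Matrix.smul_mulVec, dotProduct_smul,
      Matrix.vecMulVec_mulVec]
    simp only [gram, op_smul_eq_smul, dotProduct_smul, smul_eq_mul]
    rw [dotProduct_comm (g *ᵥ e) x]
  rw [this]
  field_simp
  ring

/-! ### Continuity of adapted bases -/

variable {T : Type*} [TopologicalSpace T] {t : T}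

@[fun_prop]
theorem continuousAt_mulVec {A : T → Matrix (Fin 3) (Fin 3) ℝ} {v : T → Fin 3 → ℝ}
    (hA : ContinuousAt A t) (hv : ContinuousAt v t) : ContinuousAt (fun t => A t *ᵥ v t) t := by
  have : Continuous fun p : Matrix (Fin 3) (Fin 3) ℝ × (Fin 3 → ℝ) => p.1 *ᵥ p.2 :=
    continuous_fst.matrix_mulVec continuous_snd
  exact ContinuousAt.comp (g := fun p : Matrix (Fin 3) (Fin 3) ℝ × (Fin 3 → ℝ) => p.1 *ᵥ p.2)
    this.continuousAt (hA.prodMk hv)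

@[fun_prop]
theorem continuousAt_gram {A : T → Matrix (Fin 3) (Fin 3) ℝ} {u v : T → Fin 3 → ℝ}
    (hA : ContinuousAt A t) (hu : ContinuousAt u t) (hv : ContinuousAt v t) :
    ContinuousAt (fun t => gram (A t) (u t) (v t)) t := by
  have : Continuous fun p : (Fin 3 → ℝ) × (Fin 3 → ℝ) => p.1 ⬝ᵥ p.2 :=
    continuous_fst.dotProduct continuous_snd
  exact ContinuousAt.comp (g := fun p : (Fin 3 → ℝ) × (Fin 3 → ℝ) => p.1 ⬝ᵥ p.2)
    this.continuousAt (hu.prodMk (continuousAt_mulVec hA hv))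

@[fun_prop]
theorem continuousAt_cross {u v : T → Fin 3 → ℝ}
    (hu : ContinuousAt u t) (hv : ContinuousAt v t) :
    ContinuousAt (fun t => crossProduct (u t) (v t)) t := by
  have hu' := continuousAt_pi.1 hu
  have hv' := continuousAt_pi.1 hv
  refine continuousAt_pi.2 fun i => ?_
  simp only [cross_apply]
  fin_cases i
  · exact ((hu' 1).mul (hv' 2)).sub ((hu' 2).mul (hv' 1))
  · exact ((hu' 2).mul (hv' 0)).sub ((hu' 0).mul (hv' 2))
  · exact ((hu' 0).mul (hv' 1)).sub ((hu' 1).mul (hv' 0))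

@[fun_prop]
theorem continuousAt_cols {u v w : T → Fin 3 → ℝ}
    (hu : ContinuousAt u t) (hv : ContinuousAt v t) (hw : ContinuousAt w t) :
    ContinuousAt (fun t => cols (u t) (v t) (w t)) t := by
  refine continuousAt_pi.2 fun i => continuousAt_pi.2 fun j => ?_
  fin_cases j
  · exact continuousAt_pi.1 hu i
  · exact continuousAt_pi.1 hv i
  · exact continuousAt_pi.1 hw i

/-! ### Continuous reduction of families of pencils to a fixed normal form. -/

/-- Near `t₀` the pencil `W t` is carried to the fixed pencil `N` by a congruence depending
continuously on `t`. -/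
def HasLocalForm (t₀ : T) (W : T → Submodule ℝ (Matrix (Fin 3) (Fin 3) ℝ))
    (N : Submodule ℝ (Matrix (Fin 3) (Fin 3) ℝ)) : Prop :=
  ∃ c : T → Matrix (Fin 3) (Fin 3) ℝ, ∀ᶠ t in 𝓝 t₀,
    ContinuousAt c t ∧ (c t).det ≠ 0 ∧ (W t).map (cong (c t)) = N

theorem cong_cols_smul (M : Matrix (Fin 3) (Fin 3) ℝ) (u v w : Fin 3 → ℝ) (x y z : ℝ) :
    cong (cols (x • u) (y • v) (z • w)) M = Matrix.of fun i j =>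
      ![x, y, z] i * ![x, y, z] j * cong (cols u v w) M i j := by
  simp only [cong_cols]
  ext i j
  fin_cases i <;> fin_cases j <;> simp [gram_smul_left, gram_smul_right] <;> ring

theorem det_ne_zero_of_cong {c g : Matrix (Fin 3) (Fin 3) ℝ} (h : (cong c g).det ≠ 0) :
    c.det ≠ 0 := by
  rw [det_cong] at h
  intro h0
  simp [h0] at h

section

variable {T : Type*} [TopologicalSpace T] {t₀ : T}

/-- Serves both the type with three base points and the type with one, where `μ₀ = 0`. The basis is
rescaled so that the pencil no longer depends on `t`: the factors `ρ` and `ρ⁻¹` absorb the variation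
of the trace, and the factor on `n` keeps the ratio of `k` to `b` constant. -/
theorem hasLocalForm_of_sq_eq_zero {A g : T → Matrix (Fin 3) (Fin 3) ℝ} {e : T → Fin 3 → ℝ}
    {ρ : T → ℝ} {μ₀ : ℝ}
    (h : ∀ᶠ t in 𝓝 t₀, ContinuousAt A t ∧ ContinuousAt g t ∧ ContinuousAt e t ∧ ContinuousAt ρ t ∧
      (g t).IsSymm ∧ (g t * A t).IsSymm ∧ (g t).det ≠ 0 ∧ ρ t ≠ 0 ∧
      (A t).trace = ρ t ^ 2 * μ₀ ∧ A t *ᵥ (A t *ᵥ e t) = 0)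
    (hb : gram (g t₀) (e t₀) (A t₀ *ᵥ e t₀) ≠ 0) :
    ∃ γ, γ ≠ 0 ∧ HasLocalForm t₀ (fun t => pen (g t * A t) (g t))
      (pen (nfH (μ₀ * γ)) (nfG γ)) := by
  obtain ⟨b, hbdef⟩ : ∃ b : T → ℝ, b = fun t => gram (g t) (e t) (A t *ᵥ e t) := ⟨_, rfl⟩
  obtain ⟨n, hn⟩ : ∃ n : T → Fin 3 → ℝ,
    n = fun t => crossProduct (g t *ᵥ e t) (g t *ᵥ (A t *ᵥ e t)) := ⟨_, rfl⟩
  obtain ⟨k, hk⟩ : ∃ k : T → ℝ, k = fun t => gram (g t) (n t) (n t) := ⟨_, rfl⟩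
  obtain ⟨e', he'⟩ : ∃ e' : T → Fin 3 → ℝ,
    e' = fun t => e t - (gram (g t) (e t) (e t) / (2 * b t)) • A t *ᵥ e t := ⟨_, rfl⟩
  have hbt₀ : b t₀ ≠ 0 := by rw [hbdef]; exact hb
  have basis : ∀ᶠ t in 𝓝 t₀, b t ≠ 0 → k t ≠ 0 ∧
      cong (cols (e' t) (A t *ᵥ e t) (n t)) (g t) = !![0, b t, 0; b t, 0, 0; 0, 0, k t] ∧
      cong (cols (e' t) (A t *ᵥ e t) (n t)) (g t * A t) =
        !![b t, 0, 0; 0, 0, 0; 0, 0, (A t).trace * k t] := by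
    filter_upwards [h] with t ht hb0
    obtain ⟨-, -, -, -, h1, h2, h3, -, -, h4⟩ := ht
    exact adapted_basis_of_sq_eq_zero h1 h2 h3 h4 (congrFun hbdef.symm t) hb0
      (congrFun hn t) (congrFun hk.symm t) (congrFun he' t)
  have hcont : ∀ᶠ t in 𝓝 t₀, ContinuousAt b t ∧ ContinuousAt n t ∧ ContinuousAt k t := by
    filter_upwards [h] with t ht
    obtain ⟨h1, h2, h3, -⟩ := ht
    have hn' : ContinuousAt n t := by rw [hn]; fun_prop
    exact ⟨by rw [hbdef]; fun_prop, hn', by rw [hk]; fun_prop⟩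
  have hkt₀ : k t₀ ≠ 0 := (basis.self_of_nhds hbt₀).1
  -- With this choice `γ * b / k` equals 1 at `t₀`, so it stays positive nearby and has a continuous
  -- square root.
  obtain ⟨γ, hγ⟩ : ∃ γ, γ = k t₀ / b t₀ := ⟨_, rfl⟩
  have hγ0 : γ ≠ 0 := by rw [hγ]; exact div_ne_zero hkt₀ hbt₀
  have hbne : ∀ᶠ t in 𝓝 t₀, b t ≠ 0 := hcont.self_of_nhds.1.eventually_ne hbt₀
  have hkne : ∀ᶠ t in 𝓝 t₀, k t ≠ 0 := hcont.self_of_nhds.2.2.eventually_ne hkt₀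
  have hpos : ∀ᶠ t in 𝓝 t₀, 0 < γ * b t / k t := by
    have : ContinuousAt (fun t => γ * b t / k t) t₀ :=
      (continuousAt_const.mul hcont.self_of_nhds.1).div hcont.self_of_nhds.2.2 hkt₀
    refine continuousAt_const.eventually_lt this ?_
    rw [hγ]
    field_simp
    norm_num
  refine ⟨γ, hγ0, fun t => cols (ρ t • e' t) ((ρ t)⁻¹ • A t *ᵥ e t)
    (Real.sqrt (γ * b t / k t) • n t), ?_⟩
  filter_upwards [h, basis, hcont, hbne, hkne, hpos] with t ht hbas hc hb0 hk0 hp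
  obtain ⟨h1, h2, h3, h4, -, -, -, hρ, htr, -⟩ := ht
  obtain ⟨-, hG, hH⟩ := hbas hb0
  obtain ⟨hc1, hc2, hc3⟩ := hc
  have hz : Real.sqrt (γ * b t / k t) * Real.sqrt (γ * b t / k t) * k t = γ * b t := by
    rw [Real.mul_self_sqrt hp.le]; field_simp
  have eG : cong (cols (ρ t • e' t) ((ρ t)⁻¹ • A t *ᵥ e t)
      (Real.sqrt (γ * b t / k t) • n t)) (g t) = b t • nfG γ := by
    rw [cong_cols_smul, hG]
    ext i j
    fin_cases i <;> fin_cases j <;> simp [nfG, hρ]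
    rw [hz]; ring
  have eH : cong (cols (ρ t • e' t) ((ρ t)⁻¹ • A t *ᵥ e t)
      (Real.sqrt (γ * b t / k t) • n t)) (g t * A t) = (ρ t ^ 2 * b t) • nfH (μ₀ * γ) := by
    rw [cong_cols_smul, hH]
    ext i j
    fin_cases i <;> fin_cases j <;> simp [nfH]
    · left; ring
    · rw [htr]; linear_combination ρ t ^ 2 * μ₀ * hz
  refine ⟨?_, det_ne_zero_of_cong (g := g t) ?_, ?_⟩
  · have : ContinuousAt e' t := by
      rw [he']
      have h2b : 2 * b t ≠ 0 := by simpa using hb0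
      exact h3.sub (ContinuousAt.smul (ContinuousAt.div (continuousAt_gram h2 h3 h3)
        (continuousAt_const.mul hc1) h2b) (continuousAt_mulVec h1 h3))
    have hρ' : ContinuousAt (fun t => (ρ t)⁻¹) t := h4.inv₀ hρ
    have hs : ContinuousAt (fun t => Real.sqrt (γ * b t / k t)) t :=
      ((continuousAt_const.mul hc1).div hc3 hk0).sqrt
    fun_prop
  · rw [eG, nfG, Matrix.det_fin_three]
    simp [hb0, hγ0]
  · rw [map_cong_pen, eG, eH, pen_smul_smul (by positivity) hb0]

/-- A constant vector `e` suffices, and no modulus remains: both Gram matrices are the same scalar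
times fixed matrices. -/
theorem hasLocalForm_of_cube_eq_zero {A g : T → Matrix (Fin 3) (Fin 3) ℝ} {e : Fin 3 → ℝ}
    (h : ∀ᶠ t in 𝓝 t₀, ContinuousAt A t ∧ ContinuousAt g t ∧
      (g t).IsSymm ∧ (g t * A t).IsSymm ∧ A t *ᵥ (A t *ᵥ (A t *ᵥ e)) = 0)
    (hc : gram (g t₀) e (A t₀ *ᵥ (A t₀ *ᵥ e)) ≠ 0) :
    HasLocalForm t₀ (fun t => pen (g t * A t) (g t)) (pen nfH' nfG') := by
  obtain ⟨c, hcdef⟩ : ∃ c : T → ℝ, c = fun t => gram (g t) e (A t *ᵥ (A t *ᵥ e)) := ⟨_, rfl⟩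
  obtain ⟨p, hp⟩ : ∃ p : T → ℝ, p = fun t => -(gram (g t) e (A t *ᵥ e) / (2 * c t)) := ⟨_, rfl⟩
  obtain ⟨q, hq⟩ : ∃ q : T → ℝ, q = fun t => -((gram (g t) e e +
    2 * p t * gram (g t) e (A t *ᵥ e) + p t ^ 2 * c t) / (2 * c t)) := ⟨_, rfl⟩
  obtain ⟨e₁, he₁⟩ : ∃ e₁ : T → Fin 3 → ℝ,
    e₁ = fun t => e + (p t • A t *ᵥ e + q t • A t *ᵥ (A t *ᵥ e)) := ⟨_, rfl⟩
  have hcc : ∀ᶠ t in 𝓝 t₀, ContinuousAt c t := by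
    filter_upwards [h] with t ht
    obtain ⟨h1, h2, -⟩ := ht
    rw [hcdef]; fun_prop
  have hc0 : ∀ᶠ t in 𝓝 t₀, c t ≠ 0 :=
    hcc.self_of_nhds.eventually_ne (by rw [hcdef]; exact hc)
  refine ⟨fun t => cols (e₁ t) (A t *ᵥ e₁ t) (A t *ᵥ (A t *ᵥ e₁ t)), ?_⟩
  filter_upwards [h, hcc, hc0] with t ht hct hct0
  obtain ⟨h1, h2, h3, h4, h5⟩ := ht
  obtain ⟨eG, eH⟩ := adapted_basis_of_cube_eq_zero h3 h4 h5 (congrFun hcdef.symm t) hct0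
    (congrFun hp t) (congrFun hq t) (congrFun he₁ t)
  have h2c : 2 * c t ≠ 0 := by simpa using hct0
  refine ⟨?_, det_ne_zero_of_cong (g := g t) ?_, ?_⟩
  · have hp' : ContinuousAt p t := by
      rw [hp]
      exact (ContinuousAt.div (by fun_prop) (continuousAt_const.mul hct) h2c).neg
    have hq' : ContinuousAt q t := by
      rw [hq]
      exact (ContinuousAt.div (by fun_prop) (continuousAt_const.mul hct) h2c).neg
    have : ContinuousAt e₁ t := by rw [he₁]; fun_prop
    fun_prop
  · rw [eG, nfG', Matrix.det_fin_three]
    simp [hct0]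
  · rw [map_cong_pen, eG, eH, pen_smul_smul hct0 hct0]

/-- The orthogonal eigenbasis is rescaled by square roots of ratios of values at `t₀` and `t`. The
matrix of `g` becomes constant, and that of `g * A` a nonzero multiple of the square of one
coordinate. -/
theorem hasLocalForm_of_sq_eq_smul {A g : T → Matrix (Fin 3) (Fin 3) ℝ} {e : T → Fin 3 → ℝ}
    {μ : T → ℝ}
    (h : ∀ᶠ t in 𝓝 t₀, ContinuousAt A t ∧ ContinuousAt g t ∧ ContinuousAt e t ∧
      (g t).IsSymm ∧ (g t * A t).IsSymm ∧ (g t).det ≠ 0 ∧ μ t ≠ 0 ∧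
      A t * A t = μ t • A t ∧ (A t).trace = μ t ∧ A t *ᵥ e t = μ t • e t)
    (hd : gram (g t₀) (e t₀) (e t₀) ≠ 0) :
    ∃ a b c, b ≠ 0 ∧ c ≠ 0 ∧ HasLocalForm t₀ (fun t => pen (g t * A t) (g t))
      (pen (nfD 1 0 0) (nfD a b c)) := by
  obtain ⟨-, -, -, s1, s2, s3, -⟩ := h.self_of_nhds
  obtain ⟨x, hx⟩ := exists_projection_nonisotropic s1 s3 rfl hd
  obtain ⟨d, hddef⟩ : ∃ d : T → ℝ, d = fun t => gram (g t) (e t) (e t) := ⟨_, rfl⟩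
  obtain ⟨e₂, he₂⟩ : ∃ e₂ : T → Fin 3 → ℝ,
    e₂ = fun t => x - (gram (g t) x (e t) / d t) • e t := ⟨_, rfl⟩
  obtain ⟨d₂, hd₂⟩ : ∃ d₂ : T → ℝ, d₂ = fun t => gram (g t) (e₂ t) (e₂ t) := ⟨_, rfl⟩
  obtain ⟨n, hn⟩ : ∃ n : T → Fin 3 → ℝ,
    n = fun t => crossProduct (g t *ᵥ e t) (g t *ᵥ (e₂ t)) := ⟨_, rfl⟩
  obtain ⟨k, hk⟩ : ∃ k : T → ℝ, k = fun t => gram (g t) (n t) (n t) := ⟨_, rfl⟩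
  have hdt₀ : d t₀ ≠ 0 := by rw [hddef]; exact hd
  have hd₂t₀ : d₂ t₀ ≠ 0 := by rw [hd₂, he₂, hddef]; exact hx
  have hdc : ∀ᶠ t in 𝓝 t₀, ContinuousAt d t := by
    filter_upwards [h] with t ht
    obtain ⟨h1, h2, h3, -⟩ := ht
    rw [hddef]; fun_prop
  have hdne : ∀ᶠ t in 𝓝 t₀, d t ≠ 0 := hdc.self_of_nhds.eventually_ne hdt₀
  have hcont : ∀ᶠ t in 𝓝 t₀, ContinuousAt e₂ t ∧ ContinuousAt d₂ t ∧ ContinuousAt n t ∧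
      ContinuousAt k t := by
    filter_upwards [h, hdc, hdne] with t ht hdt hdt0
    obtain ⟨h1, h2, h3, -⟩ := ht
    have he₂' : ContinuousAt e₂ t := by
      rw [he₂]
      exact continuousAt_const.sub (ContinuousAt.smul (ContinuousAt.div (by fun_prop) hdt hdt0) h3)
    have hn' : ContinuousAt n t := by rw [hn]; fun_prop
    exact ⟨he₂', by rw [hd₂]; fun_prop, hn', by rw [hk]; fun_prop⟩
  have hd₂ne : ∀ᶠ t in 𝓝 t₀, d₂ t ≠ 0 := hcont.self_of_nhds.2.1.eventually_ne hd₂t₀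
  have basis : ∀ᶠ t in 𝓝 t₀, k t ≠ 0 ∧
      cong (cols (e t) (e₂ t) (n t)) (g t) = nfD (d t) (d₂ t) (k t) ∧
      cong (cols (e t) (e₂ t) (n t)) (g t * A t) = nfD (μ t * d t) 0 0 := by
    filter_upwards [h, hdne, hd₂ne] with t ht hdt hd₂t
    obtain ⟨-, -, -, h1, h2, h3, h4, h5, h6, h7⟩ := ht
    exact adapted_basis_of_sq_eq_smul h1 h2 h3 h4 h5 h6 h7 (congrFun hddef.symm t) hdt
      (congrFun he₂ t) (congrFun hd₂.symm t) hd₂t (congrFun hn t) (congrFun hk.symm t)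
  have hkt₀ : k t₀ ≠ 0 := basis.self_of_nhds.1
  have hpos : ∀ {f : T → ℝ}, ContinuousAt f t₀ → f t₀ ≠ 0 → ∀ᶠ t in 𝓝 t₀, 0 < f t₀ / f t := by
    intro f hf hf0
    have : ContinuousAt (fun t => f t₀ / f t) t₀ := continuousAt_const.div hf hf0
    exact continuousAt_const.eventually_lt this (by rw [div_self hf0]; norm_num)
  refine ⟨d t₀, d₂ t₀, k t₀, hd₂t₀, hkt₀, fun t => cols (Real.sqrt (d t₀ / d t) • e t)
    (Real.sqrt (d₂ t₀ / d₂ t) • e₂ t) (Real.sqrt (k t₀ / k t) • n t), ?_⟩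
  filter_upwards [h, basis, hcont, hdc, hdne, hd₂ne, hpos hdc.self_of_nhds hdt₀,
    hpos hcont.self_of_nhds.2.1 hd₂t₀, hpos hcont.self_of_nhds.2.2.2 hkt₀]
    with t ht hbas hct hdct hdt hd₂t p1 p2 p3
  obtain ⟨h1, h2, h3, -, -, -, hμ, -⟩ := ht
  obtain ⟨hkt, hG, hH⟩ := hbas
  obtain ⟨c1, c2, c3, c4⟩ := hct
  have q1 : Real.sqrt (d t₀ / d t) * Real.sqrt (d t₀ / d t) * d t = d t₀ := by
    rw [Real.mul_self_sqrt p1.le]; field_simp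
  have q2 : Real.sqrt (d₂ t₀ / d₂ t) * Real.sqrt (d₂ t₀ / d₂ t) * d₂ t = d₂ t₀ := by
    rw [Real.mul_self_sqrt p2.le]; field_simp
  have q3 : Real.sqrt (k t₀ / k t) * Real.sqrt (k t₀ / k t) * k t = k t₀ := by
    rw [Real.mul_self_sqrt p3.le]; field_simp
  have eG : cong (cols (Real.sqrt (d t₀ / d t) • e t)
      (Real.sqrt (d₂ t₀ / d₂ t) • e₂ t) (Real.sqrt (k t₀ / k t) • n t)) (g t) =
      nfD (d t₀) (d₂ t₀) (k t₀) := by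
    rw [cong_cols_smul, hG]
    ext i j
    fin_cases i <;> fin_cases j <;> simp [nfD, q1, q2, q3]
  have eH : cong (cols (Real.sqrt (d t₀ / d t) • e t)
      (Real.sqrt (d₂ t₀ / d₂ t) • e₂ t) (Real.sqrt (k t₀ / k t) • n t)) (g t * A t) =
      (μ t * d t₀) • nfD 1 0 0 := by
    rw [cong_cols_smul, hH]
    ext i j
    fin_cases i <;> fin_cases j <;> simp [nfD]
    linear_combination μ t * q1
  refine ⟨?_, det_ne_zero_of_cong (g := g t) ?_, ?_⟩
  · have r1 : ContinuousAt (fun t => Real.sqrt (d t₀ / d t)) t :=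
      (continuousAt_const.div hdct hdt).sqrt
    have r2 : ContinuousAt (fun t => Real.sqrt (d₂ t₀ / d₂ t)) t :=
      (continuousAt_const.div c2 hd₂t).sqrt
    have r3 : ContinuousAt (fun t => Real.sqrt (k t₀ / k t)) t :=
      (continuousAt_const.div c4 hkt).sqrt
    fun_prop
  · rw [eG, nfD, Matrix.det_fin_three]
    simp [hdt₀, hd₂t₀, hkt₀]
  · rw [map_cong_pen, eG, eH]
    simpa using pen_smul_smul (mul_ne_zero hμ hdt₀) one_ne_zero (nfD 1 0 0)
      (nfD (d t₀) (d₂ t₀) (k t₀))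

end

section

variable {T : Type*} [TopologicalSpace T] {t₀ : T}

theorem encard_basePoints_of_map_cong {c : Matrix (Fin 3) (Fin 3) ℝ} (hc : c.det ≠ 0)
    (W : Submodule ℝ (Matrix (Fin 3) (Fin 3) ℝ)) :
    (basePoints (W.map (cong c))).encard = (basePoints W).encard :=
  encard_basePoints_map_cong (Matrix.GeneralLinearGroup.mkOfDetNeZero c hc) W

theorem HasLocalForm.encard_basePoints {W : T → Submodule ℝ (Matrix (Fin 3) (Fin 3) ℝ)}
    {N : Submodule ℝ (Matrix (Fin 3) (Fin 3) ℝ)} (h : HasLocalForm t₀ W N) :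
    (basePoints (W t₀)).encard = (basePoints N).encard := by
  obtain ⟨c, hc⟩ := h
  obtain ⟨-, h1, h2⟩ := hc.self_of_nhds
  rw [← h2, encard_basePoints_of_map_cong h1]

/-! ### The four types of pencil with a multiple eigenvalue. -/

/-- `A` is self-adjoint for `g`, with characteristic polynomial `X² (X - μ)`. -/
structure IsDoubleRoot (g A : Matrix (Fin 3) (Fin 3) ℝ) (μ : ℝ) : Prop where
  symm : g.IsSymm
  symm_mul : (g * A).IsSymm
  det_ne_zero : g.det ≠ 0
  sq_mul : A * A * (A - μ • 1) = 0
  trace_eq : A.trace = μ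

theorem isSymm_mul_sub_smul_one {g A : Matrix (Fin 3) (Fin 3) ℝ} (hg : g.IsSymm)
    (hA : (g * A).IsSymm) (μ : ℝ) : (g * (A - μ • 1)).IsSymm := by
  have : g * (A - μ • 1) = g * A - μ • g := by simp [Matrix.mul_sub]
  rw [this]
  exact hA.sub (hg.smul μ)

theorem mul_ne_zero_of_det_ne_zero {g B : Matrix (Fin 3) (Fin 3) ℝ} (hg : g.det ≠ 0)
    (hB : B ≠ 0) : g * B ≠ 0 := by
  intro h
  apply hB
  rw [← Matrix.one_mul B, ← Matrix.nonsing_inv_mul g (isUnit_iff_ne_zero.2 hg),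
    Matrix.mul_assoc, h, Matrix.mul_zero]

theorem commute_sub_smul_one (A : Matrix (Fin 3) (Fin 3) ℝ) (μ : ℝ) :
    A * (A - μ • 1) = (A - μ • 1) * A := by
  simp [Matrix.mul_sub, Matrix.sub_mul]

variable {A g : T → Matrix (Fin 3) (Fin 3) ℝ} {μ : T → ℝ}

/-- The vector e = (A - μ)v satisfies A²e = 0. Its product with Ae is -μ times the value at v of the
symmetric matrix gA(A - μ), which is nonzero, so a suitable v exists. -/
theorem exists_localForm_three
    (h : ∀ᶠ t in 𝓝 t₀, ContinuousAt A t ∧ ContinuousAt g t ∧ ContinuousAt μ t ∧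
      IsDoubleRoot (g t) (A t) (μ t))
    (hμ : μ t₀ ≠ 0) (hA : A t₀ * (A t₀ - μ t₀ • 1) ≠ 0) :
    ∃ γ ν, γ ≠ 0 ∧ ν ≠ 0 ∧ HasLocalForm t₀ (fun t => pen (g t * A t) (g t))
      (pen (nfH ν) (nfG γ)) := by
  obtain ⟨-, -, hμc, hd⟩ := h.self_of_nhds
  have hs := isSymm_mul_sub_smul_one hd.symm hd.symm_mul (μ t₀)
  obtain ⟨v, hv⟩ := exists_gram_self_ne_zero
    (isSymm_mul_mul hd.symm hd.symm_mul hs (commute_sub_smul_one _ _))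
    (mul_ne_zero_of_det_ne_zero hd.det_ne_zero hA)
  have hpos : ∀ᶠ t in 𝓝 t₀, 0 < μ t / μ t₀ := by
    have : ContinuousAt (fun t => μ t / μ t₀) t₀ := hμc.div_const _
    exact continuousAt_const.eventually_lt this (by rw [div_self hμ]; norm_num)
  obtain ⟨γ, hγ, hform⟩ := hasLocalForm_of_sq_eq_zero (t₀ := t₀) (A := A) (g := g)
    (e := fun t => (A t - μ t • 1) *ᵥ v) (ρ := fun t => Real.sqrt (μ t / μ t₀)) (μ₀ := μ t₀)
    (by
      filter_upwards [h, hpos] with t ht hp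
      obtain ⟨h1, h2, h3, h4⟩ := ht
      refine ⟨h1, h2, ?_, (h3.div_const _).sqrt, h4.symm, h4.symm_mul, h4.det_ne_zero,
        (Real.sqrt_pos.2 hp).ne', ?_, ?_⟩
      · have : ContinuousAt (fun t => A t - μ t • (1 : Matrix (Fin 3) (Fin 3) ℝ)) t :=
          h1.sub (h3.smul continuousAt_const)
        fun_prop
      · rw [Real.sq_sqrt hp.le, h4.trace_eq]; field_simp
      · rw [Matrix.mulVec_mulVec, Matrix.mulVec_mulVec, h4.sq_mul,
          Matrix.zero_mulVec])
    (by
      rw [gram_mulVec_left hd.symm hs, Matrix.mulVec_mulVec, Matrix.mulVec_mulVec]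
      have : (A t₀ - μ t₀ • 1) * (A t₀ * (A t₀ - μ t₀ • 1)) =
          (-μ t₀) • (A t₀ * (A t₀ - μ t₀ • 1)) := by
        rw [Matrix.sub_mul, ← Matrix.mul_assoc, hd.sq_mul]
        simp
      rw [Matrix.mul_assoc, this, Matrix.smul_mulVec, gram_smul_right, ← gram_mul]
      exact mul_ne_zero (neg_ne_zero.2 hμ) hv)
  exact ⟨γ, _, hγ, mul_ne_zero hμ hγ, hform⟩

theorem hasLocalForm_two
    (h : ∀ᶠ t in 𝓝 t₀, ContinuousAt A t ∧ ContinuousAt g t ∧ IsDoubleRoot (g t) (A t) 0)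
    (hA : A t₀ * A t₀ ≠ 0) :
    HasLocalForm t₀ (fun t => pen (g t * A t) (g t)) (pen nfH' nfG') := by
  obtain ⟨-, -, hd⟩ := h.self_of_nhds
  obtain ⟨v, hv⟩ := exists_gram_self_ne_zero
    (isSymm_mul_mul hd.symm hd.symm_mul hd.symm_mul rfl)
    (mul_ne_zero_of_det_ne_zero hd.det_ne_zero hA)
  refine hasLocalForm_of_cube_eq_zero (e := v) ?_ ?_
  · filter_upwards [h] with t ht
    obtain ⟨h1, h2, h3⟩ := ht
    refine ⟨h1, h2, h3.symm, h3.symm_mul, ?_⟩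
    have := h3.sq_mul
    rw [zero_smul, sub_zero] at this
    rw [Matrix.mulVec_mulVec, Matrix.mulVec_mulVec, this, Matrix.zero_mulVec]
  · rw [Matrix.mulVec_mulVec, ← gram_mul]
    exact hv

/-- Here A² = μA, so e = Av is an eigenvector for μ, and its square for `g` is μ times the value of
gA at v. -/
theorem exists_localForm_double
    (h : ∀ᶠ t in 𝓝 t₀, ContinuousAt A t ∧ ContinuousAt g t ∧ ContinuousAt μ t ∧
      IsDoubleRoot (g t) (A t) (μ t))
    (hμ : μ t₀ ≠ 0) (hA : ∀ᶠ t in 𝓝 t₀, A t * (A t - μ t • 1) = 0) :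
    ∃ a b c, b ≠ 0 ∧ c ≠ 0 ∧ HasLocalForm t₀ (fun t => pen (g t * A t) (g t))
      (pen (nfD 1 0 0) (nfD a b c)) := by
  obtain ⟨-, -, hμc, hd⟩ := h.self_of_nhds
  have hA0 : A t₀ ≠ 0 := by
    intro h0
    apply hμ
    rw [← hd.trace_eq, h0, Matrix.trace_zero]
  obtain ⟨v, hv⟩ := exists_gram_self_ne_zero hd.symm_mul
    (mul_ne_zero_of_det_ne_zero hd.det_ne_zero hA0)
  have hAA : ∀ {t}, A t * (A t - μ t • 1) = 0 → A t * A t = μ t • A t := by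
    intro t ht
    simpa [Matrix.mul_sub, sub_eq_zero] using ht
  refine hasLocalForm_of_sq_eq_smul (e := fun t => A t *ᵥ v) (μ := μ) ?_ ?_
  · filter_upwards [h, hA, hμc.eventually_ne hμ] with t ht hAt hμt
    obtain ⟨h1, h2, h3, h4⟩ := ht
    refine ⟨h1, h2, by fun_prop, h4.symm, h4.symm_mul, h4.det_ne_zero, hμt, hAA hAt,
      h4.trace_eq, ?_⟩
    rw [Matrix.mulVec_mulVec, hAA hAt, Matrix.smul_mulVec]
  · rw [gram_mulVec_left hd.symm hd.symm_mul, Matrix.mulVec_mulVec, hAA hA.self_of_nhds,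
      Matrix.smul_mulVec, gram_smul_right, ← gram_mul]
    exact mul_ne_zero hμ hv

theorem exists_localForm_one
    (h : ∀ᶠ t in 𝓝 t₀, ContinuousAt A t ∧ ContinuousAt g t ∧ IsDoubleRoot (g t) (A t) 0)
    (hA : ∀ᶠ t in 𝓝 t₀, A t * A t = 0) (hA0 : A t₀ ≠ 0) :
    ∃ γ, γ ≠ 0 ∧ HasLocalForm t₀ (fun t => pen (g t * A t) (g t)) (pen (nfH 0) (nfG γ)) := by
  obtain ⟨-, -, hd⟩ := h.self_of_nhds
  obtain ⟨v, hv⟩ := exists_gram_self_ne_zero hd.symm_mul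
    (mul_ne_zero_of_det_ne_zero hd.det_ne_zero hA0)
  obtain ⟨γ, hγ, hform⟩ := hasLocalForm_of_sq_eq_zero (t₀ := t₀) (A := A) (g := g)
    (e := fun _ => v) (ρ := fun _ => 1) (μ₀ := 0)
    (by
      filter_upwards [h, hA] with t ht hAt
      obtain ⟨h1, h2, h3⟩ := ht
      refine ⟨h1, h2, continuousAt_const, continuousAt_const, h3.symm, h3.symm_mul,
        h3.det_ne_zero, one_ne_zero, by simp [h3.trace_eq], ?_⟩
      rw [Matrix.mulVec_mulVec, hAt, Matrix.zero_mulVec])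
    (by rw [← gram_mul]; exact hv)
  rw [zero_mul] at hform
  exact ⟨γ, hγ, hform⟩

end

section

variable {g A : Matrix (Fin 3) (Fin 3) ℝ} {μ : ℝ}

/-- The local form is applied over a one-point parameter space, so that the reduction of a single
pencil needs no separate argument. -/
theorem IsDoubleRoot.encard_eq_three (h : IsDoubleRoot g A μ) (hμ : μ ≠ 0)
    (hA : A * (A - μ • 1) ≠ 0) : (basePoints (pen (g * A) g)).encard = 3 := by
  obtain ⟨γ, ν, hγ, hν, hform⟩ := exists_localForm_three (T := Unit) (t₀ := ()) (A := fun _ => A)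
    (g := fun _ => g) (μ := fun _ => μ) (Filter.Eventually.of_forall fun _ =>
      ⟨continuousAt_const, continuousAt_const, continuousAt_const, h⟩) hμ hA
  rw [hform.encard_basePoints, encard_basePoints_nf_three hγ hν]

theorem IsDoubleRoot.encard_eq_two (h : IsDoubleRoot g A 0) (hA : A * A ≠ 0) :
    (basePoints (pen (g * A) g)).encard = 2 := by
  have hform := hasLocalForm_two (T := Unit) (t₀ := ()) (A := fun _ => A)
    (g := fun _ => g) (Filter.Eventually.of_forall fun _ =>
      ⟨continuousAt_const, continuousAt_const, h⟩) hA
  rw [hform.encard_basePoints, encard_basePoints_nf_two]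

theorem IsDoubleRoot.encard_eq_two' (h : IsDoubleRoot g A μ) (hμ : μ ≠ 0)
    (hA : A * (A - μ • 1) = 0) : (basePoints (pen (g * A) g)).encard = 2 := by
  obtain ⟨a, b, c, hb, hc, hform⟩ := exists_localForm_double (T := Unit) (t₀ := ())
    (A := fun _ => A) (g := fun _ => g) (μ := fun _ => μ) (Filter.Eventually.of_forall fun _ =>
      ⟨continuousAt_const, continuousAt_const, continuousAt_const, h⟩) hμ
      (Filter.Eventually.of_forall fun _ => hA)
  rw [hform.encard_basePoints, encard_basePoints_nf_double hb hc]

theorem IsDoubleRoot.encard_eq_one (h : IsDoubleRoot g A 0) (hA : A * A = 0) (hA0 : A ≠ 0) :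
    (basePoints (pen (g * A) g)).encard = 1 := by
  obtain ⟨γ, hγ, hform⟩ := exists_localForm_one (T := Unit) (t₀ := ()) (A := fun _ => A)
    (g := fun _ => g) (Filter.Eventually.of_forall fun _ =>
      ⟨continuousAt_const, continuousAt_const, h⟩) (Filter.Eventually.of_forall fun _ => hA) hA0
  rw [hform.encard_basePoints, encard_basePoints_nf_one hγ]

end

/-! ### Pencils with three distinct degenerate members -/

/-- The real matrix `A` is diagonalized over `ℂ` by `P`, with distinct eigenvalues `d`. -/
structure DiagonalizedBy (A : Matrix (Fin 3) (Fin 3) ℝ) (P : Matrix (Fin 3) (Fin 3) ℂ)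
    (d : Fin 3 → ℂ) : Prop where
  det_ne_zero : P.det ≠ 0
  injective : Function.Injective d
  mul_eq : A.map (algebraMap ℝ ℂ) * P = P * Matrix.diagonal d

theorem exists_depressed_roots (p q : ℂ) :
    ∃ a b c : ℂ, a + b + c = 0 ∧ a * b + b * c + c * a = p ∧ a * b * c = -q := by
  have hcubic : ∃ a : ℂ, a ^ 3 + p * a + q = 0 := by
    have hdeg : (Polynomial.X ^ 3 + Polynomial.C p * Polynomial.X + Polynomial.C q :
        Polynomial ℂ).degree = 3 := by compute_degree!
    obtain ⟨a, ha⟩ := IsAlgClosed.exists_root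
      (Polynomial.X ^ 3 + Polynomial.C p * Polynomial.X + Polynomial.C q : Polynomial ℂ)
      (by rw [hdeg]; norm_num)
    exact ⟨a, by simpa using ha⟩
  obtain ⟨a, ha⟩ := hcubic
  obtain ⟨s, hs⟩ := exists_sq_eq (a ^ 2 - 4 * (a ^ 2 + p))
  refine ⟨a, (-a + s) / 2, (-a - s) / 2, by ring, by linear_combination -hs / 4, ?_⟩
  linear_combination -a * hs / 4 + ha

theorem exists_diagonalizedBy {A : Matrix (Fin 3) (Fin 3) ℝ} {d : Fin 3 → ℂ}
    (hd : Function.Injective d)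
    (hdet : ∀ i, (A.map (algebraMap ℝ ℂ) - d i • 1).det = 0) : ∃ P, DiagonalizedBy A P d := by
  have h : ∀ i, ∃ v : Fin 3 → ℂ, v ≠ 0 ∧ A.map (algebraMap ℝ ℂ) *ᵥ v = d i • v := by
    intro i
    obtain ⟨v, hv, hv'⟩ := Matrix.exists_mulVec_eq_zero_iff.2 (hdet i)
    refine ⟨v, hv, ?_⟩
    simpa [Matrix.sub_mulVec, sub_eq_zero, Matrix.smul_mulVec] using hv'
  choose v hv hAv using h
  have hli : LinearIndependent ℂ v := by
    refine Module.End.eigenvectors_linearIndependent'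
      (Matrix.mulVecLin (A.map (algebraMap ℝ ℂ))) d hd v fun i => ?_
    rw [Module.End.hasEigenvector_iff, Module.End.mem_eigenspace_iff]
    exact ⟨hAv i, hv i⟩
  refine ⟨(Matrix.of v)ᵀ, ?_, hd, ?_⟩
  · have : IsUnit (Matrix.of v)ᵀ := Matrix.linearIndependent_cols_iff_isUnit.1 hli
    exact isUnit_iff_ne_zero.1 ((Matrix.isUnit_iff_isUnit_det _).1 this)
  · ext i j
    have := congrFun (hAv j) i
    rw [Matrix.mul_diagonal]
    simpa [Matrix.mul_apply, Matrix.mulVec, dotProduct, mul_comm] using this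

/-- A matrix commuting with a diagonalizable matrix `A` with distinct eigenvalues vanishes if its
products with `1`, `A`, `A²` have trace zero. -/
theorem DiagonalizedBy.eq_zero_of_trace {A : Matrix (Fin 3) (Fin 3) ℝ}
    {P : Matrix (Fin 3) (Fin 3) ℂ} {d : Fin 3 → ℂ} (h : DiagonalizedBy A P d)
    {S : Matrix (Fin 3) (Fin 3) ℝ} (hS : S * A = A * S) (h0 : S.trace = 0)
    (h1 : (S * A).trace = 0) (h2 : (S * A * A).trace = 0) : S = 0 := by
  have hu : IsUnit P.det := isUnit_iff_ne_zero.2 h.det_ne_zero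
  set A' := A.map (algebraMap ℝ ℂ) with hA'
  set S' := S.map (algebraMap ℝ ℂ) with hS'
  set D := P⁻¹ * S' * P with hD
  have hPAP : P⁻¹ * A' * P = Matrix.diagonal d := by
    rw [Matrix.mul_assoc, h.mul_eq, ← Matrix.mul_assoc, Matrix.nonsing_inv_mul P hu, Matrix.one_mul]
  have conj_mul : ∀ X Y : Matrix (Fin 3) (Fin 3) ℂ,
      (P⁻¹ * X * P) * (P⁻¹ * Y * P) = P⁻¹ * (X * Y) * P := by
    intro X Y
    simp only [Matrix.mul_assoc]
    rw [← Matrix.mul_assoc P P⁻¹, Matrix.mul_nonsing_inv P hu, Matrix.one_mul]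
  have conj_trace : ∀ X : Matrix (Fin 3) (Fin 3) ℂ, (P⁻¹ * X * P).trace = X.trace := by
    intro X
    rw [Matrix.trace_mul_comm, ← Matrix.mul_assoc, Matrix.mul_nonsing_inv P hu, Matrix.one_mul]
  have tr_map : ∀ X : Matrix (Fin 3) (Fin 3) ℝ, X.trace = 0 →
      (X.map (algebraMap ℝ ℂ)).trace = 0 := by
    intro X hX
    have : (X.map (algebraMap ℝ ℂ)).trace = (X.trace : ℂ) := by simp [Matrix.trace]
    rw [this, hX]; simp
  have comm : D * Matrix.diagonal d = Matrix.diagonal d * D := by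
    rw [← hPAP, hD, conj_mul, conj_mul, hS', hA', ← Matrix.map_mul, ← Matrix.map_mul, hS]
  have off : ∀ i j, i ≠ j → D i j = 0 := by
    intro i j hij
    have e := congrFun (congrFun comm i) j
    rw [Matrix.mul_diagonal, Matrix.diagonal_mul] at e
    have : (d i - d j) * D i j = 0 := by linear_combination -e
    rcases mul_eq_zero.1 this with h' | h'
    · exact absurd (h.injective (sub_eq_zero.1 h')) hij
    · exact h'
  have t0 : D.trace = 0 := by rw [hD, conj_trace]; exact tr_map _ h0
  have t1 : (D * Matrix.diagonal d).trace = 0 := by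
    rw [← hPAP, hD, conj_mul, conj_trace, ← Matrix.map_mul]
    exact tr_map _ h1
  have t2 : (D * Matrix.diagonal d * Matrix.diagonal d).trace = 0 := by
    rw [← hPAP, hD, conj_mul, conj_mul, conj_trace, ← Matrix.map_mul, ← Matrix.map_mul]
    exact tr_map _ h2
  simp only [Matrix.trace_fin_three, Matrix.mul_diagonal] at t0 t1 t2
  have ne : ∀ i j, i ≠ j → d i - d j ≠ 0 := fun i j hij => sub_ne_zero.2 (h.injective.ne hij)
  -- The three trace conditions form a Vandermonde system for the diagonal of `D`. Evaluating (X -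
  -- d₁)(X - d₂) at the eigenvalues isolates one entry, and likewise for the others.
  have d0 : D 0 0 = 0 := by
    have : (d 0 - d 1) * (d 0 - d 2) * D 0 0 = 0 := by
      linear_combination t2 - (d 1 + d 2) * t1 + d 1 * d 2 * t0
    simpa [ne 0 1 (by decide), ne 0 2 (by decide)] using this
  have d1 : D 1 1 = 0 := by
    have : (d 1 - d 0) * (d 1 - d 2) * D 1 1 = 0 := by
      linear_combination t2 - (d 0 + d 2) * t1 + d 0 * d 2 * t0
    simpa [ne 1 0 (by decide), ne 1 2 (by decide)] using this
  have d2 : D 2 2 = 0 := by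
    have : (d 2 - d 0) * (d 2 - d 1) * D 2 2 = 0 := by
      linear_combination t2 - (d 0 + d 1) * t1 + d 0 * d 1 * t0
    simpa [ne 2 0 (by decide), ne 2 1 (by decide)] using this
  have hD0 : D = 0 := by
    ext i j
    by_cases hij : i = j
    · subst hij
      fin_cases i
      · exact d0
      · exact d1
      · exact d2
    · exact off i j hij
  have hS0 : S' = 0 := by
    have : P * D * P⁻¹ = S' := by
      rw [hD]
      simp only [Matrix.mul_assoc]
      rw [Matrix.mul_nonsing_inv P hu, Matrix.mul_one, ← Matrix.mul_assoc,
        Matrix.mul_nonsing_inv P hu, Matrix.one_mul]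
    rw [← this, hD0]; simp
  ext i j
  have := congrFun (congrFun hS0 i) j
  simpa [hS'] using this

/-- Eigenvectors of a self-adjoint operator for distinct eigenvalues are orthogonal, so the
eigenbasis diagonalizes both forms over ℂ at once. -/
theorem diag_cval {g A : Matrix (Fin 3) (Fin 3) ℝ} (hg : g.IsSymm) (hA : (g * A).IsSymm)
    (hdet : g.det ≠ 0) {P : Matrix (Fin 3) (Fin 3) ℂ} {d : Fin 3 → ℂ} (h : DiagonalizedBy A P d) :
    ∃ γ : Fin 3 → ℂ, (∀ i, γ i ≠ 0) ∧ ∀ w : Fin 3 → ℂ,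
      cval g (P *ᵥ w) = γ 0 * w 0 ^ 2 + γ 1 * w 1 ^ 2 + γ 2 * w 2 ^ 2 ∧
      cval (g * A) (P *ᵥ w) =
        d 0 * γ 0 * w 0 ^ 2 + d 1 * γ 1 * w 1 ^ 2 + d 2 * γ 2 * w 2 ^ 2 := by
  set g' := g.map (algebraMap ℝ ℂ) with hg'
  set A' := A.map (algebraMap ℝ ℂ) with hA'
  set G := Pᵀ * g' * P with hG
  have hgT : g'ᵀ = g' := by rw [hg', ← Matrix.transpose_map, hg.eq]
  have hGT : Gᵀ = G := by
    simp [hG, Matrix.transpose_mul, hgT, Matrix.mul_assoc]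
  have hGA : Pᵀ * (g' * A') * P = G * Matrix.diagonal d := by
    rw [hG, Matrix.mul_assoc, Matrix.mul_assoc, h.mul_eq]
    simp only [Matrix.mul_assoc]
  have hGAT : (G * Matrix.diagonal d)ᵀ = G * Matrix.diagonal d := by
    rw [← hGA, Matrix.transpose_mul, Matrix.transpose_mul, Matrix.transpose_transpose]
    have : (g' * A')ᵀ = g' * A' := by
      rw [hg', hA', ← Matrix.map_mul, ← Matrix.transpose_map, hA.eq]
    rw [this]
    simp only [Matrix.mul_assoc]
  have off : ∀ i j, i ≠ j → G i j = 0 := by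
    intro i j hij
    have e := congrFun (congrFun hGAT i) j
    have e2 := congrFun (congrFun hGT i) j
    rw [Matrix.transpose_apply, Matrix.mul_diagonal, Matrix.mul_diagonal] at e
    rw [Matrix.transpose_apply] at e2
    have : (d i - d j) * G i j = 0 := by rw [e2] at e; linear_combination e
    rcases mul_eq_zero.1 this with h' | h'
    · exact absurd (h.injective (sub_eq_zero.1 h')) hij
    · exact h'
  have hGd : G.det ≠ 0 := by
    rw [hG, Matrix.det_mul, Matrix.det_mul, Matrix.det_transpose]
    have : g'.det ≠ 0 := by
      have e : g'.det = (g.det : ℂ) := ((algebraMap ℝ ℂ).map_det g).symm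
      rw [e]
      exact_mod_cast hdet
    exact mul_ne_zero (mul_ne_zero h.det_ne_zero this) h.det_ne_zero
  have hval : ∀ (M : Matrix (Fin 3) (Fin 3) ℝ) (w : Fin 3 → ℂ),
      cval M (P *ᵥ w) = w ⬝ᵥ ((Pᵀ * M.map (algebraMap ℝ ℂ) * P) *ᵥ w) := by
    intro M w
    simp only [cval, Matrix.dotProduct_mulVec, ← Matrix.vecMul_vecMul, Matrix.vecMul_transpose]
  have o01 := off 0 1 (by decide)
  have o02 := off 0 2 (by decide)
  have o10 := off 1 0 (by decide)
  have o12 := off 1 2 (by decide)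
  have o20 := off 2 0 (by decide)
  have o21 := off 2 1 (by decide)
  refine ⟨fun i => G i i, ?_, fun w => ⟨?_, ?_⟩⟩
  · rw [Matrix.det_fin_three, o01, o02, o10, o12, o20, o21] at hGd
    intro i hi
    apply hGd
    fin_cases i <;> simp at hi <;> simp [hi]
  · rw [hval, ← hG]
    simp [dotProduct, Matrix.mulVec, Fin.sum_univ_three, o01, o02, o10, o12, o20, o21]
    ring
  · rw [hval, Matrix.map_mul, hGA]
    simp [dotProduct, Matrix.mulVec, Fin.sum_univ_three, Matrix.mul_diagonal, o01, o02, o10,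
      o12, o20, o21]
    ring

/-- In the eigenbasis the two equations are linear in the γᵢwᵢ², and force these to be proportional
to (d₁ - d₂, d₂ - d₀, d₀ - d₁). No entry is zero, so the choices of signs, up to a common one, give
four points. -/
theorem DiagonalizedBy.encard_basePoints {g A : Matrix (Fin 3) (Fin 3) ℝ} (hg : g.IsSymm)
    (hA : (g * A).IsSymm) (hdet : g.det ≠ 0) {P : Matrix (Fin 3) (Fin 3) ℂ} {d : Fin 3 → ℂ}
    (h : DiagonalizedBy A P d) : (basePoints (pen (g * A) g)).encard = 4 := by
  obtain ⟨γ, hγ, hval⟩ := diag_cval hg hA hdet h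
  have hu : IsUnit P.det := isUnit_iff_ne_zero.2 h.det_ne_zero
  have hinj : Function.Injective (Matrix.mulVecLin P) :=
    Matrix.mulVec_injective_iff_isUnit.2 ((Matrix.isUnit_iff_isUnit_det P).2 hu)
  have hPne : ∀ {w : Fin 3 → ℂ}, w ≠ 0 → P *ᵥ w ≠ 0 := fun {w} hw h0 =>
    hw (hinj (by simpa using h0))
  have ne : ∀ i j, i ≠ j → d i - d j ≠ 0 := fun i j hij => sub_ne_zero.2 (h.injective.ne hij)
  obtain ⟨s, hs⟩ := exists_sq_eq ((d 1 - d 2) / γ 0)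
  obtain ⟨r, hr⟩ := exists_sq_eq ((d 2 - d 0) / γ 1)
  obtain ⟨q, hq⟩ := exists_sq_eq ((d 0 - d 1) / γ 2)
  have hs' : γ 0 * s ^ 2 = d 1 - d 2 := by rw [hs]; field_simp [hγ 0]
  have hr' : γ 1 * r ^ 2 = d 2 - d 0 := by rw [hr]; field_simp [hγ 1]
  have hq' : γ 2 * q ^ 2 = d 0 - d 1 := by rw [hq]; field_simp [hγ 2]
  have hs0 : s ≠ 0 := by
    rintro rfl
    exact ne 1 2 (by decide) (by rw [← hs']; ring)
  have hr0 : r ≠ 0 := by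
    rintro rfl
    exact ne 2 0 (by decide) (by rw [← hr']; ring)
  have hq0 : q ≠ 0 := by
    rintro rfl
    exact ne 0 1 (by decide) (by rw [← hq']; ring)
  have n1 : (![s, r, q] : Fin 3 → ℂ) ≠ 0 := vec_ne_zero 0 (by simpa)
  have n2 : (![s, r, -q] : Fin 3 → ℂ) ≠ 0 := vec_ne_zero 0 (by simpa)
  have n3 : (![s, -r, q] : Fin 3 → ℂ) ≠ 0 := vec_ne_zero 0 (by simpa)
  have n4 : (![s, -r, -q] : Fin 3 → ℂ) ≠ 0 := vec_ne_zero 0 (by simpa)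
  set S : Set (ℙ ℂ (Fin 3 → ℂ)) := {Projectivization.mk ℂ _ n1, Projectivization.mk ℂ _ n2,
    Projectivization.mk ℂ _ n3, Projectivization.mk ℂ _ n4} with hS
  have key : ∀ w (hw : w ≠ 0), (cval (g * A) (P *ᵥ w) = 0 ∧ cval g (P *ᵥ w) = 0) ↔
      Projectivization.mk ℂ w hw ∈ S := by
    intro w hw
    rw [(hval w).1, (hval w).2]
    simp only [hS, Set.mem_insert_iff, Set.mem_singleton_iff, mk_eq_mk_iff_cross']
    simp only [Matrix.cons_val_zero, Matrix.cons_val_one, Matrix.cons_val]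
    constructor
    · rintro ⟨e1, e2⟩
      have f1 : (w 0 * r - w 1 * s) * (w 0 * r + w 1 * s) = 0 := by
        apply mul_left_cancel₀ (mul_ne_zero (hγ 0) (hγ 1))
        linear_combination γ 0 * w 0 ^ 2 * hr' - γ 1 * w 1 ^ 2 * hs' + d 2 * e2 - e1
      have f2 : (w 0 * q - w 2 * s) * (w 0 * q + w 2 * s) = 0 := by
        apply mul_left_cancel₀ (mul_ne_zero (hγ 0) (hγ 2))
        linear_combination γ 0 * w 0 ^ 2 * hq' - γ 2 * w 2 ^ 2 * hs' - d 1 * e2 + e1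
      rcases mul_eq_zero.1 f1 with a1 | a1 <;> rcases mul_eq_zero.1 f2 with a2 | a2
      · left
        refine ⟨by linear_combination a1, by linear_combination a2, ?_⟩
        apply mul_left_cancel₀ hs0; linear_combination r * a2 - q * a1
      · right; left
        refine ⟨by linear_combination a1, by linear_combination -a2, ?_⟩
        apply mul_left_cancel₀ hs0; linear_combination q * a1 - r * a2
      · right; right; left
        refine ⟨by linear_combination -a1, by linear_combination a2, ?_⟩
        apply mul_left_cancel₀ hs0; linear_combination q * a1 - r * a2
      · right; right; right
        refine ⟨by linear_combination -a1, by linear_combination -a2, ?_⟩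
        apply mul_left_cancel₀ hs0; linear_combination r * a2 - q * a1
    · have fin : ∀ ε η : ℂ, ε ^ 2 = 1 → η ^ 2 = 1 → w 0 * (ε * r) = w 1 * s →
          w 0 * (η * q) = w 2 * s →
          (d 0 * γ 0 * w 0 ^ 2 + d 1 * γ 1 * w 1 ^ 2 + d 2 * γ 2 * w 2 ^ 2 = 0 ∧
          γ 0 * w 0 ^ 2 + γ 1 * w 1 ^ 2 + γ 2 * w 2 ^ 2 = 0) := by
        intro ε η hε hη a1 a2
        have w1 : w 1 = w 0 * (ε * r) / s := by field_simp; linear_combination -a1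
        have w2 : w 2 = w 0 * (η * q) / s := by field_simp; linear_combination -a2
        have b1 : γ 1 * w 1 ^ 2 * s ^ 2 = w 0 ^ 2 * (d 2 - d 0) := by
          rw [w1]; field_simp; linear_combination w 0 ^ 2 * hr' + γ 1 * w 0 ^ 2 * r ^ 2 * hε
        have b2 : γ 2 * w 2 ^ 2 * s ^ 2 = w 0 ^ 2 * (d 0 - d 1) := by
          rw [w2]; field_simp; linear_combination w 0 ^ 2 * hq' + γ 2 * w 0 ^ 2 * q ^ 2 * hη
        have hss : s ^ 2 ≠ 0 := pow_ne_zero 2 hs0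
        constructor <;> apply mul_left_cancel₀ hss
        · linear_combination d 0 * w 0 ^ 2 * hs' + d 1 * b1 + d 2 * b2
        · linear_combination w 0 ^ 2 * hs' + b1 + b2
      rintro (⟨a1, a2, -⟩ | ⟨a1, a2, -⟩ | ⟨a1, a2, -⟩ | ⟨a1, a2, -⟩)
      · exact fin 1 1 (by ring) (by ring) (by rw [one_mul, a1]) (by rw [one_mul, a2])
      · exact fin 1 (-1) (by ring) (by ring) (by rw [one_mul, a1]) (by rw [neg_one_mul, a2])
      · exact fin (-1) 1 (by ring) (by ring) (by rw [neg_one_mul, a1]) (by rw [one_mul, a2])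
      · exact fin (-1) (-1) (by ring) (by ring) (by rw [neg_one_mul, a1]) (by rw [neg_one_mul, a2])
  have himg : basePoints (pen (g * A) g) = Projectivization.map (Matrix.mulVecLin P) hinj '' S := by
    ext p
    constructor
    · intro hp
      induction p using Projectivization.ind with | h v hv =>
      rw [mk_mem_basePoints, forall_mem_pen_cval] at hp
      have e : P *ᵥ (P⁻¹ *ᵥ v) = v := by
        rw [Matrix.mulVec_mulVec, Matrix.mul_nonsing_inv P hu, Matrix.one_mulVec]
      have hne : P⁻¹ *ᵥ v ≠ 0 := by
        intro h0; rw [h0, Matrix.mulVec_zero] at e; exact hv e.symm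
      refine ⟨Projectivization.mk ℂ _ hne, (key _ hne).1 (by rwa [e]), ?_⟩
      rw [Projectivization.map_mk]
      congr 1
    · rintro ⟨x, hx, rfl⟩
      induction x using Projectivization.ind with | h w hw =>
      rw [Projectivization.map_mk, mk_mem_basePoints, forall_mem_pen_cval]
      exact (key w hw).2 hx
  have htwo : ∀ {x : ℂ}, x ≠ 0 → x ≠ -x := fun {x} hx h0 => hx (by linear_combination h0 / 2)
  rw [himg, (Projectivization.map_injective _ hinj).encard_image, hS, Set.encard_insert_of_notMem,
    (Set.encard_eq_three.2 ⟨_, _, _, ?_, ?_, ?_, rfl⟩)]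
  · norm_num
  all_goals
    simp only [Set.mem_insert_iff, Set.mem_singleton_iff, Ne, mk_eq_mk_iff_cross']
    simp only [Matrix.cons_val_zero, Matrix.cons_val_one, Matrix.cons_val]
  · rintro ⟨a, -⟩
    exact mul_ne_zero hs0 hr0 (by linear_combination -a / 2)
  · rintro ⟨a, -⟩
    exact mul_ne_zero hs0 hr0 (by linear_combination -a / 2)
  · rintro ⟨-, a, -⟩
    exact mul_ne_zero hs0 hq0 (by linear_combination -a / 2)
  · rintro (⟨-, a, -⟩ | ⟨a, -⟩ | ⟨a, -⟩)
    · exact mul_ne_zero hs0 hq0 (by linear_combination -a / 2)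
    · exact mul_ne_zero hs0 hr0 (by linear_combination -a / 2)
    · exact mul_ne_zero hs0 hr0 (by linear_combination -a / 2)

/-! ### Openness of the orbit of a pencil with three distinct degenerate members -/

/-- `3 × 3` arrays, with the sup norm. -/
abbrev Arr : Type := Fin 3 → Fin 3 → ℝ

theorem contDiff_arr_mul {E : Type*} [NormedAddCommGroup E] [NormedSpace ℝ E] {A B : E → Arr}
    (hA : ContDiff ℝ 1 A) (hB : ContDiff ℝ 1 B) :
    ContDiff ℝ 1 (fun x => (show Arr from (Matrix.of (A x) * Matrix.of (B x) :
      Matrix (Fin 3) (Fin 3) ℝ))) := by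
  rw [contDiff_pi]
  intro i
  rw [contDiff_pi]
  intro j
  have h1 : ∀ i j, ContDiff ℝ 1 fun x => A x i j := fun i j =>
    contDiff_pi.1 (contDiff_pi.1 hA i) j
  have h2 : ∀ i j, ContDiff ℝ 1 fun x => B x i j := fun i j =>
    contDiff_pi.1 (contDiff_pi.1 hB i) j
  have : (fun x => (Matrix.of (A x) * Matrix.of (B x) : Matrix (Fin 3) (Fin 3) ℝ) i j) =
      fun x => ∑ k, A x i k * B x k j := by
    ext x; simp [Matrix.mul_apply]
  change ContDiff ℝ 1 (fun x => (Matrix.of (A x) * Matrix.of (B x) : Matrix (Fin 3) (Fin 3) ℝ) i j)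
  rw [this]
  exact ContDiff.sum fun k _ => (h1 i k).mul (h2 k j)

theorem contDiff_arr_transpose {E : Type*} [NormedAddCommGroup E] [NormedSpace ℝ E] {A : E → Arr}
    (hA : ContDiff ℝ 1 A) : ContDiff ℝ 1 (fun x => (show Arr from (Matrix.of (A x))ᵀ)) := by
  rw [contDiff_pi]
  intro i
  rw [contDiff_pi]
  intro j
  exact contDiff_pi.1 (contDiff_pi.1 hA j) i

/-- The map `(b, x, y, Z) ↦ x • bᵀ f b + y • bᵀ g b + (Z - Zᵀ)`. -/
def orbitMap (f g : Matrix (Fin 3) (Fin 3) ℝ) (b Z : Matrix (Fin 3) (Fin 3) ℝ) (x y : ℝ) :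
    Matrix (Fin 3) (Fin 3) ℝ := x • (bᵀ * f * b) + y • (bᵀ * g * b) + (Z - Zᵀ)

theorem contDiff_orbitMap {E : Type*} [NormedAddCommGroup E] [NormedSpace ℝ E]
    (f g : Arr) {b Z : E → Arr} {x y : E → ℝ}
    (hb : ContDiff ℝ 1 b) (hZ : ContDiff ℝ 1 Z) (hx : ContDiff ℝ 1 x) (hy : ContDiff ℝ 1 y) :
    ContDiff ℝ 1 (fun e => (show Arr from orbitMap (Matrix.of f) (Matrix.of g) (Matrix.of (b e))
      (Matrix.of (Z e)) (x e) (y e))) := by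
  have hq : ∀ f : Arr, ContDiff ℝ 1 (fun e => (show Arr from
      ((Matrix.of (b e))ᵀ * Matrix.of f * Matrix.of (b e) : Matrix (Fin 3) (Fin 3) ℝ))) := fun f =>
    contDiff_arr_mul (contDiff_arr_mul (contDiff_arr_transpose hb) contDiff_const) hb
  exact ((hx.smul (hq f)).add (hy.smul (hq g))).add (hZ.sub (contDiff_arr_transpose hZ))

theorem trace_mul_eq_zero {M : Matrix (Fin 3) (Fin 3) ℝ}
    (h : ∀ X : Matrix (Fin 3) (Fin 3) ℝ, (M * X).trace = 0) : M = 0 := by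
  ext i j
  have := h (Matrix.single j i 1)
  simpa [Matrix.trace_mul_single] using this

/-- The term `Z - Zᵀ` of the orbit map fills the skew matrices, so that a submersion onto all
matrices can be obtained. A functional that kills this term is represented by a symmetric matrix. -/
theorem isSymm_of_trace_sub_transpose {H : Matrix (Fin 3) (Fin 3) ℝ}
    (h : ∀ Z : Matrix (Fin 3) (Fin 3) ℝ, (Hᵀ * (Z - Zᵀ)).trace = 0) : H.IsSymm := by
  have : Hᵀ - H = 0 := by
    refine trace_mul_eq_zero fun X => ?_
    have e := h X
    have : (Hᵀ * Xᵀ).trace = (H * X).trace := by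
      rw [← Matrix.transpose_mul, Matrix.trace_transpose, Matrix.trace_mul_comm]
    rw [Matrix.mul_sub, Matrix.trace_sub, this] at e
    rw [Matrix.sub_mul, Matrix.trace_sub, e]
  exact sub_eq_zero.1 this

/-- The tangent directions to the orbit of a pencil with distinct eigenvalues span. -/
theorem DiagonalizedBy.orthogonal_eq_zero {g A : Matrix (Fin 3) (Fin 3) ℝ} (hg : g.IsSymm)
    (hA : (g * A).IsSymm) (hdet : g.det ≠ 0) {P : Matrix (Fin 3) (Fin 3) ℂ} {d : Fin 3 → ℂ}
    (h : DiagonalizedBy A P d) {H K : Matrix (Fin 3) (Fin 3) ℝ} (hH : H.IsSymm) (hK : K.IsSymm)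
    (h1 : (H * g).trace = 0) (h2 : (H * (g * A)).trace = 0) (h3 : (K * (g * A)).trace = 0)
    (hX : ∀ X : Matrix (Fin 3) (Fin 3) ℝ, (H * (Xᵀ * (g * A) + (g * A) * X)).trace +
      (K * (Xᵀ * g + g * X)).trace = 0) : H = 0 ∧ K = 0 := by
  have flip : ∀ {H f : Matrix (Fin 3) (Fin 3) ℝ}, H.IsSymm → f.IsSymm →
      ∀ X : Matrix (Fin 3) (Fin 3) ℝ,
      (H * (Xᵀ * f + f * X)).trace = 2 * (H * f * X).trace := by
    intro H f hH hf X
    have : (H * (Xᵀ * f)).trace = (H * f * X).trace := by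
      rw [← Matrix.trace_transpose, Matrix.transpose_mul, Matrix.transpose_mul,
        Matrix.transpose_transpose, hH.eq, hf.eq, Matrix.trace_mul_comm, Matrix.mul_assoc]
    rw [Matrix.mul_add, Matrix.trace_add, this, ← Matrix.mul_assoc]; ring
  have hsum : H * (g * A) + K * g = 0 := by
    refine trace_mul_eq_zero fun X => ?_
    have := hX X
    rw [flip hH hA, flip hK hg] at this
    rw [Matrix.add_mul, Matrix.trace_add]
    linarith
  have hKg : K * g = -(H * (g * A)) := eq_neg_of_add_eq_zero_right hsum
  have hAg : Aᵀ * g = g * A := by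
    have := hA.eq
    rwa [Matrix.transpose_mul, hg.eq] at this
  have hu : IsUnit g.det := isUnit_iff_ne_zero.2 hdet
  have cancel : ∀ {X Y : Matrix (Fin 3) (Fin 3) ℝ}, g * X = g * Y → X = Y := by
    intro X Y hXY
    have := congrArg (g⁻¹ * ·) hXY
    simpa [← Matrix.mul_assoc, Matrix.nonsing_inv_mul g hu] using this
  have hKA : K = -(A * H) := by
    apply cancel
    have := congrArg Matrix.transpose hKg
    rw [Matrix.transpose_mul, hg.eq, hK.eq, Matrix.transpose_neg, Matrix.transpose_mul, hA.eq,
      hH.eq, Matrix.mul_assoc] at this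
    rw [this, Matrix.mul_neg]
  -- Symmetry of `K` gives K = -AH, while the orbit directions give Kg = -HgA. Comparing them shows
  -- that Hg commutes with A, and the conditions `h1`, `h2`, `h3` are the vanishing of the traces of
  -- Hg, HgA and HgA².
  have hcomm : H * g * A = A * (H * g) := by
    have e := hKg
    rw [hKA, Matrix.neg_mul, neg_inj] at e
    rw [Matrix.mul_assoc, ← e, Matrix.mul_assoc]
  have hHg : H * g = 0 := by
    refine h.eq_zero_of_trace hcomm h1 (by rw [Matrix.mul_assoc]; exact h2) ?_
    have : H * g * A * A = -(K * (g * A)) := by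
      rw [← Matrix.mul_assoc K, hKg]; simp [Matrix.mul_assoc]
    rw [this, Matrix.trace_neg, h3, neg_zero]
  have hH0 : H = 0 := by
    rw [← Matrix.mul_one H, ← Matrix.mul_nonsing_inv g hu, ← Matrix.mul_assoc, hHg,
      Matrix.zero_mul]
  exact ⟨hH0, by rw [hKA, hH0, Matrix.mul_zero, neg_zero]⟩

theorem exists_trace_representation (φ : (Arr × Arr) →ₗ[ℝ] ℝ) :
    ∃ H K : Matrix (Fin 3) (Fin 3) ℝ, ∀ M N : Matrix (Fin 3) (Fin 3) ℝ,
      φ (M, N) = (Hᵀ * M).trace + (Kᵀ * N).trace := by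
  have rep : ∀ ψ : Matrix (Fin 3) (Fin 3) ℝ →ₗ[ℝ] ℝ, ∃ H : Matrix (Fin 3) (Fin 3) ℝ,
      ∀ M, ψ M = (Hᵀ * M).trace := by
    intro ψ
    refine ⟨Matrix.of fun i j => ψ (Matrix.single i j 1), fun M => ?_⟩
    conv_lhs => rw [Matrix.matrix_eq_sum_single M]
    simp only [map_sum, Matrix.trace, Matrix.diag, Matrix.mul_apply, Matrix.transpose_apply,
      Matrix.of_apply]
    rw [Finset.sum_comm]
    refine Finset.sum_congr rfl fun j _ => Finset.sum_congr rfl fun i _ => ?_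
    have : Matrix.single i j (M i j) = M i j • Matrix.single i j (1 : ℝ) := by simp
    rw [this, map_smul, smul_eq_mul, mul_comm]
  obtain ⟨H, hH⟩ := rep (φ ∘ₗ LinearMap.inl ℝ Arr Arr)
  obtain ⟨K, hK⟩ := rep (φ ∘ₗ LinearMap.inr ℝ Arr Arr)
  refine ⟨H, K, fun M N => ?_⟩
  rw [← hH, ← hK]
  change _ = φ (M, 0) + φ (0, N)
  rw [← map_add]
  congr 1
  exact Prod.ext (add_zero _).symm (zero_add _).symm

/-- On each line through the base parameter the orbit map is a cubic polynomial in `s`, so its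
directional derivative is the linear coefficient. -/
theorem hasDerivAt_cubic {E : Type*} [NormedAddCommGroup E] [NormedSpace ℝ E] (c L Q C : E) :
    HasDerivAt (fun s : ℝ => c + s • L + s ^ 2 • Q + s ^ 3 • C) L 0 := by
  have h1 : HasDerivAt (fun s : ℝ => s • L) ((1 : ℝ) • L) 0 := (hasDerivAt_id 0).smul_const L
  have h2 : HasDerivAt (fun s : ℝ => s ^ 2 • Q) (((2 : ℕ) * (0 : ℝ) ^ 1) • Q) 0 :=
    (hasDerivAt_pow 2 0).smul_const Q
  have h3 : HasDerivAt (fun s : ℝ => s ^ 3 • C) (((3 : ℕ) * (0 : ℝ) ^ 2) • C) 0 :=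
    (hasDerivAt_pow 3 0).smul_const C
  have := ((((hasDerivAt_const (0 : ℝ) c).add h1).add h2).add h3)
  simp only [pow_one, mul_zero, zero_smul, one_smul, zero_add, add_zero, ne_eq,
    OfNat.ofNat_ne_zero, not_false_eq_true, zero_pow] at this
  exact this

theorem orbitMap_line (f g X Z : Matrix (Fin 3) (Fin 3) ℝ) (x₀ y₀ x y s : ℝ) :
    orbitMap f g (1 + s • X) (s • Z) (x₀ + s * x) (y₀ + s * y) =
      (x₀ • f + y₀ • g) +
      s • (x • f + y • g + x₀ • (Xᵀ * f + f * X) + y₀ • (Xᵀ * g + g * X) + (Z - Zᵀ)) +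
      s ^ 2 • (x • (Xᵀ * f + f * X) + y • (Xᵀ * g + g * X) + x₀ • (Xᵀ * f * X) +
        y₀ • (Xᵀ * g * X)) +
      s ^ 3 • (x • (Xᵀ * f * X) + y • (Xᵀ * g * X)) := by
  simp only [orbitMap, Matrix.transpose_add, Matrix.transpose_one, Matrix.transpose_smul,
    Matrix.add_mul, Matrix.mul_add, Matrix.one_mul, Matrix.mul_one, Matrix.smul_mul,
    Matrix.mul_smul]
  module

/-- The parameter space of the orbit map of a pair of forms. -/
abbrev OrbitParam : Type := Arr × (ℝ × ℝ × ℝ × ℝ) × Arr × Arr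

/-- The orbit map of a pair of forms. -/
def pairOrbitMap (f g : Matrix (Fin 3) (Fin 3) ℝ) (v : OrbitParam) : Arr × Arr :=
  (orbitMap f g (Matrix.of v.1) (Matrix.of v.2.2.1) v.2.1.1 v.2.1.2.1,
    orbitMap f g (Matrix.of v.1) (Matrix.of v.2.2.2) v.2.1.2.2.1 v.2.1.2.2.2)

theorem contDiff_pairOrbitMap (f g : Matrix (Fin 3) (Fin 3) ℝ) :
    ContDiff ℝ 1 (pairOrbitMap f g) := by
  refine ContDiff.prodMk ?_ ?_
  · exact contDiff_orbitMap f g (b := fun v : OrbitParam => v.1) (Z := fun v => v.2.2.1)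
      (x := fun v => v.2.1.1) (y := fun v => v.2.1.2.1)
      (by fun_prop) (by fun_prop) (by fun_prop) (by fun_prop)
  · exact contDiff_orbitMap f g (b := fun v : OrbitParam => v.1) (Z := fun v => v.2.2.2)
      (x := fun v => v.2.1.2.2.1) (y := fun v => v.2.1.2.2.2)
      (by fun_prop) (by fun_prop) (by fun_prop) (by fun_prop)

/-- The parameter mapped to the pair itself. -/
def orbitBase : OrbitParam := ((1 : Matrix (Fin 3) (Fin 3) ℝ), (1, 0, 0, 1), 0, 0)

theorem pairOrbitMap_base (f g : Matrix (Fin 3) (Fin 3) ℝ) :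
    pairOrbitMap f g orbitBase = (f, g) := by
  have h1 : Matrix.of (orbitBase.1) = (1 : Matrix (Fin 3) (Fin 3) ℝ) := rfl
  have h2 : Matrix.of (orbitBase.2.2.1) = (0 : Matrix (Fin 3) (Fin 3) ℝ) := rfl
  have h3 : Matrix.of (orbitBase.2.2.2) = (0 : Matrix (Fin 3) (Fin 3) ℝ) := rfl
  rw [pairOrbitMap, h1, h2, h3]
  simp [orbitBase, orbitMap]
  rfl

theorem fderiv_pairOrbitMap (f g X Z Z' : Matrix (Fin 3) (Fin 3) ℝ) (x y x' y' : ℝ) :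
    fderiv ℝ (pairOrbitMap f g) orbitBase (X, (x, y, x', y'), Z, Z') =
      (x • f + y • g + (Xᵀ * f + f * X) + (Z - Zᵀ),
        x' • f + y' • g + (Xᵀ * g + g * X) + (Z' - Z'ᵀ)) := by
  set v : OrbitParam := (X, (x, y, x', y'), Z, Z') with hv
  have hd : HasFDerivAt (pairOrbitMap f g) (fderiv ℝ (pairOrbitMap f g) orbitBase) orbitBase :=
    ((contDiff_pairOrbitMap f g).differentiable (by norm_num) _).hasFDerivAt
  have hline : HasDerivAt (fun s : ℝ => orbitBase + s • v) v 0 := by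
    simpa using ((hasDerivAt_id (0 : ℝ)).smul_const v).const_add orbitBase
  have h1 : HasDerivAt (fun s : ℝ => pairOrbitMap f g (orbitBase + s • v))
      (fderiv ℝ (pairOrbitMap f g) orbitBase v) 0 := by
    have := HasFDerivAt.comp_hasDerivAt (x := (0 : ℝ)) (f := fun s : ℝ => orbitBase + s • v)
      (l := pairOrbitMap f g) (l' := fderiv ℝ (pairOrbitMap f g) orbitBase) (f' := v)
      (by simpa using hd) hline
    exact this
  have e : ∀ s : ℝ, pairOrbitMap f g (orbitBase + s • v) =
      (orbitMap f g (1 + s • X) (s • Z) (1 + s * x) (0 + s * y),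
        orbitMap f g (1 + s • X) (s • Z') (0 + s * x') (1 + s * y')) := by
    intro s
    have e1 : Matrix.of (orbitBase + s • v).1 = 1 + s • X := rfl
    have e2 : Matrix.of (orbitBase + s • v).2.2.1 = s • Z := zero_add _
    have e3 : Matrix.of (orbitBase + s • v).2.2.2 = s • Z' := zero_add _
    rw [pairOrbitMap, e1, e2, e3]
    rfl
  have h2 := HasDerivAt.prodMk
    (hasDerivAt_cubic (E := Arr) ((1 : ℝ) • f + (0 : ℝ) • g)
      (x • f + y • g + (1 : ℝ) • (Xᵀ * f + f * X) + (0 : ℝ) • (Xᵀ * g + g * X) + (Z - Zᵀ))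
      (x • (Xᵀ * f + f * X) + y • (Xᵀ * g + g * X) + (1 : ℝ) • (Xᵀ * f * X) +
        (0 : ℝ) • (Xᵀ * g * X)) (x • (Xᵀ * f * X) + y • (Xᵀ * g * X)))
    (hasDerivAt_cubic (E := Arr) ((0 : ℝ) • f + (1 : ℝ) • g)
      (x' • f + y' • g + (0 : ℝ) • (Xᵀ * f + f * X) + (1 : ℝ) • (Xᵀ * g + g * X) + (Z' - Z'ᵀ))
      (x' • (Xᵀ * f + f * X) + y' • (Xᵀ * g + g * X) + (0 : ℝ) • (Xᵀ * f * X) +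
        (1 : ℝ) • (Xᵀ * g * X)) (x' • (Xᵀ * f * X) + y' • (Xᵀ * g * X)))
  have h3 : HasDerivAt (fun s : ℝ => pairOrbitMap f g (orbitBase + s • v))
      ((x • f + y • g + (1 : ℝ) • (Xᵀ * f + f * X) + (0 : ℝ) • (Xᵀ * g + g * X) + (Z - Zᵀ) : Arr),
        (x' • f + y' • g + (0 : ℝ) • (Xᵀ * f + f * X) + (1 : ℝ) • (Xᵀ * g + g * X) +
          (Z' - Z'ᵀ) : Arr)) 0 := by
    convert h2 using 1
    funext s
    rw [e, orbitMap_line, orbitMap_line]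
    rfl
  rw [h1.unique h3, one_smul, one_smul, zero_smul, zero_smul, add_zero, add_zero]
  rfl

/-- Otherwise a nonzero functional, given by a pair of matrices through the trace, kills the image.
Testing it on each kind of parameter direction gives the hypotheses of
`DiagonalizedBy.orthogonal_eq_zero`. -/
theorem DiagonalizedBy.surjective_fderiv {g A : Matrix (Fin 3) (Fin 3) ℝ} (hg : g.IsSymm)
    (hA : (g * A).IsSymm) (hdet : g.det ≠ 0) {P : Matrix (Fin 3) (Fin 3) ℂ} {d : Fin 3 → ℂ}
    (h : DiagonalizedBy A P d) :
    Function.Surjective (fderiv ℝ (pairOrbitMap (g * A) g) orbitBase) := by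
  set L := fderiv ℝ (pairOrbitMap (g * A) g) orbitBase with hL
  by_contra hns
  have hlt : LinearMap.range (L : OrbitParam →ₗ[ℝ] Arr × Arr) < ⊤ := by
    rw [lt_top_iff_ne_top, Ne, LinearMap.range_eq_top]
    exact hns
  obtain ⟨φ, hφ, hker⟩ := Submodule.exists_le_ker_of_lt_top _ hlt
  obtain ⟨H, K, hHK⟩ := exists_trace_representation φ
  have hzero : ∀ (X Z Z' : Matrix (Fin 3) (Fin 3) ℝ) (x y x' y' : ℝ),
      (Hᵀ * (x • (g * A) + y • g + (Xᵀ * (g * A) + (g * A) * X) + (Z - Zᵀ))).trace +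
        (Kᵀ * (x' • (g * A) + y' • g + (Xᵀ * g + g * X) + (Z' - Z'ᵀ))).trace = 0 := by
    intro X Z Z' x y x' y'
    rw [← hHK]
    exact hker ⟨(X, (x, y, x', y'), Z, Z'), fderiv_pairOrbitMap (g * A) g X Z Z' x y x' y'⟩
  have hH : H.IsSymm := isSymm_of_trace_sub_transpose fun Z => by
    simpa using hzero 0 Z 0 0 0 0 0
  have hK : K.IsSymm := isSymm_of_trace_sub_transpose fun Z => by
    simpa using hzero 0 0 Z 0 0 0 0
  rw [hH.eq, hK.eq] at hzero
  obtain ⟨rfl, rfl⟩ := h.orthogonal_eq_zero hg hA hdet hH hK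
    (by simpa using hzero 0 0 0 0 1 0 0) (by simpa using hzero 0 0 0 1 0 0 0)
    (by simpa using hzero 0 0 0 0 0 1 0) (fun X => by simpa using hzero X 0 0 0 0 0 0)
  apply hφ
  refine LinearMap.ext fun x => ?_
  have e : ∀ M N : Matrix (Fin 3) (Fin 3) ℝ, ((0 : Matrix (Fin 3) (Fin 3) ℝ)ᵀ * M).trace +
      ((0 : Matrix (Fin 3) (Fin 3) ℝ)ᵀ * N).trace = 0 := by simp
  exact (hHK x.1 x.2).trans (e _ _)

/-- A linear right inverse of the derivative gives an affine slice through `a` on which the map has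
derivative the identity. The inverse function theorem applies to the slice. -/
theorem exists_continuous_localRightInverse {E F : Type*} [NormedAddCommGroup E] [NormedSpace ℝ E]
    [NormedAddCommGroup F] [NormedSpace ℝ F] [FiniteDimensional ℝ F] {Φ : E → F}
    (hΦ : ContDiff ℝ 1 Φ) (a : E) (hs : Function.Surjective (fderiv ℝ Φ a)) :
    ∃ β : F → E, β (Φ a) = a ∧ ∀ᶠ y in 𝓝 (Φ a), ContinuousAt β y ∧ Φ (β y) = y := by
  have : CompleteSpace F := FiniteDimensional.complete ℝ F
  obtain ⟨σ, hσ⟩ := LinearMap.exists_rightInverse_of_surjective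
    (fderiv ℝ Φ a : E →ₗ[ℝ] F) (LinearMap.range_eq_top.2 hs)
  let σ' : F →L[ℝ] E := LinearMap.toContinuousLinearMap σ
  have hstrict : HasStrictFDerivAt Φ (fderiv ℝ Φ a) a :=
    hΦ.contDiffAt.hasStrictFDerivAt (by norm_num)
  have hline : HasStrictFDerivAt (fun w : F => a + σ' w) σ' 0 :=
    σ'.hasStrictFDerivAt.const_add a
  have hcomp : HasStrictFDerivAt (fun w : F => Φ (a + σ' w))
      ((ContinuousLinearEquiv.refl ℝ F : F ≃L[ℝ] F) : F →L[ℝ] F) 0 := by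
    have h1 : HasStrictFDerivAt Φ (fderiv ℝ Φ a) (a + σ' 0) := by simpa using hstrict
    have h2 := h1.comp (0 : F) hline
    convert h2 using 1
    ext w
    exact (LinearMap.congr_fun hσ w).symm
  have e0 : Φ (a + σ' 0) = Φ a := by simp
  let o := hcomp.toOpenPartialHomeomorph
  refine ⟨fun y => a + σ' (o.symm y), ?_, ?_⟩
  · have h1 : o.symm (Φ (a + σ' 0)) = 0 := hcomp.localInverse_apply_image
    rw [e0] at h1
    change a + σ' (o.symm (Φ a)) = a
    rw [h1, map_zero, add_zero]
  · have hmem : Φ a ∈ o.target := by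
      have := hcomp.image_mem_toOpenPartialHomeomorph_target
      rwa [e0] at this
    filter_upwards [o.open_target.mem_nhds hmem] with y hy
    refine ⟨?_, ?_⟩
    · have : ContinuousAt o.symm y := o.symm.continuousAt hy
      exact continuousAt_const.add (σ'.continuous.continuousAt.comp this)
    · exact o.right_inv hy

/-- Near a pencil with three distinct degenerate members all pencils are congruent to it, by a
congruence depending continuously on the pencil. -/
theorem DiagonalizedBy.exists_local_congruence {g A : Matrix (Fin 3) (Fin 3) ℝ} (hg : g.IsSymm)
    (hA : (g * A).IsSymm) (hdet : g.det ≠ 0) {P : Matrix (Fin 3) (Fin 3) ℂ} {d : Fin 3 → ℂ}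
    (h : DiagonalizedBy A P d) :
    ∃ b : Matrix (Fin 3) (Fin 3) ℝ × Matrix (Fin 3) (Fin 3) ℝ → Matrix (Fin 3) (Fin 3) ℝ,
      b (g * A, g) = 1 ∧ ∀ᶠ y in 𝓝 (g * A, g), ContinuousAt b y ∧
        (y.1.IsSymm → y.2.IsSymm → pen y.1 y.2 ≤ (pen (g * A) g).map (cong (b y))) := by
  obtain ⟨β, hβ0, hβ⟩ := exists_continuous_localRightInverse (contDiff_pairOrbitMap (g * A) g)
    orbitBase (h.surjective_fderiv hg hA hdet)
  rw [pairOrbitMap_base] at hβ0 hβ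
  refine ⟨fun y => (β y).1, congrArg Prod.fst hβ0, ?_⟩
  have key : ∀ (b Z : Matrix (Fin 3) (Fin 3) ℝ) (x y : ℝ) (M : Matrix (Fin 3) (Fin 3) ℝ),
      M.IsSymm → orbitMap (g * A) g b Z x y = M → M ∈ (pen (g * A) g).map (cong b) := by
    intro b Z x y M hM e
    -- For symmetric `M` the term `Z - Zᵀ` is a difference of symmetric matrices, hence both
    -- symmetric and skew. It vanishes, and `M` lies in the transported pencil.
    have hs : (x • (bᵀ * (g * A) * b) + y • (bᵀ * g * b)).IsSymm := by
      have : ∀ f : Matrix (Fin 3) (Fin 3) ℝ, f.IsSymm → (bᵀ * f * b).IsSymm := by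
        intro f hf
        change (bᵀ * f * b)ᵀ = _
        rw [Matrix.transpose_mul, Matrix.transpose_mul, Matrix.transpose_transpose, hf.eq,
          Matrix.mul_assoc]
      exact ((this _ hA).smul x).add ((this _ hg).smul y)
    have hZ : Z - Zᵀ = M - (x • (bᵀ * (g * A) * b) + y • (bᵀ * g * b)) := by
      rw [← e, orbitMap]; abel
    have h2 : (Z - Zᵀ)ᵀ = Z - Zᵀ := by rw [hZ]; exact (hM.sub hs).eq
    have h3 : Z - Zᵀ = 0 := by
      rw [Matrix.transpose_sub, Matrix.transpose_transpose] at h2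
      have : (2 : ℝ) • (Z - Zᵀ) = 0 := by
        rw [two_smul]; nth_rewrite 1 [← h2]; abel
      simpa using this
    rw [map_cong_pen, Submodule.mem_span_pair]
    exact ⟨x, y, by rw [cong_apply, cong_apply, ← e, orbitMap, h3, add_zero]⟩
  filter_upwards [hβ] with y hy
  obtain ⟨h1, h2⟩ := hy
  refine ⟨continuous_fst.continuousAt.comp h1, fun s1 s2 => ?_⟩
  rw [Submodule.span_le]
  rintro _ (rfl | rfl)
  · exact key _ _ _ _ _ s1 (congrArg Prod.fst h2)
  · exact key _ _ _ _ _ s2 (congrArg Prod.snd h2)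

/-! ### Classification of pencils -/

/-- The traceless part of `g⁻¹ f`. -/
def traceless (f g : Matrix (Fin 3) (Fin 3) ℝ) : Matrix (Fin 3) (Fin 3) ℝ :=
  g⁻¹ * f - ((g⁻¹ * f).trace / 3) • 1

theorem trace_traceless (f g : Matrix (Fin 3) (Fin 3) ℝ) : (traceless f g).trace = 0 := by
  simp [traceless, Matrix.trace_sub, Matrix.trace_smul]

theorem mul_traceless {f g : Matrix (Fin 3) (Fin 3) ℝ} (hdet : g.det ≠ 0) :
    g * traceless f g = f - ((g⁻¹ * f).trace / 3) • g := by
  rw [traceless, Matrix.mul_sub, ← Matrix.mul_assoc,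
    Matrix.mul_nonsing_inv g (isUnit_iff_ne_zero.2 hdet), Matrix.one_mul, Matrix.mul_smul,
    Matrix.mul_one]

theorem pen_sub_smul (f g : Matrix (Fin 3) (Fin 3) ℝ) (x : ℝ) : pen (f - x • g) g = pen f g := by
  apply le_antisymm <;> rw [Submodule.span_le] <;> rintro _ (rfl | rfl)
  · exact Submodule.mem_span_pair.2 ⟨1, -x, by module⟩
  · exact Submodule.subset_span (by simp)
  · exact Submodule.mem_span_pair.2 ⟨1, x, by module⟩
  · exact Submodule.subset_span (by simp)

/-- Shifting the operator by a scalar only subtracts a multiple of `g` from `f`. The double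
eigenvalue can thus be moved to zero within the same pencil. -/
theorem pen_mul_traceless_sub {f g : Matrix (Fin 3) (Fin 3) ℝ} (hdet : g.det ≠ 0) (r : ℝ) :
    pen (g * (traceless f g - r • 1)) g = pen f g := by
  have : g * (traceless f g - r • 1) = f - ((g⁻¹ * f).trace / 3 + r) • g := by
    rw [Matrix.mul_sub, mul_traceless hdet, Matrix.mul_smul, Matrix.mul_one]
    module
  rw [this, pen_sub_smul]

theorem pen_mul_traceless {f g : Matrix (Fin 3) (Fin 3) ℝ} (hdet : g.det ≠ 0) :
    pen (g * traceless f g) g = pen f g := by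
  rw [mul_traceless hdet, pen_sub_smul]

theorem isSymm_mul_traceless {f g : Matrix (Fin 3) (Fin 3) ℝ} (hf : f.IsSymm) (hg : g.IsSymm)
    (hdet : g.det ≠ 0) : (g * traceless f g).IsSymm := by
  rw [mul_traceless hdet]
  exact hf.sub (hg.smul _)

/-- The linear coefficient of the characteristic polynomial of a traceless matrix. -/
def charP (B : Matrix (Fin 3) (Fin 3) ℝ) : ℝ := -(B * B).trace / 2

/-- The constant coefficient of the characteristic polynomial. -/
def charQ (B : Matrix (Fin 3) (Fin 3) ℝ) : ℝ := -B.det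

theorem cayley_of_traceless {B : Matrix (Fin 3) (Fin 3) ℝ} (h : B.trace = 0) :
    B * B * B + charP B • B + charQ B • 1 = 0 := by
  rw [Matrix.trace_fin_three] at h
  have h2 : B 2 2 = - B 0 0 - B 1 1 := by linarith
  ext i j
  fin_cases i <;> fin_cases j <;>
    simp [charP, charQ, Matrix.mul_apply, Fin.sum_univ_three, Matrix.trace_fin_three,
      Matrix.det_fin_three, h2] <;> ring

theorem det_sub_smul_of_traceless {B : Matrix (Fin 3) (Fin 3) ℝ} (h : B.trace = 0) (x : ℂ) :
    (B.map (algebraMap ℝ ℂ) - x • 1).det = -(x ^ 3 + charP B * x + charQ B) := by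
  rw [Matrix.trace_fin_three] at h
  have h2 : B 2 2 = - B 0 0 - B 1 1 := by linarith
  simp [charP, charQ, Matrix.mul_apply, Fin.sum_univ_three, Matrix.trace_fin_three,
      Matrix.det_fin_three, h2]
  ring

theorem exists_diagonalizedBy_of_traceless {B : Matrix (Fin 3) (Fin 3) ℝ} (h : B.trace = 0)
    (hD : 4 * charP B ^ 3 + 27 * charQ B ^ 2 ≠ 0) : ∃ P d, DiagonalizedBy B P d := by
  obtain ⟨a, b, c, h1, h2, h3⟩ := exists_depressed_roots (charP B) (charQ B)
  have hD' : (4 * (charP B : ℂ) ^ 3 + 27 * (charQ B : ℂ) ^ 2) ≠ 0 := by exact_mod_cast hD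
  have hc : c = -a - b := by linear_combination h1
  subst hc
  rw [← h2, ← neg_eq_iff_eq_neg.2 h3] at hD'
  have hab : a ≠ b := by
    rintro rfl; apply hD'; ring
  have hac : a ≠ -a - b := by
    intro h; apply hD'
    have : b = -2 * a := by linear_combination h
    rw [this]; ring
  have hbc : b ≠ -a - b := by
    intro h; apply hD'
    have : a = -2 * b := by linear_combination h
    rw [this]; ring
  have root : ∀ x : ℂ, (x - a) * (x - b) * (x - (-a - b)) = 0 →
      (B.map (algebraMap ℝ ℂ) - x • 1).det = 0 := by
    intro x hx
    rw [det_sub_smul_of_traceless h]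
    linear_combination -hx + x * h2 - h3
  have hinj : Function.Injective ![a, b, -a - b] := by
    intro i j hij
    fin_cases i <;> fin_cases j <;> simp at hij ⊢ <;>
      first | exact absurd hij hab | exact absurd hij hac | exact absurd hij hbc |
        exact absurd hij.symm hab | exact absurd hij.symm hac | exact absurd hij.symm hbc
  obtain ⟨P, hP⟩ := exists_diagonalizedBy (A := B) hinj (by
    intro i
    apply root
    fin_cases i <;> simp)
  exact ⟨P, _, hP⟩

/-- The cubic is (X - r)²(X + 2r). The formula for `r` is recorded because it makes the double root
continuous wherever `p` does not vanish. -/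
theorem exists_double_root {p q : ℝ} (h : 4 * p ^ 3 + 27 * q ^ 2 = 0) :
    ∃ r, p = -3 * r ^ 2 ∧ q = 2 * r ^ 3 ∧ (p ≠ 0 → r = -3 * q / (2 * p)) := by
  by_cases hp : p = 0
  · subst hp
    have : q = 0 := by simpa using h
    exact ⟨0, by simp, by simp [this], by simp⟩
  · refine ⟨-3 * q / (2 * p), ?_, ?_, fun _ => rfl⟩
    · field_simp; linear_combination h
    · field_simp; linear_combination q * h

/-- After the shift by `r` the characteristic polynomial is X²(X + 3r), whence the eigenvalue `-3 *
r`. The cubic relation is Cayley–Hamilton. -/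
theorem isDoubleRoot_traceless {f g : Matrix (Fin 3) (Fin 3) ℝ} (hf : f.IsSymm) (hg : g.IsSymm)
    (hdet : g.det ≠ 0) {r : ℝ} (hp : charP (traceless f g) = -3 * r ^ 2)
    (hq : charQ (traceless f g) = 2 * r ^ 3) :
    IsDoubleRoot g (traceless f g - r • 1) (-3 * r) where
  symm := hg
  symm_mul := isSymm_mul_sub_smul_one hg (isSymm_mul_traceless hf hg hdet) r
  det_ne_zero := hdet
  sq_mul := by
    have := cayley_of_traceless (trace_traceless f g)
    rw [hp, hq] at this
    rw [← this]
    simp only [Matrix.mul_sub, Matrix.sub_mul, Matrix.mul_smul, Matrix.smul_mul, Matrix.mul_one,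
      Matrix.one_mul]
    module
  trace_eq := by
    rw [Matrix.trace_sub, trace_traceless, Matrix.trace_smul]
    simp; ring

theorem traceless_ne_zero {f g : Matrix (Fin 3) (Fin 3) ℝ} (hdet : g.det ≠ 0)
    (h : LinearIndependent ℝ ![f, g]) : traceless f g ≠ 0 := by
  intro h0
  have := mul_traceless (f := f) hdet
  rw [h0, Matrix.mul_zero] at this
  have := LinearIndependent.pair_iff.1 h 1 (-((g⁻¹ * f).trace / 3)) (by
    rw [one_smul, neg_smul, ← sub_eq_add_neg, ← this])
  exact one_ne_zero this.1

section

variable {f g : Matrix (Fin 3) (Fin 3) ℝ}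

theorem encard_eq_four (hf : f.IsSymm) (hg : g.IsSymm) (hdet : g.det ≠ 0)
    (hD : 4 * charP (traceless f g) ^ 3 + 27 * charQ (traceless f g) ^ 2 ≠ 0) :
    (basePoints (pen f g)).encard = 4 := by
  obtain ⟨P, d, h⟩ := exists_diagonalizedBy_of_traceless (trace_traceless f g) hD
  rw [← pen_mul_traceless hdet]
  exact h.encard_basePoints hg (isSymm_mul_traceless hf hg hdet) hdet

theorem encard_eq_three_or_two (hf : f.IsSymm) (hg : g.IsSymm) (hdet : g.det ≠ 0) {r : ℝ}
    (hr : r ≠ 0) (hp : charP (traceless f g) = -3 * r ^ 2)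
    (hq : charQ (traceless f g) = 2 * r ^ 3) :
    (basePoints (pen f g)).encard =
      if (traceless f g - r • 1) * (traceless f g - r • 1 - (-3 * r) • 1) = 0 then 2 else 3 := by
  have h := isDoubleRoot_traceless hf hg hdet hp hq
  rw [← pen_mul_traceless_sub hdet r]
  split_ifs with hM
  · exact h.encard_eq_two' (by simpa using hr) hM
  · exact h.encard_eq_three (by simpa using hr) hM

theorem encard_eq_two_or_one (hf : f.IsSymm) (hg : g.IsSymm) (hdet : g.det ≠ 0)
    (hfg : LinearIndependent ℝ ![f, g]) (hp : charP (traceless f g) = 0)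
    (hq : charQ (traceless f g) = 0) :
    (basePoints (pen f g)).encard = if traceless f g * traceless f g = 0 then 1 else 2 := by
  have h := isDoubleRoot_traceless (r := 0) hf hg hdet (by simp [hp]) (by simp [hq])
  rw [zero_smul, sub_zero, mul_zero] at h
  rw [← pen_mul_traceless hdet]
  split_ifs with hM
  · exact h.encard_eq_one hM (traceless_ne_zero hdet hfg)
  · exact h.encard_eq_two hM

theorem basePoints_finite (hf : f.IsSymm) (hg : g.IsSymm) (hdet : g.det ≠ 0)
    (hfg : LinearIndependent ℝ ![f, g]) : (basePoints (pen f g)).Finite := by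
  rw [← Set.encard_ne_top_iff]
  by_cases hD : 4 * charP (traceless f g) ^ 3 + 27 * charQ (traceless f g) ^ 2 = 0
  · obtain ⟨r, hp, hq, -⟩ := exists_double_root hD
    by_cases hr : r = 0
    · subst hr
      rw [encard_eq_two_or_one hf hg hdet hfg (by simpa using hp) (by simpa using hq)]
      split_ifs <;> simp
    · rw [encard_eq_three_or_two hf hg hdet hr hp hq]
      split_ifs <;> simp
  · rw [encard_eq_four hf hg hdet hD]
    simp

end

/-! ### Local lifting of a path of pencils -/

section

variable {T : Type*} [TopologicalSpace T] {t₀ : T}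

theorem continuousAt_matrix_inv {c : T → Matrix (Fin 3) (Fin 3) ℝ} (h : ContinuousAt c t₀)
    (hdet : (c t₀).det ≠ 0) : ContinuousAt (fun t => (c t)⁻¹) t₀ := by
  simp only [Matrix.inv_def, Ring.inverse_eq_inv']
  have h1 : ContinuousAt (fun t => (c t).det) t₀ :=
    (Continuous.matrix_det continuous_id).continuousAt.comp h
  have h2 : ContinuousAt (fun t => (c t).adjugate) t₀ :=
    (Continuous.matrix_adjugate continuous_id).continuousAt.comp h
  exact (h1.inv₀ hdet).smul h2

/-- Near `t₀` the pencils `W t` are congruent to `W t₀`, continuously in `t`. -/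
def LocallyCongruent (t₀ : T) (W : T → Submodule ℝ (Matrix (Fin 3) (Fin 3) ℝ)) : Prop :=
  ∃ b : T → Matrix (Fin 3) (Fin 3) ℝ, ∀ᶠ t in 𝓝 t₀,
    ContinuousAt b t ∧ (b t).det ≠ 0 ∧ (W t₀).map (cong (b t)) = W t

theorem HasLocalForm.locallyCongruent {W : T → Submodule ℝ (Matrix (Fin 3) (Fin 3) ℝ)}
    {N : Submodule ℝ (Matrix (Fin 3) (Fin 3) ℝ)} (h : HasLocalForm t₀ W N) :
    LocallyCongruent t₀ W := by
  obtain ⟨c, hc⟩ := h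
  obtain ⟨-, h1, h2⟩ := hc.self_of_nhds
  refine ⟨fun t => c t₀ * (c t)⁻¹, ?_⟩
  filter_upwards [hc] with t ht
  obtain ⟨h3, h4, h5⟩ := ht
  have hu : IsUnit (c t).det := isUnit_iff_ne_zero.2 h4
  refine ⟨continuousAt_const.mul (continuousAt_matrix_inv h3 h4), ?_, ?_⟩
  · rw [Matrix.det_mul]
    exact mul_ne_zero h1 (Matrix.isUnit_nonsing_inv_det _ hu).ne_zero
  · rw [← map_cong_map_cong, h2, ← h5, map_cong_map_cong, Matrix.mul_nonsing_inv _ hu,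
      map_cong_one]

theorem finrank_pen {f g : Matrix (Fin 3) (Fin 3) ℝ} (h : LinearIndependent ℝ ![f, g]) :
    Module.finrank ℝ (pen f g) = 2 := by
  have := finrank_span_eq_card h
  rwa [Matrix.range_cons_cons_empty, Fintype.card_fin] at this

variable {f g : T → Matrix (Fin 3) (Fin 3) ℝ}

theorem continuous_traceless (hf : Continuous f) (hg : Continuous g) (hdet : ∀ t, (g t).det ≠ 0) :
    Continuous fun t => traceless (f t) (g t) := by
  have hinv : Continuous fun t => (g t)⁻¹ := continuous_iff_continuousAt.2 fun t =>
    continuousAt_matrix_inv hg.continuousAt (hdet t)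
  have h1 : Continuous fun t => (g t)⁻¹ * f t := hinv.mul hf
  exact h1.sub ((h1.matrix_trace.div_const 3).smul continuous_const)

/-- The congruence near the pencil at `t₀` is evaluated along the family. It gives an inclusion of
pencils, which is an equality because both have dimension two. -/
theorem locallyCongruent_of_ne_zero (hf : Continuous f) (hg : Continuous g)
    (hfs : ∀ t, (f t).IsSymm) (hgs : ∀ t, (g t).IsSymm) (hdet : ∀ t, (g t).det ≠ 0)
    (hli : ∀ t, LinearIndependent ℝ ![f t, g t])
    (hD : 4 * charP (traceless (f t₀) (g t₀)) ^ 3 + 27 * charQ (traceless (f t₀) (g t₀)) ^ 2 ≠ 0) :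
    LocallyCongruent t₀ fun t => pen (f t) (g t) := by
  obtain ⟨P, d, h⟩ := exists_diagonalizedBy_of_traceless (trace_traceless (f t₀) (g t₀)) hD
  obtain ⟨b, hb1, hb⟩ := h.exists_local_congruence (hgs t₀)
    (isSymm_mul_traceless (hfs t₀) (hgs t₀) (hdet t₀)) (hdet t₀)
  have hy : Continuous fun t => (g t * traceless (f t) (g t), g t) :=
    (hg.mul (continuous_traceless hf hg hdet)).prodMk hg
  refine ⟨fun t => b (g t * traceless (f t) (g t), g t), ?_⟩
  have hev := (hy.tendsto t₀).eventually hb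
  have hdetb : ∀ᶠ t in 𝓝 t₀, (b (g t * traceless (f t) (g t), g t)).det ≠ 0 := by
    have h1 : ContinuousAt (fun t => (b (g t * traceless (f t) (g t), g t)).det) t₀ :=
      (Continuous.matrix_det continuous_id).continuousAt.comp
        (ContinuousAt.comp (f := fun t => (g t * traceless (f t) (g t), g t)) (x := t₀)
          hb.self_of_nhds.1 hy.continuousAt)
    exact h1.eventually_ne (by rw [hb1]; simp)
  filter_upwards [hev, hdetb] with t ht hdt
  refine ⟨ContinuousAt.comp (f := fun t => (g t * traceless (f t) (g t), g t)) ht.1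
    hy.continuousAt, hdt, ?_⟩
  have hle := ht.2 (isSymm_mul_traceless (hfs t) (hgs t) (hdet t)) (hgs t)
  rw [pen_mul_traceless (hdet t), pen_mul_traceless (hdet t₀)] at hle
  symm
  refine Submodule.eq_of_le_of_finrank_le hle ?_
  rw [finrank_pen (hli t), ← finrank_pen (hli t₀)]
  exact Submodule.finrank_map_le _ _

/-- The constant count forces nearby pencils to have the type of the one at `t₀`. A count other than
four makes the discriminant vanish for all parameters. Among the remaining types only the count two
is ambiguous, and that case is settled by openness. -/
theorem locallyCongruent_of_encard_eq (hf : Continuous f) (hg : Continuous g)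
    (hfs : ∀ t, (f t).IsSymm) (hgs : ∀ t, (g t).IsSymm) (hdet : ∀ t, (g t).det ≠ 0)
    (hli : ∀ t, LinearIndependent ℝ ![f t, g t])
    (hn : ∀ t, (basePoints (pen (f t) (g t))).encard = (basePoints (pen (f t₀) (g t₀))).encard) :
    LocallyCongruent t₀ fun t => pen (f t) (g t) := by
  by_cases hD : 4 * charP (traceless (f t₀) (g t₀)) ^ 3 + 27 * charQ (traceless (f t₀) (g t₀)) ^ 2
      = 0
  swap
  · exact locallyCongruent_of_ne_zero hf hg hfs hgs hdet hli hD
  have hBc := continuous_traceless hf hg hdet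
  obtain ⟨B, hB⟩ : ∃ B : T → Matrix (Fin 3) (Fin 3) ℝ, B = fun t => traceless (f t) (g t) :=
    ⟨_, rfl⟩
  have hBt : ∀ t, traceless (f t) (g t) = B t := fun t => by rw [hB]
  rw [← hB] at hBc
  have hpc : Continuous fun t => charP (B t) :=
    ((hBc.mul hBc).matrix_trace.neg).div_const 2
  have hqc : Continuous fun t => charQ (B t) := hBc.matrix_det.neg
  obtain ⟨r₀, hp₀, hq₀, -⟩ := exists_double_root hD
  have n1 := fun t => encard_eq_four (hfs t) (hgs t) (hdet t)
  have n2 := fun t r => encard_eq_three_or_two (r := r) (hfs t) (hgs t) (hdet t)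
  have n3 := fun t => encard_eq_two_or_one (hfs t) (hgs t) (hdet t) (hli t)
  have hdr := fun t r => isDoubleRoot_traceless (r := r) (hfs t) (hgs t) (hdet t)
  have hpen := fun t => pen_mul_traceless_sub (f := f t) (hdet t)
  have hpen0 := fun t => pen_mul_traceless (f := f t) (hdet t)
  simp only [hBt] at hD hp₀ hq₀ n1 n2 n3 hdr hpen hpen0
  have hle : (basePoints (pen (f t₀) (g t₀))).encard ≠ 4 := by
    by_cases hr : r₀ = 0
    · subst hr
      rw [n3 t₀ (by simpa using hp₀) (by simpa using hq₀)]
      split_ifs <;> decide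
    · rw [n2 t₀ r₀ hr hp₀ hq₀]
      split_ifs <;> decide
  have hDt : ∀ t, 4 * charP (B t) ^ 3 + 27 * charQ (B t) ^ 2 = 0 := by
    intro t
    by_contra h
    exact hle ((hn t).symm.trans (n1 t h))
  by_cases hr : r₀ = 0
  · subst hr
    replace hp₀ : charP (B t₀) = 0 := by simpa using hp₀
    replace hq₀ : charQ (B t₀) = 0 := by simpa using hq₀
    have hn₀ := n3 t₀ hp₀ hq₀
    have hq_of_p : ∀ t, charP (B t) = 0 → charQ (B t) = 0 := by
      intro t h
      have := hDt t
      rw [h] at this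
      simpa using this
    have hdr0 : ∀ t, charP (B t) = 0 → IsDoubleRoot (g t) (B t) 0 := by
      intro t h
      simpa using hdr t 0 (by simpa using h) (by simpa using hq_of_p t h)
    have hW : (fun t => pen (f t) (g t)) = fun t => pen (g t * B t) (g t) := by
      funext t; rw [hpen0]
    by_cases hBB : B t₀ * B t₀ = 0
    · rw [if_pos hBB] at hn₀
      have hall : ∀ t, charP (B t) = 0 ∧ B t * B t = 0 := by
        intro t
        obtain ⟨r, hp, hq, -⟩ := exists_double_root (hDt t)
        have hnt := (hn t).trans hn₀
        by_cases hr : r = 0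
        · subst hr
          have hp' : charP (B t) = 0 := by simpa using hp
          refine ⟨hp', ?_⟩
          rw [n3 t hp' (by simpa using hq)] at hnt
          by_contra h
          rw [if_neg h] at hnt
          exact absurd hnt (by decide)
        · rw [n2 t r hr hp hq] at hnt
          split_ifs at hnt <;> exact absurd hnt (by decide)
      have hne := traceless_ne_zero (hdet t₀) (hli t₀)
      rw [hBt] at hne
      obtain ⟨γ, -, hform⟩ := exists_localForm_one (t₀ := t₀) (A := B) (g := g)
        (Filter.Eventually.of_forall fun t => ⟨hBc.continuousAt, hg.continuousAt,
          hdr0 t (hall t).1⟩) (Filter.Eventually.of_forall fun t => (hall t).2) hne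
      rw [hW]
      exact hform.locallyCongruent
    · rw [if_neg hBB] at hn₀
      -- The formula -3q/(2p) for the double root is unavailable at p = 0, but the root is one of
      -- ±√(-p/3), which are continuous. For both signs A(A - μ) equals B² ≠ 0 at `t₀`, so it stays
      -- nonzero nearby. A nonzero double root would then give three base points instead of two.
      have hs : Continuous fun t => Real.sqrt (-charP (B t) / 3) := (hpc.neg.div_const 3).sqrt
      have hF : ∀ ε : ℝ, ∀ᶠ t in 𝓝 t₀, (B t - (ε * Real.sqrt (-charP (B t) / 3)) • 1) *
          (B t - (ε * Real.sqrt (-charP (B t) / 3)) • 1 -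
            (-3 * (ε * Real.sqrt (-charP (B t) / 3))) • 1) ≠ 0 := by
        intro ε
        have hc : Continuous fun t => (B t - (ε * Real.sqrt (-charP (B t) / 3)) •
            (1 : Matrix (Fin 3) (Fin 3) ℝ)) * (B t - (ε * Real.sqrt (-charP (B t) / 3)) • 1 -
            (-3 * (ε * Real.sqrt (-charP (B t) / 3))) • 1) := by
          fun_prop
        refine hc.continuousAt.eventually_ne ?_
        rw [hp₀]
        simpa using hBB
      have hpz : ∀ᶠ t in 𝓝 t₀, charP (B t) = 0 := by
        filter_upwards [hF 1, hF (-1)] with t h1 h2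
        by_contra hpt
        obtain ⟨r, hp, hq, -⟩ := exists_double_root (hDt t)
        have hr : r ≠ 0 := by
          rintro rfl
          exact hpt (by simpa using hp)
        have hsq : Real.sqrt (-charP (B t) / 3) = |r| := by
          rw [hp, ← Real.sqrt_sq_eq_abs]
          congr 1; ring
        have hnt := (hn t).trans hn₀
        rw [n2 t r hr hp hq] at hnt
        split_ifs at hnt with hM
        · rw [hsq] at h1 h2
          rcases abs_choice r with h | h
          · rw [h, one_mul] at h1
            exact h1 hM
          · rw [h, neg_one_mul, neg_neg] at h2
            exact h2 hM
        · exact absurd hnt (by decide)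
      have hform := hasLocalForm_two (t₀ := t₀) (A := B) (g := g) (by
        filter_upwards [hpz] with t ht
        exact ⟨hBc.continuousAt, hg.continuousAt, hdr0 t ht⟩) hBB
      rw [hW]
      exact hform.locallyCongruent
  · have hp₀ne : charP (B t₀) ≠ 0 := by
      rw [hp₀]
      simpa using hr
    have hpne : ∀ᶠ t in 𝓝 t₀, charP (B t) ≠ 0 := hpc.continuousAt.eventually_ne hp₀ne
    obtain ⟨r, hrdef⟩ : ∃ r : T → ℝ, r = fun t => -3 * charQ (B t) / (2 * charP (B t)) := ⟨_, rfl⟩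
    have hroot : ∀ t, charP (B t) ≠ 0 → r t ≠ 0 ∧ charP (B t) = -3 * r t ^ 2 ∧
        charQ (B t) = 2 * r t ^ 3 := by
      intro t ht
      obtain ⟨r', hp, hq, hr'⟩ := exists_double_root (hDt t)
      have : r t = r' := by rw [hr' ht, hrdef]
      rw [this]
      refine ⟨?_, hp, hq⟩
      rintro rfl
      exact ht (by simpa using hp)
    have hrc : ∀ᶠ t in 𝓝 t₀, ContinuousAt r t := by
      filter_upwards [hpne] with t ht
      rw [hrdef]
      exact ContinuousAt.div (continuousAt_const.mul hqc.continuousAt)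
        (continuousAt_const.mul hpc.continuousAt) (mul_ne_zero two_ne_zero ht)
    have hW : (fun t => pen (f t) (g t)) = fun t => pen (g t * (B t - r t • 1)) (g t) := by
      funext t; rw [hpen]
    have hyp : ∀ᶠ t in 𝓝 t₀, ContinuousAt (fun t => B t - r t • (1 : Matrix (Fin 3) (Fin 3) ℝ)) t ∧
        ContinuousAt g t ∧ ContinuousAt (fun t => -3 * r t) t ∧
        IsDoubleRoot (g t) (B t - r t • 1) (-3 * r t) := by
      filter_upwards [hpne, hrc] with t h1 h2
      exact ⟨hBc.continuousAt.sub (h2.smul continuousAt_const), hg.continuousAt,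
        continuousAt_const.mul h2, hdr t (r t) (hroot t h1).2.1 (hroot t h1).2.2⟩
    have hr₀ := hroot t₀ hp₀ne
    have hn₀ := n2 t₀ (r t₀) hr₀.1 hr₀.2.1 hr₀.2.2
    have hμ : -3 * r t₀ ≠ 0 := by simpa using hr₀.1
    rw [hW]
    by_cases hM : (B t₀ - r t₀ • 1) * (B t₀ - r t₀ • 1 - (-3 * r t₀) • 1) = 0
    · rw [if_pos hM] at hn₀
      obtain ⟨a, b, c, -, -, hform⟩ := exists_localForm_double hyp hμ (by
        filter_upwards [hpne] with t ht
        have h1 := hroot t ht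
        have hnt := (hn t).trans hn₀
        rw [n2 t (r t) h1.1 h1.2.1 h1.2.2] at hnt
        by_contra h
        rw [if_neg h] at hnt
        exact absurd hnt (by decide))
      exact hform.locallyCongruent
    · obtain ⟨γ, ν, -, -, hform⟩ := exists_localForm_three hyp hμ hM
      exact hform.locallyCongruent

end

/-! ### Lifting paths -/

open unitInterval in
/-- A relation over `[0, 1]` with local sections through every point has a section over `[0, 1]`
with given initial value. -/
theorem exists_continuous_section {Y : Type*} [TopologicalSpace Y] (S : I → Y → Prop)
    (hloc : ∀ t₀, ∃ U ∈ 𝓝 t₀, ∀ t₁ ∈ U, ∀ y, S t₁ y →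
      ∃ b : I → Y, ContinuousOn b U ∧ b t₁ = y ∧ ∀ t ∈ U, S t (b t))
    {y₀ : Y} (h₀ : S 0 y₀) : ∃ b : I → Y, Continuous b ∧ b 0 = y₀ ∧ ∀ t, S t (b t) := by
  choose U hU hloc using hloc
  -- A subdivision puts each interval inside one of the sets carrying local sections. The section is
  -- extended interval by interval, its value at `τ m` being prescribed to the next piece.
  obtain ⟨τ, hτ0, hmono, ⟨n, hn⟩, hcov⟩ := exists_monotone_Icc_subset_open_cover_unitInterval
    (c := fun t => interior (U t)) (fun t => isOpen_interior)
    (fun t _ => Set.mem_iUnion.2 ⟨t, mem_interior_iff_mem_nhds.2 (hU t)⟩)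
  have key : ∀ m, ∃ b : I → Y, ContinuousOn b (Set.Icc 0 (τ m)) ∧ b 0 = y₀ ∧
      ∀ t ∈ Set.Icc 0 (τ m), S t (b t) := by
    intro m
    induction m with
    | zero =>
      refine ⟨fun _ => y₀, continuousOn_const, rfl, fun t ht => ?_⟩
      rw [hτ0, Set.Icc_self, Set.mem_singleton_iff] at ht
      rwa [ht]
    | succ m ih =>
      obtain ⟨b, hbc, hb0, hbS⟩ := ih
      obtain ⟨i, hi⟩ := hcov m
      have hle : τ m ≤ τ (m + 1) := hmono m.le_succ
      have h0 : (0 : I) ≤ τ m := unitInterval.nonneg'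
      have hsub : Set.Icc (τ m) (τ (m + 1)) ⊆ U i := hi.trans interior_subset
      obtain ⟨b', hbc', hb0', hbS'⟩ := hloc i (τ m) (hsub ⟨le_rfl, hle⟩) (b (τ m))
        (hbS _ ⟨h0, le_rfl⟩)
      classical
      have e1 : ∀ t ∈ Set.Icc 0 (τ m), (if t ≤ τ m then b t else b' t) = b t := fun t ht =>
        if_pos ht.2
      have e2 : ∀ t ∈ Set.Icc (τ m) (τ (m + 1)), (if t ≤ τ m then b t else b' t) = b' t := by
        intro t ht
        split_ifs with h
        · rw [le_antisymm h ht.1, hb0']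
        · rfl
      refine ⟨fun t => if t ≤ τ m then b t else b' t, ?_, ?_, ?_⟩
      · rw [← Set.Icc_union_Icc_eq_Icc h0 hle]
        exact (hbc.congr e1).union_of_isClosed ((hbc'.mono hsub).congr e2) isClosed_Icc
          isClosed_Icc
      · exact (e1 0 ⟨le_rfl, h0⟩).trans hb0
      · intro t ht
        rw [← Set.Icc_union_Icc_eq_Icc h0 hle] at ht
        rcases ht with ht | ht
        · simp only [e1 t ht]
          exact hbS t ht
        · simp only [e2 t ht]
          exact hbS' t (hsub ht)
  obtain ⟨b, hbc, hb0, hbS⟩ := key n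
  have : Set.Icc 0 (τ n) = Set.univ := by
    rw [hn n le_rfl]
    exact Set.eq_univ_of_forall fun t => ⟨unitInterval.nonneg', unitInterval.le_one'⟩
  rw [this] at hbc hbS
  exact ⟨b, continuousOn_univ.1 hbc, hb0, fun t => hbS t trivial⟩

theorem isEquation_rep (C : Conic) : IsEquation C.rep C := ⟨C.rep_nonzero, C.mk_rep⟩

theorem IsEquation.exists_smul_rep {f : TernaryForm} {C : Conic} (h : IsEquation f C) :
    ∃ a : ℝ, a ≠ 0 ∧ C.rep = a • f := by
  obtain ⟨hf, rfl⟩ := h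
  obtain ⟨a, ha⟩ := Projectivization.exists_smul_eq_mk_rep ℝ f hf
  exact ⟨a, a.ne_zero, ha.symm⟩

theorem IsEquation.smul {f : TernaryForm} {C : Conic} (h : IsEquation f C) {a : ℝ} (ha : a ≠ 0) :
    IsEquation (a • f) C := by
  obtain ⟨hf, rfl⟩ := h
  exact ⟨smul_ne_zero ha hf, (Projectivization.mk_eq_mk_iff' ℝ _ _ _ _).2 ⟨a, rfl⟩⟩

theorem continuous_mk : Continuous fun f : {f : TernaryForm // f ≠ 0} =>
    (Projectivization.mk ℝ f.1 f.2 : Conic) :=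
  continuous_quotient_mk'

theorem isQuotientMap_mk : Topology.IsQuotientMap fun f : {f : TernaryForm // f ≠ 0} =>
    (Projectivization.mk ℝ f.1 f.2 : Conic) :=
  isQuotientMap_quotient_mk'

theorem continuous_of_isEquation {T : Type*} [TopologicalSpace T] {f : T → TernaryForm}
    (hf : Continuous f) {C : T → Conic} (h : ∀ t, IsEquation (f t) (C t)) : Continuous C := by
  have : C = fun t => (Projectivization.mk ℝ (f t) (h t).1 : Conic) := by
    funext t; exact (h t).2.symm
  rw [this]
  exact continuous_mk.comp (hf.subtype_mk fun t => (h t).1)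

/-- Dividing an equation by one of its nonzero entries gives a continuous local section of the map
from nonzero forms to conics. Multiplying by a constant makes it pass through any given equation. -/
theorem exists_continuous_equation (C : unitInterval → Conic) (hC : Continuous C)
    {f₀ : TernaryForm} (h₀ : IsEquation f₀ (C 0)) :
    ∃ f : unitInterval → TernaryForm, Continuous f ∧ f 0 = f₀ ∧ ∀ t, IsEquation (f t) (C t) := by
  refine exists_continuous_section (fun t f => IsEquation f (C t)) (fun t₀ => ?_) h₀
  obtain ⟨i, j, hij⟩ : ∃ i j, (C t₀).rep.1 i j ≠ 0 := by
    by_contra! h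
    exact (C t₀).rep_nonzero (Subtype.ext (Matrix.ext h))
  have hne : ∀ (f : TernaryForm) (D : Conic), IsEquation f D → (f.1 i j = 0 ↔ D.rep.1 i j = 0) := by
    intro f D h
    obtain ⟨a, ha, e⟩ := h.exists_smul_rep
    rw [e]
    simp [ha]
  obtain ⟨F, hFdef⟩ : ∃ F : Conic → TernaryForm, ∀ D, F D = (D.rep.1 i j)⁻¹ • D.rep :=
    ⟨_, fun _ => rfl⟩
  have hF : ∀ (f : TernaryForm) (D : Conic), IsEquation f D → F D = (f.1 i j)⁻¹ • f := by
    intro f D h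
    obtain ⟨a, ha, e⟩ := h.exists_smul_rep
    rw [hFdef, e]
    change (a * f.1 i j)⁻¹ • a • f = _
    rw [smul_smul, mul_inv, mul_comm, ← mul_assoc, mul_inv_cancel₀ ha, one_mul]
  have hentry : Continuous fun f : {f : TernaryForm // f ≠ 0} => f.1.1 i j :=
    (continuous_subtype_val.comp continuous_subtype_val).matrix_elem i j
  have hpre : (fun f : {f : TernaryForm // f ≠ 0} => (Projectivization.mk ℝ f.1 f.2 : Conic)) ⁻¹'
      {D | D.rep.1 i j ≠ 0} = {f | f.1.1 i j ≠ 0} := by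
    ext f
    exact (hne f.1 _ ⟨f.2, rfl⟩).not.symm
  have hV : IsOpen {D : Conic | D.rep.1 i j ≠ 0} := by
    rw [← isQuotientMap_mk.isOpen_preimage, hpre]
    exact isOpen_ne_fun hentry continuous_const
  have hFc : ContinuousOn F {D : Conic | D.rep.1 i j ≠ 0} := by
    refine (isQuotientMap_mk.continuousOn_isOpen_iff hV).2 ?_
    rw [hpre]
    refine ContinuousOn.congr (f := fun f : {f : TernaryForm // f ≠ 0} => (f.1.1 i j)⁻¹ • f.1) ?_ ?_
    · exact (hentry.continuousOn.inv₀ fun f hf => hf).smul continuous_subtype_val.continuousOn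
    · intro f _
      exact hF f.1 _ ⟨f.2, rfl⟩
  have hFC : ContinuousOn (fun t => F (C t)) (C ⁻¹' {D : Conic | D.rep.1 i j ≠ 0}) :=
    hFc.comp hC.continuousOn fun t ht => ht
  refine ⟨C ⁻¹' {D : Conic | D.rep.1 i j ≠ 0}, (hV.preimage hC).mem_nhds hij, fun t₁ ht₁ y hy =>
    ⟨fun t => y.1 i j • F (C t), hFC.fun_const_smul _, ?_, fun t ht => ?_⟩⟩
  · have : y.1 i j ≠ 0 := fun h => ht₁ ((hne y _ hy).1 h)
    simp only [hF y _ hy, smul_smul, mul_inv_cancel₀ this, one_smul]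
  · have : y.1 i j ≠ 0 := fun h => ht₁ ((hne y _ hy).1 h)
    simp only [hFdef]
    exact ((isEquation_rep _).smul (inv_ne_zero ht)).smul this

/-- If `b` is a local family of congruences and `y` is the value already reached at `t₁`, the
continuation is `y * (b t₁)⁻¹ * b t`. -/
theorem exists_continuous_congruence
    {W : unitInterval → Submodule ℝ (Matrix (Fin 3) (Fin 3) ℝ)}
    (h : ∀ t, LocallyCongruent t W) : ∃ a : unitInterval → Matrix (Fin 3) (Fin 3) ℝ,
      Continuous a ∧ a 0 = 1 ∧ ∀ t, (a t).det ≠ 0 ∧ (W 0).map (cong (a t)) = W t := by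
  refine exists_continuous_section (fun t a => a.det ≠ 0 ∧ (W 0).map (cong a) = W t)
    (fun t₀ => ?_) ⟨by simp, map_cong_one _⟩
  obtain ⟨b, hb⟩ := h t₀
  refine ⟨_, hb, fun t₁ ht₁ y hy => ⟨fun t => y * (b t₁)⁻¹ * b t, fun t ht =>
    (continuousAt_const.mul ht.1).continuousWithinAt, ?_, fun t ht => ⟨?_, ?_⟩⟩⟩
  · exact Matrix.nonsing_inv_mul_cancel_right _ _ (isUnit_iff_ne_zero.2 ht₁.2.1)
  · rw [Matrix.det_mul, Matrix.det_mul]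
    exact mul_ne_zero (mul_ne_zero hy.1
      (Matrix.isUnit_nonsing_inv_det _ (isUnit_iff_ne_zero.2 ht₁.2.1)).ne_zero) ht.2.1
  · rw [← map_cong_map_cong, ← map_cong_map_cong, hy.2, ← ht₁.2.2,
      map_cong_map_cong (b t₁) (b t₁)⁻¹,
      Matrix.mul_nonsing_inv _ (isUnit_iff_ne_zero.2 ht₁.2.1), map_cong_one, ht.2.2]

theorem IsEquation.disc_ne_zero_iff {f : TernaryForm} {C : Conic} (h : IsEquation f C) :
    f.disc ≠ 0 ↔ C.IsProper := by
  obtain ⟨a, ha, e⟩ := h.exists_smul_rep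
  rw [Conic.IsProper, e]
  simp [TernaryForm.disc, ha]

theorem couplePen_eq {f g : TernaryForm} {c : Conic × Conic} (hf : IsEquation f c.1)
    (hg : IsEquation g c.2) : couplePen c = pen f.1 g.1 := by
  obtain ⟨a, ha, e⟩ := hf.exists_smul_rep
  obtain ⟨b, hb, e'⟩ := hg.exists_smul_rep
  rw [couplePen, e, e']
  exact pen_smul_smul ha hb _ _

theorem linearIndependent_iff_ne {f g : TernaryForm} {C D : Conic} (hf : IsEquation f C)
    (hg : IsEquation g D) : LinearIndependent ℝ ![f, g] ↔ C ≠ D := by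
  obtain ⟨hf, rfl⟩ := hf
  obtain ⟨hg, rfl⟩ := hg
  rw [LinearIndependent.pair_iff' hf, ne_eq, Projectivization.mk_eq_mk_iff']
  constructor
  · rintro h ⟨a, ha⟩
    have h0 : a ≠ 0 := by
      rintro rfl
      exact hf (by rw [← ha, zero_smul])
    exact h a⁻¹ (by rw [← ha, smul_smul, inv_mul_cancel₀ h0, one_smul])
  · rintro h a ha
    have h0 : a ≠ 0 := by
      rintro rfl
      exact hg (by rw [← ha, zero_smul])
    exact h ⟨a⁻¹, by rw [← ha, smul_smul, inv_mul_cancel₀ h0, one_smul]⟩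

theorem linearIndependent_coe {f g : TernaryForm} :
    LinearIndependent ℝ ![f.1, g.1] ↔ LinearIndependent ℝ ![f, g] := by
  simp only [LinearIndependent.pair_iff]
  refine forall₂_congr fun a b => imp_congr_left ?_
  rw [← Subtype.coe_inj]
  rfl

/-- A rigid isotopy lifts to paths of quadratic forms, and the pencils along it are congruent. -/
theorem IsRigidIsotopy.exists_lift {c d : Conic × Conic} {γ : Path c d} (h : IsRigidIsotopy γ) :
    ∃ f g : unitInterval → TernaryForm, Continuous f ∧ Continuous g ∧
      (∀ t, IsEquation (f t) (γ t).1 ∧ IsEquation (g t) (γ t).2) ∧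
      ∃ a : unitInterval → Matrix (Fin 3) (Fin 3) ℝ, Continuous a ∧ a 0 = 1 ∧
        ∀ t, (a t).det ≠ 0 ∧
          (pen (f 0).1 (g 0).1).map (cong (a t)) = pen (f t).1 (g t).1 := by
  obtain ⟨f, hf, -, hfC⟩ := exists_continuous_equation (fun t => (γ t).1)
    (continuous_fst.comp γ.continuous) (isEquation_rep _)
  obtain ⟨g, hg, -, hgC⟩ := exists_continuous_equation (fun t => (γ t).2)
    (continuous_snd.comp γ.continuous) (isEquation_rep _)
  refine ⟨f, g, hf, hg, fun t => ⟨hfC t, hgC t⟩, ?_⟩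
  have hdet : ∀ t, (g t).1.det ≠ 0 := fun t => (hgC t).disc_ne_zero_iff.2 (h.1 t).2.2
  have hli : ∀ t, LinearIndependent ℝ ![(f t).1, (g t).1] := fun t =>
    linearIndependent_coe.2 ((linearIndependent_iff_ne (hfC t) (hgC t)).2 (h.1 t).1)
  have hpen : ∀ t, couplePen (γ t) = pen (f t).1 (g t).1 := fun t =>
    couplePen_eq (hfC t) (hgC t)
  have hfin : ∀ t, (basePoints (couplePen (γ t))).Finite := fun t => by
    rw [hpen]
    exact basePoints_finite (f t).2 (g t).2 (hdet t) (hli t)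
  refine exists_continuous_congruence (W := fun t => pen (f t).1 (g t).1) fun t₀ => ?_
  refine locallyCongruent_of_encard_eq (continuous_subtype_val.comp hf)
    (continuous_subtype_val.comp hg) (fun t => (f t).2) (fun t => (g t).2) hdet hli fun t => ?_
  rw [← hpen, ← hpen]
  refine encard_basePoints_eq (hfin _) (hfin _) fun m => ?_
  rw [(h.2 t m).1, (h.2 t m).2, (h.2 t₀ m).1, (h.2 t₀ m).2]
  exact ⟨rfl, rfl⟩

/-! ### Slidings in a pencil -/

theorem exists_cubic_root (a b c : ℝ) : ∃ x : ℝ, x ^ 3 + a * x ^ 2 + b * x + c = 0 := by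
  -- This bound makes the cubic term dominate at ±M, so the polynomial changes sign on the interval.
  obtain ⟨M, hM⟩ : ∃ M, M = 1 + |a| + |b| + |c| := ⟨_, rfl⟩
  have ha := abs_nonneg a
  have hb := abs_nonneg b
  have hc := abs_nonneg c
  have hM1 : 1 ≤ M := by linarith
  have h2 : M ≤ M ^ 2 := by nlinarith
  have e3 : M ^ 3 = M ^ 2 + |a| * M ^ 2 + |b| * M ^ 2 + |c| * M ^ 2 := by
    rw [pow_succ, hM]; ring
  have ba : |a * M ^ 2| = |a| * M ^ 2 := by rw [abs_mul, abs_of_nonneg (sq_nonneg M)]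
  have bb : |b * M| ≤ |b| * M ^ 2 := by
    rw [abs_mul, abs_of_nonneg (by linarith : 0 ≤ M)]
    exact mul_le_mul_of_nonneg_left h2 hb
  have bc : |c| ≤ |c| * M ^ 2 := le_mul_of_one_le_right hc (by linarith)
  have A1 := abs_le.1 ba.le
  have A2 := abs_le.1 bb
  have A3 := abs_le.1 bc
  have hcont : Continuous fun x : ℝ => x ^ 3 + a * x ^ 2 + b * x + c := by fun_prop
  obtain ⟨x, -, hx⟩ := intermediate_value_Icc (by linarith : -M ≤ M) hcont.continuousOn
    (show (0 : ℝ) ∈ Set.Icc _ _ from ⟨by nlinarith, by nlinarith⟩)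
  exact ⟨x, hx⟩

/-- The determinant is a cubic in `r` with leading coefficient det `g` ≠ 0. The real degenerate
member found here serves as the point at infinity of the pencil. -/
theorem exists_disc_add_smul_eq_zero (f : TernaryForm) {g : TernaryForm} (hg : g.disc ≠ 0) :
    ∃ r : ℝ, (f + r • g).disc = 0 := by
  obtain ⟨A, hA⟩ : ∃ A : Matrix (Fin 3) (Fin 3) ℝ, A = f.1 := ⟨_, rfl⟩
  obtain ⟨B, hB⟩ : ∃ B : Matrix (Fin 3) (Fin 3) ℝ, B = g.1 := ⟨_, rfl⟩
  have h1 : ∃ a b c : ℝ, ∀ r : ℝ, (A + r • B).det = B.det * r ^ 3 + a * r ^ 2 + b * r + c := by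
    refine ⟨A 0 0 * (B 1 1 * B 2 2 - B 1 2 * B 2 1) - A 0 1 * (B 1 0 * B 2 2 - B 1 2 * B 2 0)
        + A 0 2 * (B 1 0 * B 2 1 - B 1 1 * B 2 0)
        + B 0 0 * (A 1 1 * B 2 2 + B 1 1 * A 2 2 - A 1 2 * B 2 1 - B 1 2 * A 2 1)
        - B 0 1 * (A 1 0 * B 2 2 + B 1 0 * A 2 2 - A 1 2 * B 2 0 - B 1 2 * A 2 0)
        + B 0 2 * (A 1 0 * B 2 1 + B 1 0 * A 2 1 - A 1 1 * B 2 0 - B 1 1 * A 2 0),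
      B 0 0 * (A 1 1 * A 2 2 - A 1 2 * A 2 1) - B 0 1 * (A 1 0 * A 2 2 - A 1 2 * A 2 0)
        + B 0 2 * (A 1 0 * A 2 1 - A 1 1 * A 2 0)
        + A 0 0 * (A 1 1 * B 2 2 + B 1 1 * A 2 2 - A 1 2 * B 2 1 - B 1 2 * A 2 1)
        - A 0 1 * (A 1 0 * B 2 2 + B 1 0 * A 2 2 - A 1 2 * B 2 0 - B 1 2 * A 2 0)
        + A 0 2 * (A 1 0 * B 2 1 + B 1 0 * A 2 1 - A 1 1 * B 2 0 - B 1 1 * A 2 0),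
      A.det, fun r => ?_⟩
    simp only [Matrix.det_fin_three, Matrix.add_apply, Matrix.smul_apply, smul_eq_mul]
    ring
  obtain ⟨a, b, c, h⟩ := h1
  have hd : B.det ≠ 0 := by rwa [hB]
  obtain ⟨r, hr⟩ := exists_cubic_root (a / B.det) (b / B.det) (c / B.det)
  refine ⟨r, ?_⟩
  change (f.1 + r • g.1).det = 0
  rw [← hA, ← hB, h]
  field_simp at hr
  linarith

theorem disc_smul (a : ℝ) (f : TernaryForm) : (a • f).disc = a ^ 3 * f.disc := by
  change (a • f.1).det = _
  rw [Matrix.det_smul, Fintype.card_fin]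
  rfl

/-- In the affine coordinate z ↦ [e + zh], adding multiples of the conic at `y` moves the conic at
`x₀` along the line. The constant (y - x₀)/(y - x₁) is positive because `y` lies outside the
segment. The intermediate points are then convex combinations of `x₀` and `x₁`, so the sliding stays
among non-degenerate members. -/
theorem disc_ne_zero_of_mem_uIcc {e h : TernaryForm} {x₀ x₁ y : ℝ}
    (hx : ∀ z ∈ Set.uIcc x₀ x₁, (e + z • h).disc ≠ 0) (hy : y ∉ Set.uIcc x₀ x₁) :
    ∃ k c : ℝ, c ≠ 0 ∧ (e + x₀ • h) + k • (e + y • h) = c • (e + x₁ • h) ∧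
      ∀ θ ∈ Set.Icc (0 : ℝ) 1, ((e + x₀ • h) + (θ * k) • (e + y • h)).disc ≠ 0 := by
  have hy1 : y - x₁ ≠ 0 := fun h' => hy (by rw [sub_eq_zero.1 h']; exact Set.right_mem_uIcc)
  have hc : 0 < (y - x₀) / (y - x₁) := by
    rw [Set.mem_uIcc, not_or, not_and_or, not_and_or, not_le, not_le, not_le, not_le] at hy
    rcases lt_or_gt_of_ne hy1 with h1 | h1
    · exact div_pos_of_neg_of_neg (by rcases hy.1 with h | h <;> linarith) h1
    · exact div_pos (by rcases hy.2 with h | h <;> linarith) h1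
  obtain ⟨c, hcdef⟩ : ∃ c, c = (y - x₀) / (y - x₁) := ⟨_, rfl⟩
  rw [← hcdef] at hc
  have hcm : c * (y - x₁) = y - x₀ := by rw [hcdef, div_mul_cancel₀ _ hy1]
  have key : (e + x₀ • h) + (c - 1) • (e + y • h) = c • (e + x₁ • h) := by
    have : x₀ = y - c * (y - x₁) := by linarith
    rw [this]; module
  refine ⟨c - 1, c, hc.ne', key, fun θ hθ => ?_⟩
  have hN : 0 < (1 - θ) + θ * c := by
    rcases hθ.1.eq_or_lt with h0 | h0
    · rw [← h0]; simp
    · have := mul_pos h0 hc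
      linarith [hθ.2]
  have e1 : (e + x₀ • h) + (θ * (c - 1)) • (e + y • h) = ((1 - θ) + θ * c) •
      (e + (((1 - θ) / ((1 - θ) + θ * c)) * x₀ + (θ * c / ((1 - θ) + θ * c)) * x₁) • h) := by
    have : (e + x₀ • h) + (θ * (c - 1)) • (e + y • h) =
        (1 - θ) • (e + x₀ • h) + θ • ((e + x₀ • h) + (c - 1) • (e + y • h)) := by module
    have e : ((1 - θ) + θ * c) * (((1 - θ) / ((1 - θ) + θ * c)) * x₀ +
        (θ * c / ((1 - θ) + θ * c)) * x₁) = (1 - θ) * x₀ + θ * c * x₁ := by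
      have := hN.ne'
      field_simp
    rw [this, key, smul_add ((1 - θ) + θ * c), smul_smul ((1 - θ) + θ * c), e]
    module
  rw [e1, disc_smul]
  refine mul_ne_zero (pow_ne_zero _ hN.ne') (hx _ ?_)
  have := (convex_uIcc x₀ x₁) Set.left_mem_uIcc Set.right_mem_uIcc
    (div_nonneg (by linarith [hθ.2]) hN.le : 0 ≤ (1 - θ) / ((1 - θ) + θ * c))
    (div_nonneg (mul_nonneg hθ.1 hc.le) hN.le : 0 ≤ θ * c / ((1 - θ) + θ * c))
    (by rw [← add_div, div_self hN.ne'])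
  simpa using this

/-- A sequence of slidings from `([f], [g])` to `([f'], [g'])` within the pencil of `f` and `g`,
with lifts to quadratic forms. -/
def SlidingConnected (f g f' g' : TernaryForm) : Prop :=
  ∃ (s : C(unitInterval, Conic × Conic)) (U V : unitInterval → TernaryForm),
    IsSlidingSequence s ∧ Continuous U ∧ Continuous V ∧
    (∀ t, IsEquation (U t) (s t).1 ∧ IsEquation (V t) (s t).2 ∧ (U t).disc ≠ 0 ∧
      (V t).disc ≠ 0 ∧ LinearIndependent ℝ ![U t, V t] ∧ U t ∈ Submodule.span ℝ {f, g} ∧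
      V t ∈ Submodule.span ℝ {f, g}) ∧
    U 0 = f ∧ V 0 = g ∧ U 1 = f' ∧ V 1 = g'

theorem IsSliding.swap {a b : ℝ} {σ : ℝ → Conic × Conic} (h : IsSliding a b σ) :
    IsSliding a b fun t => (σ t).swap := by
  obtain ⟨ha, hb, f, g, k, hf, hg, hfg, h⟩ := h
  refine ⟨ha, hb, g, f, k, hg, hf, LinearIndependent.pair_symm_iff.1 hfg, ?_⟩
  rcases h with h | h
  · exact Or.inr fun t ht => ⟨(h t ht).1, (h t ht).2.2, (h t ht).2.1⟩
  · exact Or.inl fun t ht => ⟨(h t ht).1, (h t ht).2.2, (h t ht).2.1⟩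

theorem SlidingConnected.swap {f g f' g' : TernaryForm} (h : SlidingConnected f g f' g') :
    SlidingConnected g f g' f' := by
  obtain ⟨s, U, V, ⟨n, τ, hτ0, hτn, hτ⟩, hU, hV, hUV, h1, h2, h3, h4⟩ := h
  refine ⟨⟨fun t => (s t).swap, continuous_swap.comp s.continuous⟩, V, U,
    ⟨n, τ, hτ0, hτn, fun i hi => ⟨(hτ i hi).1, ?_⟩⟩, hV, hU, fun t => ?_, h2, h1, h4, h3⟩
  · obtain ⟨c, hc⟩ := (hτ i hi).2
    exact ⟨c, hc.swap⟩
  · obtain ⟨a1, a2, a3, a4, a5, a6, a7⟩ := hUV t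
    rw [Set.pair_comm]
    exact ⟨a2, a1, a4, a3, LinearIndependent.pair_symm_iff.1 a5, a7, a6⟩

/-- The first conic slides while the second rests, then the roles are exchanged. The equations are
kept explicit so that endpoints and membership in the pencil can be followed. -/
theorem slidingConnected_add {f g : TernaryForm} {k l : ℝ} (hfg : LinearIndependent ℝ ![f, g])
    (hg : g.disc ≠ 0) (h1 : ∀ θ ∈ Set.Icc (0 : ℝ) 1, (f + (θ * k) • g).disc ≠ 0)
    (h2 : ∀ θ ∈ Set.Icc (0 : ℝ) 1, (g + (θ * l) • (f + k • g)).disc ≠ 0) :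
    SlidingConnected f g (f + k • g) (g + l • (f + k • g)) := by
  have hf : f.disc ≠ 0 := by simpa using h1 0 (by simp)
  have hf' : (f + k • g).disc ≠ 0 := by simpa using h1 1 (by simp)
  have hfg' : LinearIndependent ℝ ![f + k • g, g] := (LinearIndependent.pair_add_smul_left_iff _).2 hfg
  -- The clocks of the two slidings: `x` runs from 0 to 1 on the first half of the time and then
  -- stops, `y` waits and runs on the second half.
  obtain ⟨x, hx⟩ : ∃ x : unitInterval → ℝ, ∀ t, x t = min (2 * t.1) 1 := ⟨_, fun _ => rfl⟩
  obtain ⟨y, hy⟩ : ∃ y : unitInterval → ℝ, ∀ t, y t = max (2 * t.1 - 1) 0 := ⟨_, fun _ => rfl⟩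
  have hxc : Continuous x := by
    rw [funext hx]; fun_prop
  have hyc : Continuous y := by
    rw [funext hy]; fun_prop
  have hx01 : ∀ t, x t ∈ Set.Icc (0 : ℝ) 1 := fun t => by
    rw [hx]
    exact ⟨le_min (by linarith [t.2.1]) zero_le_one, min_le_right _ _⟩
  have hy01 : ∀ t, y t ∈ Set.Icc (0 : ℝ) 1 := fun t => by
    rw [hy]
    exact ⟨le_max_right _ _, max_le (by linarith [t.2.2]) zero_le_one⟩
  have hcase : ∀ t : unitInterval, (t.1 ≤ 1 / 2 ∧ x t = 2 * t.1 ∧ y t = 0) ∨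
      (1 / 2 ≤ t.1 ∧ x t = 1 ∧ y t = 2 * t.1 - 1) := by
    intro t
    rw [hx, hy]
    rcases le_total t.1 (1 / 2) with h | h
    · exact Or.inl ⟨h, min_eq_left (by linarith), max_eq_right (by linarith)⟩
    · exact Or.inr ⟨h, min_eq_right (by linarith), max_eq_left (by linarith)⟩
  obtain ⟨U, hU⟩ : ∃ U : unitInterval → TernaryForm, ∀ t, U t = f + (x t * k) • g :=
    ⟨_, fun _ => rfl⟩
  obtain ⟨V, hV⟩ : ∃ V : unitInterval → TernaryForm, ∀ t, V t = g + (y t * l) • (f + k • g) :=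
    ⟨_, fun _ => rfl⟩
  have hUc : Continuous U := by
    rw [funext hU]
    exact continuous_const.add ((hxc.mul continuous_const).smul continuous_const)
  have hVc : Continuous V := by
    rw [funext hV]
    exact continuous_const.add ((hyc.mul continuous_const).smul continuous_const)
  have hUd : ∀ t, (U t).disc ≠ 0 := fun t => by rw [hU]; exact h1 _ (hx01 t)
  have hVd : ∀ t, (V t).disc ≠ 0 := fun t => by rw [hV]; exact h2 _ (hy01 t)
  have hne : ∀ u : TernaryForm, u.disc ≠ 0 → u ≠ 0 := by
    rintro u h rfl
    exact h (by simp [TernaryForm.disc])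
  have hUe : ∀ t, IsEquation (U t) (Projectivization.mk ℝ (U t) (hne _ (hUd t))) :=
    fun t => ⟨_, rfl⟩
  have hVe : ∀ t, IsEquation (V t) (Projectivization.mk ℝ (V t) (hne _ (hVd t))) :=
    fun t => ⟨_, rfl⟩
  have hfW : f ∈ Submodule.span ℝ {f, g} := Submodule.subset_span (by simp)
  have hgW : g ∈ Submodule.span ℝ {f, g} := Submodule.subset_span (by simp)
  refine ⟨⟨fun t => (Projectivization.mk ℝ (U t) (hne _ (hUd t)),
      Projectivization.mk ℝ (V t) (hne _ (hVd t))),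
      (continuous_of_isEquation hUc hUe).prodMk (continuous_of_isEquation hVc hVe)⟩,
    U, V, ⟨2, fun i => i / 2, by simp, by simp, fun i hi => ⟨by simp; linarith, ?_⟩⟩, hUc, hVc,
    fun t => ⟨hUe t, hVe t, hUd t, hVd t, ?_, ?_, ?_⟩, ?_, ?_, ?_, ?_⟩
  · have hext : ∀ t (ht : t ∈ Set.Icc (0 : ℝ) 1), Set.IccExtend (zero_le_one : (0 : ℝ) ≤ 1)
        (fun t => ((Projectivization.mk ℝ (U t) (hne _ (hUd t)) : Conic),
          (Projectivization.mk ℝ (V t) (hne _ (hVd t)) : Conic))) t =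
          (Projectivization.mk ℝ (U ⟨t, ht⟩) (hne _ (hUd ⟨t, ht⟩)),
          Projectivization.mk ℝ (V ⟨t, ht⟩) (hne _ (hVd ⟨t, ht⟩))) := fun t ht =>
      Set.IccExtend_of_mem _ _ ht
    have : i = 0 ∨ i = 1 := by omega
    rcases this with rfl | rfl
    -- Each sliding takes time 1/2, hence the doubled coefficient. The second one below is
    -- translated by 1/2 so that its time interval contains 0.
    · refine ⟨0, by simp, by norm_num, f, g, 2 * k, hf, hg, hfg, Or.inl fun t ht => ?_⟩
      norm_num at ht
      have ht' : t ∈ Set.Icc (0 : ℝ) 1 := ⟨ht.1, by linarith [ht.2]⟩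
      have hUt : U ⟨t, ht'⟩ = f + (t * (2 * k)) • g := by
        rw [hU]
        rcases hcase ⟨t, ht'⟩ with h | h
        · rw [h.2.1]; congr 2; ring
        · have : t = 1 / 2 := le_antisymm (by linarith [ht.2]) h.1
          rw [h.2.1, this]; congr 2; ring
      have hVt : V ⟨t, ht'⟩ = g := by
        rw [hV]
        rcases hcase ⟨t, ht'⟩ with h | h
        · rw [h.2.2]; simp
        · have : t = 1 / 2 := le_antisymm (by linarith [ht.2]) h.1
          rw [h.2.2]; simp [this]
      rw [← hUt]
      refine ⟨hUd _, ?_⟩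
      have e := hext t ht'
      simp only [add_zero, ContinuousMap.coe_mk]
      rw [e]
      exact ⟨hUe _, hVt ▸ hVe _⟩
    · refine ⟨1 / 2, by norm_num, by norm_num, f + k • g, g, 2 * l, hf', hg, hfg',
        Or.inr fun t ht => ?_⟩
      norm_num at ht
      have ht' : t + 1 / 2 ∈ Set.Icc (0 : ℝ) 1 := ⟨by linarith [ht.1], by linarith [ht.2]⟩
      have hUt : U ⟨t + 1 / 2, ht'⟩ = f + k • g := by
        rw [hU]
        rcases hcase ⟨t + 1 / 2, ht'⟩ with h | h
        · have : t = 0 := le_antisymm (by linarith [h.1]) ht.1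
          rw [h.2.1]; simp [this]
        · rw [h.2.1, one_mul]
      have hVt : V ⟨t + 1 / 2, ht'⟩ = g + (t * (2 * l)) • (f + k • g) := by
        rw [hV]
        rcases hcase ⟨t + 1 / 2, ht'⟩ with h | h
        · have : t = 0 := le_antisymm (by linarith [h.1]) ht.1
          rw [h.2.2, this]; simp
        · rw [h.2.2]; congr 2; ring
      rw [← hVt]
      refine ⟨hVd _, ?_⟩
      have e := hext (t + 1 / 2) ht'
      simp only [ContinuousMap.coe_mk]
      rw [e]
      exact ⟨hUt ▸ hUe _, hVe _⟩
  · rcases hcase t with h | h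
    · rw [hU, hV, h.2.2, zero_mul, zero_smul, add_zero]
      exact (LinearIndependent.pair_add_smul_left_iff _).2 hfg
    · rw [hU, hV, h.2.1, one_mul]
      rw [add_comm g]
      exact (LinearIndependent.pair_add_smul_right_iff _).2 hfg'
  · rw [hU]
    exact add_mem hfW (Submodule.smul_mem _ _ hgW)
  · rw [hV]
    exact add_mem hgW (Submodule.smul_mem _ _ (add_mem hfW (Submodule.smul_mem _ _ hgW)))
  · rw [hU, hx]; simp
  · rw [hV, hy]; simp
  · rw [hU, hx]; norm_num
  · rw [hV, hy]; norm_num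

/-- The coordinates are extended to linear functions on all forms, which makes their continuity
automatic. -/
theorem exists_coordinates {e h : TernaryForm} (hl : LinearIndependent ℝ ![e, h]) :
    ∃ φ ψ : TernaryForm →ₗ[ℝ] ℝ, ∀ w ∈ Submodule.span ℝ {e, h}, w = φ w • e + ψ w • h := by
  obtain ⟨L, hL⟩ := LinearMap.exists_leftInverse_of_injective
    (Fintype.linearCombination ℝ ![e, h])
    (LinearMap.ker_eq_bot.2 (linearIndependent_iff_injective_fintypeLinearCombination.1 hl))
  refine ⟨LinearMap.proj 0 ∘ₗ L, LinearMap.proj 1 ∘ₗ L, fun w hw => ?_⟩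
  obtain ⟨a, b, rfl⟩ := Submodule.mem_span_pair.1 hw
  have h1 : L (a • e + b • h) = ![a, b] := by
    have := LinearMap.congr_fun hL ![a, b]
    simpa [Fintype.linearCombination_apply, Fin.sum_univ_two] using this
  simp [h1]

/-- Two points moving on the line without meeting can first move one and then the other. -/
theorem notMem_uIcc_or {x₀ x₁ y₀ y₁ : ℝ} (h : (x₀ < y₀ ∧ x₁ < y₁) ∨ (y₀ < x₀ ∧ y₁ < x₁)) :
    (y₀ ∉ Set.uIcc x₀ x₁ ∧ x₁ ∉ Set.uIcc y₀ y₁) ∨ (x₀ ∉ Set.uIcc y₀ y₁ ∧ y₁ ∉ Set.uIcc x₀ x₁) := by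
  simp only [Set.mem_uIcc, not_or, not_and_or, not_le]
  rcases h with ⟨h0, h1⟩ | ⟨h0, h1⟩
  · rcases lt_or_ge x₁ y₀ with h | h
    · exact Or.inl ⟨⟨Or.inr h, Or.inr h0⟩, ⟨Or.inl h, Or.inl h1⟩⟩
    · exact Or.inr ⟨⟨Or.inl h0, Or.inl (by linarith)⟩, ⟨Or.inr h1, Or.inr (by linarith)⟩⟩
  · rcases lt_or_ge y₀ x₁ with h | h
    · exact Or.inl ⟨⟨Or.inl h0, Or.inl h⟩, ⟨Or.inr h1, Or.inr h⟩⟩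
    · exact Or.inr ⟨⟨Or.inr (by linarith), Or.inr h0⟩, ⟨Or.inl (by linarith), Or.inl h1⟩⟩

theorem slidingConnected_of_notMem {e h : TernaryForm} {x₀ x₁ y₀ y₁ : ℝ}
    (hl : LinearIndependent ℝ ![e + x₀ • h, e + y₀ • h])
    (hx : ∀ z ∈ Set.uIcc x₀ x₁, (e + z • h).disc ≠ 0)
    (hy : ∀ z ∈ Set.uIcc y₀ y₁, (e + z • h).disc ≠ 0)
    (h₀ : y₀ ∉ Set.uIcc x₀ x₁) (h₁ : x₁ ∉ Set.uIcc y₀ y₁) :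
    ∃ a b : ℝ, a ≠ 0 ∧ b ≠ 0 ∧ SlidingConnected (e + x₀ • h) (e + y₀ • h)
      (a • (e + x₁ • h)) (b • (e + y₁ • h)) := by
  obtain ⟨k, c, hc, hk, hkd⟩ := disc_ne_zero_of_mem_uIcc hx h₀
  obtain ⟨l, d, hd, hlk, hld⟩ := disc_ne_zero_of_mem_uIcc hy h₁
  refine ⟨c, d, hc, hd, ?_⟩
  -- The first conic ends at the multiple by `c` of its target equation, so the coefficient of the
  -- second sliding is divided by `c`.
  have hl' : (l / c) • ((e + x₀ • h) + k • (e + y₀ • h)) = l • (e + x₁ • h) := by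
    rw [hk, smul_smul, div_mul_cancel₀ _ hc]
  have := slidingConnected_add (k := k) (l := l / c) hl (hy _ Set.left_mem_uIcc) hkd
    (fun θ hθ => by rw [mul_smul, hl', smul_smul]; exact hld θ hθ)
  rwa [hl', hk, hlk] at this

/-- With a degenerate member `h` put at infinity, the two paths become real functions x and y with x
≠ y throughout. By the intermediate value theorem the segments between their endpoints avoid
degenerate members, and the order of x and y is preserved. Hence one of the two points can move
first without meeting the other. -/
theorem exists_slidingConnected {u v : unitInterval → TernaryForm} (hu : Continuous u)
    (hv : Continuous v) (hud : ∀ t, (u t).disc ≠ 0) (hvd : ∀ t, (v t).disc ≠ 0)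
    (hli : ∀ t, LinearIndependent ℝ ![u t, v t]) (huW : ∀ t, u t ∈ Submodule.span ℝ {u 0, v 0})
    (hvW : ∀ t, v t ∈ Submodule.span ℝ {u 0, v 0}) :
    ∃ a b c d : ℝ, a ≠ 0 ∧ b ≠ 0 ∧ c ≠ 0 ∧ d ≠ 0 ∧
      SlidingConnected (a • u 0) (b • v 0) (c • u 1) (d • v 1) := by
  obtain ⟨r, hr⟩ := exists_disc_add_smul_eq_zero (u 0) (hvd 0)
  obtain ⟨e, he⟩ : ∃ e, e = v 0 := ⟨_, rfl⟩
  obtain ⟨h, hh⟩ : ∃ h, h = u 0 + r • v 0 := ⟨_, rfl⟩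
  have hspan : Submodule.span ℝ {u 0, v 0} ≤ Submodule.span ℝ {e, h} := by
    rw [Submodule.span_le]
    rintro _ (rfl | rfl)
    · exact Submodule.mem_span_pair.2 ⟨-r, 1, by rw [he, hh]; module⟩
    · exact Submodule.subset_span (by simp [he])
  have hlin : LinearIndependent ℝ ![e, h] := by
    rw [he, hh]
    exact LinearIndependent.pair_symm_iff.1
      ((LinearIndependent.pair_add_smul_left_iff _).2 (hli 0))
  obtain ⟨φ, ψ, hφψ⟩ := exists_coordinates hlin
  have hne : ∀ w ∈ Submodule.span ℝ {e, h}, w.disc ≠ 0 →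
      φ w ≠ 0 ∧ (φ w)⁻¹ • w = e + (ψ w / φ w) • h := by
    intro w hw hd
    have h1 : φ w ≠ 0 := by
      intro h0
      apply hd
      rw [hφψ w hw, h0, zero_smul, zero_add, disc_smul, hh, hr, mul_zero]
    refine ⟨h1, ?_⟩
    nth_rw 2 [hφψ w hw]
    rw [smul_add, smul_smul, smul_smul, inv_mul_cancel₀ h1, one_smul, inv_mul_eq_div]
  have hφc : Continuous φ := LinearMap.continuous_of_finiteDimensional φ
  have hψc : Continuous ψ := LinearMap.continuous_of_finiteDimensional ψ
  have H : ∀ w : unitInterval → TernaryForm, Continuous w → (∀ t, (w t).disc ≠ 0) →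
      (∀ t, w t ∈ Submodule.span ℝ {u 0, v 0}) →
      ∃ x : unitInterval → ℝ, Continuous x ∧ ∀ t, φ (w t) ≠ 0 ∧
        (φ (w t))⁻¹ • w t = e + x t • h := by
    intro w hw hd hW
    have := fun t => hne (w t) (hspan (hW t)) (hd t)
    exact ⟨fun t => ψ (w t) / φ (w t), (hψc.comp hw).div (hφc.comp hw) fun t => (this t).1, this⟩
  obtain ⟨x, hxc, hx⟩ := H u hu hud huW
  obtain ⟨y, hyc, hy⟩ := H v hv hvd hvW
  have hxd : ∀ t, (e + x t • h).disc ≠ 0 := fun t => by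
    rw [← (hx t).2, disc_smul]
    exact mul_ne_zero (pow_ne_zero _ (inv_ne_zero (hx t).1)) (hud t)
  have hyd : ∀ t, (e + y t • h).disc ≠ 0 := fun t => by
    rw [← (hy t).2, disc_smul]
    exact mul_ne_zero (pow_ne_zero _ (inv_ne_zero (hy t).1)) (hvd t)
  have hxy : ∀ t, x t - y t ≠ 0 := by
    intro t h0
    have e1 : (φ (u t))⁻¹ • u t = (φ (v t))⁻¹ • v t := by
      rw [(hx t).2, (hy t).2, sub_eq_zero.1 h0]
    have := LinearIndependent.pair_iff.1 (hli t) (φ (u t))⁻¹ (-(φ (v t))⁻¹) (by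
      rw [e1, neg_smul, add_neg_cancel])
    exact inv_ne_zero (hx t).1 this.1
  have hIVT : ∀ z : unitInterval → ℝ, Continuous z → ∀ c ∈ Set.uIcc (z 0) (z 1), ∃ t, z t = c := by
    intro z hz c hc
    have := (isPreconnected_univ.image z hz.continuousOn).ordConnected.uIcc_subset
      ⟨0, trivial, rfl⟩ ⟨1, trivial, rfl⟩ hc
    obtain ⟨t, -, ht⟩ := this
    exact ⟨t, ht⟩
  have hxI : ∀ z ∈ Set.uIcc (x 0) (x 1), (e + z • h).disc ≠ 0 := by
    intro z hz
    obtain ⟨t, rfl⟩ := hIVT x hxc z hz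
    exact hxd t
  have hyI : ∀ z ∈ Set.uIcc (y 0) (y 1), (e + z • h).disc ≠ 0 := by
    intro z hz
    obtain ⟨t, rfl⟩ := hIVT y hyc z hz
    exact hyd t
  have hord : (x 0 < y 0 ∧ x 1 < y 1) ∨ (y 0 < x 0 ∧ y 1 < x 1) := by
    by_contra hcon
    have h0 := hxy 0
    have h1 := hxy 1
    have : (0 : ℝ) ∈ Set.uIcc (x 0 - y 0) (x 1 - y 1) := by
      rw [Set.mem_uIcc]
      by_contra h2
      apply hcon
      rw [not_or, not_and_or, not_and_or, not_le, not_le, not_le, not_le] at h2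
      rcases lt_or_gt_of_ne h0 with h | h <;> rcases lt_or_gt_of_ne h1 with h' | h'
      · left; constructor <;> linarith
      · rcases h2.1 with h3 | h3 <;> linarith
      · rcases h2.2 with h3 | h3 <;> linarith
      · right; constructor <;> linarith
    obtain ⟨t, ht⟩ := hIVT (fun t => x t - y t) (hxc.sub hyc) 0 this
    exact hxy t ht
  have hl : LinearIndependent ℝ ![e + x 0 • h, e + y 0 • h] := by
    rw [LinearIndependent.pair_iff] at hlin ⊢
    intro s t hst
    obtain ⟨h1, h2⟩ := hlin (s + t) (s * x 0 + t * y 0) (by rw [← hst]; module)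
    have h3 : s * (x 0 - y 0) = 0 := by
      linear_combination h2 - y 0 * h1
    have hs : s = 0 := (mul_eq_zero.1 h3).resolve_right (hxy 0)
    exact ⟨hs, by rwa [hs, zero_add] at h1⟩
  have hfin : ∃ c d : ℝ, c ≠ 0 ∧ d ≠ 0 ∧ SlidingConnected (e + x 0 • h) (e + y 0 • h)
      (c • (e + x 1 • h)) (d • (e + y 1 • h)) := by
    rcases notMem_uIcc_or hord with ⟨h0, h1⟩ | ⟨h0, h1⟩
    · exact slidingConnected_of_notMem hl hxI hyI h0 h1
    · obtain ⟨c, d, hc, hd, hs⟩ := slidingConnected_of_notMem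
        (LinearIndependent.pair_symm_iff.1 hl) hyI hxI h0 h1
      exact ⟨d, c, hd, hc, hs.swap⟩
  obtain ⟨c, d, hc, hd, hs⟩ := hfin
  rw [← (hx 0).2, ← (hy 0).2, ← (hx 1).2, ← (hy 1).2, smul_smul, smul_smul] at hs
  exact ⟨_, _, _, _, inv_ne_zero (hx 0).1, inv_ne_zero (hy 0).1,
    mul_ne_zero hc (inv_ne_zero (hx 1).1), mul_ne_zero hd (inv_ne_zero (hy 1).1), hs⟩

/-! ### The action on lifted paths -/

theorem coe_transform (g : GL (Fin 3) ℝ) (f : TernaryForm) :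
    (transform g f).1 = cong (g⁻¹ : GL (Fin 3) ℝ).1 f.1 := rfl

theorem transform_inv_transform (g : GL (Fin 3) ℝ) (f : TernaryForm) :
    transform g⁻¹ (transform g f) = f := by
  rw [← LinearMap.comp_apply, ← transform_mul, inv_mul_cancel, transform_one, LinearMap.id_apply]

theorem disc_transform_ne_zero (g : GL (Fin 3) ℝ) {f : TernaryForm} (hf : f.disc ≠ 0) :
    (transform g f).disc ≠ 0 := by
  have h : (g⁻¹ : GL (Fin 3) ℝ).1.det ≠ 0 :=
    ((Matrix.isUnit_iff_isUnit_det _).1 (g⁻¹).isUnit).ne_zero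
  change ((g⁻¹ : GL (Fin 3) ℝ).1ᵀ * f.1 * (g⁻¹ : GL (Fin 3) ℝ).1).det ≠ 0
  rw [Matrix.det_mul, Matrix.det_mul, Matrix.det_transpose]
  exact mul_ne_zero (mul_ne_zero h hf) h

theorem linearIndependent_transform (g : GL (Fin 3) ℝ) {f h : TernaryForm}
    (hl : LinearIndependent ℝ ![f, h]) :
    LinearIndependent ℝ ![transform g f, transform g h] := by
  have e : ![transform g f, transform g h] = transform g ∘ ![f, h] := by
    funext i
    fin_cases i <;> rfl
  rw [e]
  exact hl.map' (transform g) (LinearMap.ker_eq_bot.2 (transform_injective g))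

theorem IsEquation.transform {f : TernaryForm} {C : Conic} (h : IsEquation f C)
    (g : GL (Fin 3) ℝ) : IsEquation (transform g f) (g • C) := by
  obtain ⟨hf, rfl⟩ := h
  exact ⟨(map_ne_zero_iff _ (transform_injective g)).2 hf, rfl⟩

theorem IsEquation.eq {f : TernaryForm} {C D : Conic} (h : IsEquation f C) (h' : IsEquation f D) :
    C = D := by
  obtain ⟨_, rfl⟩ := h
  obtain ⟨_, rfl⟩ := h'
  rfl

theorem continuous_transform {T : Type*} [TopologicalSpace T] {G : T → GL (Fin 3) ℝ}
    (hG : Continuous G) {f : T → TernaryForm} (hf : Continuous f) :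
    Continuous fun t => transform (G t) (f t) := by
  refine Continuous.subtype_mk ?_ _
  have h1 : Continuous fun t => ((G t)⁻¹ : GL (Fin 3) ℝ).1 := Units.continuous_val.comp hG.inv
  exact (h1.matrix_transpose.mul (continuous_subtype_val.comp hf)).mul h1

theorem continuous_mkOfDetNeZero {T : Type*} [TopologicalSpace T]
    {a : T → Matrix (Fin 3) (Fin 3) ℝ} (ha : Continuous a) (hdet : ∀ t, (a t).det ≠ 0) :
    Continuous fun t => Matrix.GeneralLinearGroup.mkOfDetNeZero (a t) (hdet t) := by
  refine Units.continuous_iff.2 ⟨ha, ?_⟩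
  simp only [Matrix.coe_units_inv]
  exact continuous_iff_continuousAt.2 fun t => continuousAt_matrix_inv ha.continuousAt (hdet t)

theorem coe_mem_pen_iff {f g w : TernaryForm} :
    w.1 ∈ pen f.1 g.1 ↔ w ∈ Submodule.span ℝ {f, g} := by
  rw [pen, Submodule.mem_span_pair, Submodule.mem_span_pair]
  simp only [← Subtype.coe_inj]
  rfl

theorem pen_eq_of_mem {f g u v : TernaryForm} (hfg : LinearIndependent ℝ ![f, g])
    (huv : LinearIndependent ℝ ![u, v]) (hu : u ∈ Submodule.span ℝ {f, g})
    (hv : v ∈ Submodule.span ℝ {f, g}) : pen u.1 v.1 = pen f.1 g.1 := by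
  refine Submodule.eq_of_le_of_finrank_le ?_ ?_
  · rw [pen, Submodule.span_le]
    rintro _ (rfl | rfl)
    · exact coe_mem_pen_iff.2 hu
    · exact coe_mem_pen_iff.2 hv
  · rw [finrank_pen (linearIndependent_coe.2 hfg), finrank_pen (linearIndependent_coe.2 huv)]

theorem IsEquation.memPencil {f : TernaryForm} {C : Conic} (h : IsEquation f C)
    {W : Submodule ℝ TernaryForm} (hf : f ∈ W) : C.MemPencil W := by
  obtain ⟨hf0, rfl⟩ := h
  rw [Conic.MemPencil, Projectivization.submodule_mk]
  exact (Submodule.span_singleton_le_iff_mem _ _).2 hf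

theorem span_pair_smul_le {f g : TernaryForm} (a b : ℝ) :
    Submodule.span ℝ {a • f, b • g} ≤ Submodule.span ℝ {f, g} := by
  rw [Submodule.span_le]
  rintro _ (rfl | rfl)
  · exact Submodule.smul_mem _ _ (Submodule.subset_span (by simp))
  · exact Submodule.smul_mem _ _ (Submodule.subset_span (by simp))

end

end ConicPairs

/-! ### Assembly of the group path and the slidings. -/

theorem mainTheorem5 (C₀ D₀ C₁ D₁ : ConicPairs.Conic)
    (h₀ : ConicPairs.IsDistinctProper (C₀, D₀)) (h₁ : ConicPairs.IsDistinctProper (C₁, D₁))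
    (hC₀ : C₀.IsNonempty) (hD₀ : D₀.IsNonempty) (hC₁ : C₁.IsNonempty) (hD₁ : D₁.IsNonempty)
    (h : ConicPairs.RigidlyIsotopic (C₀, D₀) (C₁, D₁)) :
    ∃ (α : C(unitInterval, ConicPairs.PGL3))
      (s : C(unitInterval, ConicPairs.Conic × ConicPairs.Conic))
      (γ : Path (C₀, D₀) (C₁, D₁)),
      α 0 = 1 ∧
      ConicPairs.IsSlidingSequence s ∧
      (∃ W : Submodule ℝ ConicPairs.TernaryForm, Module.finrank ℝ W = 2 ∧
        ∀ t, (s t).1.MemPencil W ∧ (s t).2.MemPencil W) ∧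
      ConicPairs.IsRigidIsotopy γ ∧
      ∀ t, γ t = α t • s t := by
  open ConicPairs in
  obtain ⟨γ₀, hγ₀⟩ := h
  obtain ⟨f, g, hf, hg, heq, a, ha, ha0, hcong⟩ := hγ₀.exists_lift
  have hdet := fun t => (hcong t).1
  obtain ⟨G, hG⟩ : ∃ G : unitInterval → GL (Fin 3) ℝ, ∀ t, G t =
    Matrix.GeneralLinearGroup.mkOfDetNeZero (a t) (hdet t) := ⟨_, fun _ => rfl⟩
  have hGc : Continuous G := by
    rw [funext hG]
    exact continuous_mkOfDetNeZero ha hdet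
  have hGa : ∀ t, (G t).1 = a t := fun t => by rw [hG]; rfl
  have hG0 : G 0 = 1 := Units.ext (by rw [hGa, ha0]; rfl)
  have hpenG : ∀ t, (pen (f 0).1 (g 0).1).map (cong (G t).1) = pen (f t).1 (g t).1 := fun t => by
    rw [hGa]
    exact (hcong t).2
  have hfd : ∀ t, (f t).disc ≠ 0 := fun t => (heq t).1.disc_ne_zero_iff.2 (hγ₀.1 t).2.1
  have hgd : ∀ t, (g t).disc ≠ 0 := fun t => (heq t).2.disc_ne_zero_iff.2 (hγ₀.1 t).2.2
  have hli : ∀ t, LinearIndependent ℝ ![f t, g t] := fun t =>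
    (linearIndependent_iff_ne (heq t).1 (heq t).2).2 (hγ₀.1 t).1
  -- `transform (G t)` is the congruence by the inverse of `G t`, so it brings the pencil at time
  -- `t` back to the initial one. The pulled-back couple moves in a fixed pencil.
  have hback : ∀ t (w : TernaryForm), w.1 ∈ pen (f t).1 (g t).1 →
      transform (G t) w ∈ Submodule.span ℝ {f 0, g 0} := by
    intro t w hw
    rw [← hpenG] at hw
    obtain ⟨M, hM, hMw⟩ := hw
    rw [← coe_mem_pen_iff, coe_transform, ← hMw, cong_cong, ← Units.val_mul, mul_inv_cancel,
      Units.val_one, cong_one]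
    exact hM
  have hu0 : transform (G 0) (f 0) = f 0 := by rw [hG0, transform_one, LinearMap.id_apply]
  have hv0 : transform (G 0) (g 0) = g 0 := by rw [hG0, transform_one, LinearMap.id_apply]
  obtain ⟨x, y, x', y', hx, hy, hx', hy', s, U, V, hs, hU, hV, hUV, hU0, hV0, hU1, hV1⟩ :=
    exists_slidingConnected (continuous_transform hGc hf) (continuous_transform hGc hg)
      (fun t => disc_transform_ne_zero _ (hfd t)) (fun t => disc_transform_ne_zero _ (hgd t))
      (fun t => linearIndependent_transform _ (hli t))
      (fun t => by
        rw [hu0, hv0]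
        exact hback t _ (Submodule.subset_span (by simp)))
      (fun t => by
        rw [hu0, hv0]
        exact hback t _ (Submodule.subset_span (by simp)))
  rw [hu0] at hU0
  rw [hv0] at hV0
  have hUW : ∀ t, U t ∈ Submodule.span ℝ {f 0, g 0} ∧ V t ∈ Submodule.span ℝ {f 0, g 0} := by
    intro t
    obtain ⟨-, -, -, -, -, h1, h2⟩ := hUV t
    rw [hu0, hv0] at h1 h2
    exact ⟨span_pair_smul_le _ _ h1, span_pair_smul_le _ _ h2⟩
  -- The group path is the inverse of `G`, undoing the pull-back. At time 1 the slidings end at the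
  -- pulled-back final couple, which `(G 1)⁻¹` returns to its place.
  have hE1 : ∀ t, IsEquation (transform (G t)⁻¹ (U t)) ((G t)⁻¹ • (s t).1) := fun t =>
    (hUV t).1.transform _
  have hE2 : ∀ t, IsEquation (transform (G t)⁻¹ (V t)) ((G t)⁻¹ • (s t).2) := fun t =>
    (hUV t).2.1.transform _
  have hc : Continuous fun t => ((G t)⁻¹ • (s t).1, (G t)⁻¹ • (s t).2) :=
    (continuous_of_isEquation (continuous_transform hGc.inv hU) hE1).prodMk
      (continuous_of_isEquation (continuous_transform hGc.inv hV) hE2)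
  have hsrc : ((G 0)⁻¹ • (s 0).1, (G 0)⁻¹ • (s 0).2) = (C₀, D₀) := by
    have e1 := hE1 0
    have e2 := hE2 0
    rw [hG0, inv_one, transform_one, LinearMap.id_apply] at e1 e2
    rw [hU0] at e1
    rw [hV0] at e2
    have h1 := (heq 0).1.smul hx
    have h2 := (heq 0).2.smul hy
    rw [γ₀.source] at h1 h2
    rw [hG0, inv_one]
    exact Prod.ext (e1.eq h1) (e2.eq h2)
  have htgt : ((G 1)⁻¹ • (s 1).1, (G 1)⁻¹ • (s 1).2) = (C₁, D₁) := by
    have e1 := hE1 1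
    have e2 := hE2 1
    rw [hU1, map_smul, transform_inv_transform] at e1
    rw [hV1, map_smul, transform_inv_transform] at e2
    have h1 := (heq 1).1.smul hx'
    have h2 := (heq 1).2.smul hy'
    rw [γ₀.target] at h1 h2
    exact Prod.ext (e1.eq h1) (e2.eq h2)
  -- The couple reached by the slidings still spans the initial pencil, so after the group action
  -- its pencil is congruent to that one by `G t`. This makes the intersection numbers constant.
  have hpen : ∀ t, couplePen ((G t)⁻¹ • (s t).1, (G t)⁻¹ • (s t).2) =
      (couplePen (C₀, D₀)).map (cong (G t).1) := by
    intro t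
    have h1 := (heq 0).1
    have h2 := (heq 0).2
    rw [γ₀.source] at h1 h2
    rw [couplePen_eq (hE1 t) (hE2 t), couplePen_eq h1 h2, coe_transform, coe_transform, inv_inv,
      ← map_cong_pen, pen_eq_of_mem (hli 0) (hUV t).2.2.2.2.1 (hUW t).1 (hUW t).2]
  refine ⟨⟨fun t => Matrix.ProjGenLinGroup.mk (G t)⁻¹, continuous_quotient_mk'.comp hGc.inv⟩, s,
    ⟨⟨_, hc⟩, hsrc, htgt⟩, ?_, hs, ⟨Submodule.span ℝ {f 0, g 0}, ?_, fun t =>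
      ⟨(hUV t).1.memPencil (hUW t).1, (hUV t).2.1.memPencil (hUW t).2⟩⟩,
    ⟨fun t => ⟨?_, ?_, ?_⟩, fun t m => ⟨?_, ?_⟩⟩, fun t => rfl⟩
  · change Matrix.ProjGenLinGroup.mk (G 0)⁻¹ = 1
    rw [hG0, inv_one, map_one]
  · have := finrank_span_eq_card (hli 0)
    rwa [Matrix.range_cons_cons_empty, Fintype.card_fin] at this
  · exact (linearIndependent_iff_ne (hE1 t) (hE2 t)).1
      (linearIndependent_transform _ (hUV t).2.2.2.2.1)
  · exact (hE1 t).disc_ne_zero_iff.1 (disc_transform_ne_zero _ (hUV t).2.2.1)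
  · exact (hE2 t).disc_ne_zero_iff.1 (disc_transform_ne_zero _ (hUV t).2.2.2.1)
  · exact numReal_of_map_cong (G t) (hpen t) m
  · exact numImaginary_of_map_cong (G t) (hpen t) m
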